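/- Let $\Lambda\subset\mathbb{R}^2$ be a discrete subgroup and let $M$ be a bounded domain with its smooth (possibly empty) boundary included in the flat surface $\mathbb{R}^2/\Lambda$, i.e. $M\subset\mathbb{R}^2/\Lambda$ is compact, has connected non-empty interior, and is locally $\{\rho\le 0\}$ near each of its boundary points, with $\rho$ smooth and $d\rho\neq 0$ there. (For $\Lambda=\{0\}$ this is a bounded planar domain such as the disk; the periodic channel $\mathbb{T}\times[0,1]$ and the flat torus $\mathbb{T}^2$ are the cases $\Lambda\cong\mathbb{Z}$ and $\Lambda\cong\mathbb{Z}^2$.) Let $X=\{\omega\in L^\infty(M):\|\omega\|_{L^\infty(M)}\le 1\}$. For $\omega_0\in X$ let $\mathcal{O}_{\omega_0}=\{\omega_0\circ\varphi\}$, where $\varphi$ ranges over the identity component of the group of smooth area-preserving diffeomorphisms of $M$ (those joined to the identity by a smooth isotopy of area-preserving diffeomorphisms), and let $\overline{\mathcal{O}_{\omega_0}}^{*}$ be its closure in the weak-$*$ topology of $L^\infty(M)=L^1(M)^*$. Proposition A.1. Let $\omega_0\in X$ be of the form $\omega_0=\sum_{i=1}^N a_i\chi_{A_i}$ a.e.,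 where $a_1,\dots,a_N\in\mathbb{R}$ are pairwise distinct and $A_1,\dots,A_N\subset M$ are measurable, pairwise disjoint and cover $M$, up to null sets. Then $$\overline{\mathcal{O}_{\omega_0}}^{*}=\Big\{\omega\in X:\ \int_M\omega=\int_M\omega_0,\quad \int_M(\omega-a_i)_+\le\int_M(\omega_0-a_i)_+\ \text{ for all } i=1,\dots,N\Big\},$$ where $(s)_+=\max\{s,0\}$. -/

import Mathlib

open MeasureTheory Set Filter
open scoped Topology

noncomputable section

namespace VortexPatch

/-- The Euclidean plane. -/
abbrev Plane : Type := EuclideanSpace ℝ (Fin 2)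

/-- The flat surface `ℝ² / Λ`. For a discrete subgroup `Λ` of rank `0`, `1`, `2` this is the plane,
a flat cylinder, a flat torus. -/
abbrev Surface (Λ : AddSubgroup Plane) : Type := Plane ⧸ Λ

/-- The projection `ℝ² → ℝ² / Λ`; its local inverses are the charts of the flat surface. -/
abbrev proj (Λ : AddSubgroup Plane) (x : Plane) : Surface Λ := QuotientAddGroup.mk x

/-- The Dirichlet domain of `Λ`: the points for which `0` is a closest point of `Λ`. Its translates
by a discrete `Λ` cover the plane and overlap only in null sets. -/
def dirichletDomain (Λ : AddSubgroup Plane) : Set Plane :=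
  {x | ∀ v ∈ Λ, ‖x‖ ≤ ‖x - v‖}

/-- The area measure of the flat surface `ℝ² / Λ`: Lebesgue measure of a fundamental domain. -/
def surfaceArea (Λ : AddSubgroup Plane) : Measure (Surface Λ) :=
  Measure.map (proj Λ) (volume.restrict (dirichletDomain Λ))

/-- The area measure on a subset `M` of the flat surface, as a measure on the type `M`. -/
def area {Λ : AddSubgroup Plane} (M : Set (Surface Λ)) : Measure M :=
  Measure.comap Subtype.val (surfaceArea Λ)

section Smoothness

open scoped ContDiff

/-- `M` is a bounded domain, with its (possibly empty) smooth boundary included: a compact set with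
connected nonempty interior which, near each of its boundary points, is the sublevel set `{ρ ≤ 0}`,
in a chart, of a smooth function `ρ` with non-vanishing differential. -/
structure IsSmoothDomain {Λ : AddSubgroup Plane} (M : Set (Surface Λ)) : Prop where
  isCompact : IsCompact M
  isConnected_interior : IsConnected (interior M)
  smooth_boundary : ∀ p : Plane, proj Λ p ∈ frontier M →
    ∃ ρ : Plane → ℝ, ContDiff ℝ ∞ ρ ∧ fderiv ℝ ρ p ≠ 0 ∧ ∀ᶠ x in 𝓝 p, (proj Λ x ∈ M ↔ ρ x ≤ 0)

variable {Λ : AddSubgroup Plane} {M : Set (Surface Λ)}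

/-- `f : M → M` is smooth (up to the boundary): in charts it is given by smooth maps. -/
def IsSmoothMap (f : M → M) : Prop :=
  ∀ p : Plane, proj Λ p ∈ M → ∃ U ∈ 𝓝 p, ∃ F : Plane → Plane,
    ContDiffOn ℝ ∞ F (U ∩ proj Λ ⁻¹' M) ∧
      ∀ x ∈ U, ∀ hx : proj Λ x ∈ M, (f ⟨proj Λ x, hx⟩ : Surface Λ) = proj Λ (F x)

/-- The family `f t : M → M`, `t ∈ [0, 1]`, is smooth jointly in `(t, x)`. -/
def IsSmoothFamily (f : ℝ → M → M) : Prop :=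
  ∀ t ∈ Icc (0 : ℝ) 1, ∀ p : Plane, proj Λ p ∈ M → ∃ U ∈ 𝓝 (t, p), ∃ F : ℝ × Plane → Plane,
    ContDiffOn ℝ ∞ F (U ∩ Icc (0 : ℝ) 1 ×ˢ (proj Λ ⁻¹' M)) ∧
      ∀ s ∈ Icc (0 : ℝ) 1, ∀ x : Plane, (s, x) ∈ U → ∀ hx : proj Λ x ∈ M,
        (f s ⟨proj Λ x, hx⟩ : Surface Λ) = proj Λ (F (s, x))

/-- `φ` is an area preserving diffeomorphism of `M`. -/
structure IsAreaPreservingDiffeo (φ : M ≃ₜ M) : Prop where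
  smooth : IsSmoothMap φ
  smooth_symm : IsSmoothMap φ.symm
  measurePreserving : MeasurePreserving φ (area M) (area M)

/-- The identity component of the group of area preserving diffeomorphisms of `M`: the
diffeomorphisms that a smooth isotopy of area preserving diffeomorphisms joins to the identity. -/
def identityComponent (M : Set (Surface Λ)) : Set (M ≃ₜ M) :=
  {φ | ∃ Φ : ℝ → (M ≃ₜ M), (∀ t ∈ Icc (0 : ℝ) 1, IsAreaPreservingDiffeo (Φ t)) ∧
    IsSmoothFamily (fun t => (Φ t : M → M)) ∧ Φ 0 = Homeomorph.refl M ∧ Φ 1 = φ}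

end Smoothness

section Orbit

variable {Λ : AddSubgroup Plane} {M : Set (Surface Λ)}

/-- The phase space: the closed unit ball of `L^∞(M)`. -/
def phaseSpace (M : Set (Surface Λ)) : Set (Lp ℝ ⊤ (area M)) :=
  {ω | ‖ω‖ ≤ 1}

/-- The orbit `{ω₀ ∘ φ}` of `ω₀` under the area preserving diffeomorphisms `φ` in the identity
component. -/
def orbit (ω₀ : Lp ℝ ⊤ (area M)) : Set (Lp ℝ ⊤ (area M)) :=
  {ω | ∃ φ ∈ identityComponent M, ω =ᵐ[area M] fun x => ω₀ (φ x)}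

end Orbit

/-- The weak-* topology on `L^∞(μ)`: the coarsest one for which `ω ↦ ∫ g ω dμ` is continuous for
every `g ∈ L¹(μ)`. -/
@[reducible]
def weakStarTopology {α : Type*} [MeasurableSpace α] (μ : Measure α) :
    TopologicalSpace (Lp ℝ ⊤ μ) :=
  TopologicalSpace.induced (fun ω (g : Lp ℝ 1 μ) => ∫ x, g x * ω x ∂μ) inferInstance

/-- The closure of a subset of `L^∞(μ)` in the weak-* topology. -/
def weakStarClosure {α : Type*} [MeasurableSpace α] {μ : Measure α} (S : Set (Lp ℝ ⊤ μ)) :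
    Set (Lp ℝ ⊤ μ) :=
  @closure _ (weakStarTopology μ) S

end VortexPatch

end

open VortexPatch

noncomputable section

namespace VortexPatch

open scoped ContDiff Pointwise

/-! ### An area preserving twist of the square -/

/-! One inclusion is soft. Area preserving maps leave every integral `∫ F(ω₀)` unchanged, and `ω ↦ ∫
(ω - s)₊` is a supremum of weak-* continuous affine functionals. Hence the mean, the inequalities at
every level `s` and the bound `|ω| ≤ 1` pass to the closure (`weakStarClosure_orbit_subset`).

Conversely, the inequalities at the values `a i` imply those at all levels, because `s ↦ ∫ (ω₀ -
s)₊` is affine between consecutive values while `s ↦ ∫ (ω - s)₊` is convex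
(`integral_max_sub_le_of_forall_value`). So `ω` is majorized by `ω₀` in the sense of Hardy,
Littlewood and Pólya. Fill `M`, up to small area, with small cells of equal area. The averages `b i`
of `ω` over the cells are majorized, up to an error, by the values `c i` at the cells of a
continuous function that is `L¹`-close to `ω₀`. A Hahn–Banach argument makes `b` nearly an average
of `J` rearrangements `c ∘ σ j` (`exists_average_perm`). If each cell is cut into `J` equal strips
and strip `j` of cell `i` is carried into cell `σ j i`, the transported `ω₀` has nearly the averages
`b`. On fine cells this is weak-* closeness to `ω` (`mem_weakStarClosure_orbit`).

It remains to permute equal rectangles, off a set of small area, by diffeomorphisms in the identity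
component (`Approximable`). The building block is a twist of the disc: a rotation by an angle that
depends on the radius, equal to `π` except near the rim and to `0` at the rim. A parametrization
with constant Jacobian transfers it to a rectangle, where its time one map is nearly the point
reflection (`exists_box_twist`). Four reflections exchange two rectangles in a row by translations
(`approximable_cellSwap_row`). Conjugation chains exchanges together (`cellSwap_conj`),
connectedness of the interior carries them across `M` (`locallySwappable_of_mem_interior`), and
transpositions generate all permutations (`exists_approximable_perm`). -/

/-- The increasing function of the angle `θ` for which `sin θ` sweeps the unit disc at the rate at
which it sweeps the square `(-1, 1)²`, up to a constant. -/
def angleArea (θ : ℝ) : ℝ := (2 * θ + Real.sin (2 * θ)) / Real.pi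

lemma contDiff_angleArea : ContDiff ℝ ∞ angleArea := by
  unfold angleArea
  fun_prop

/-- The derivative vanishes at odd multiples of `π / 2`, so strictness is taken from `|sin u| < u`
with `u = y - x`, through the sum-to-product formula. -/
lemma strictMono_angleArea : StrictMono angleArea := by
  intro x y hxy
  have h1 : Real.sin (2 * y) - Real.sin (2 * x) = 2 * Real.sin (y - x) * Real.cos (y + x) := by
    rw [Real.sin_sub_sin]; ring_nf
  have h2 : |Real.sin (y - x)| < y - x := by
    have h := Real.abs_sin_lt_abs (x := y - x) (by linarith)
    rwa [abs_of_pos (sub_pos.2 hxy)] at h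
  have h3 : |2 * Real.sin (y - x) * Real.cos (y + x)| < 2 * (y - x) := by
    rw [abs_mul, abs_mul, abs_two]
    calc 2 * |Real.sin (y - x)| * |Real.cos (y + x)| ≤ 2 * |Real.sin (y - x)| * 1 := by
          gcongr; exact Real.abs_cos_le_one _
      _ < 2 * (y - x) := by linarith
  have h4 := (abs_lt.1 h3).1
  unfold angleArea
  apply div_lt_div_of_pos_right _ Real.pi_pos
  linarith

lemma surjective_angleArea : Function.Surjective angleArea := by
  have hπ := Real.pi_pos
  apply contDiff_angleArea.continuous.surjective
  · refine tendsto_atTop_mono (f := fun θ => (2 * θ - 1) / Real.pi) (fun θ => ?_) ?_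
    · unfold angleArea
      gcongr
      linarith [Real.neg_one_le_sin (2 * θ)]
    · apply Tendsto.atTop_div_const hπ
      apply tendsto_atTop_add_const_right
      exact tendsto_id.const_mul_atTop two_pos
  · have h (θ : ℝ) : angleArea θ ≤ (2 * θ + 1) / Real.pi := by
      unfold angleArea
      gcongr
      linarith [Real.sin_le_one (2 * θ)]
    refine tendsto_atBot_mono h ?_
    apply Tendsto.atBot_div_const hπ
    apply tendsto_atBot_add_const_right
    exact tendsto_id.const_mul_atBot two_pos

lemma angleArea_neg (θ : ℝ) : angleArea (-θ) = -angleArea θ := by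
  unfold angleArea
  rw [mul_neg, Real.sin_neg]; ring

lemma angleArea_pi_div_two : angleArea (Real.pi / 2) = 1 := by
  unfold angleArea
  rw [mul_div_cancel₀ _ two_ne_zero, Real.sin_pi, add_zero, div_self Real.pi_ne_zero]

lemma hasDerivAt_angleArea (θ : ℝ) :
    HasDerivAt angleArea (4 * Real.cos θ ^ 2 / Real.pi) θ := by
  have h : HasDerivAt (fun θ : ℝ => (2 * θ + Real.sin (2 * θ)) / Real.pi)
      ((2 * 1 + Real.cos (2 * θ) * (2 * 1)) / Real.pi) θ :=
    (((hasDerivAt_id θ).const_mul 2).add (((hasDerivAt_id θ).const_mul 2).sin)).div_const _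
  refine HasDerivAt.congr_deriv h ?_
  rw [Real.cos_two_mul]; ring

/-- `angleArea` as a homeomorphism of the line. -/
def angleAreaHomeo : ℝ ≃ₜ ℝ :=
  (strictMono_angleArea.orderIsoOfSurjective _ surjective_angleArea).toHomeomorph

/-- The inverse of `angleArea`. -/
def squareAngle (y : ℝ) : ℝ := angleAreaHomeo.symm y

lemma angleArea_squareAngle (y : ℝ) : angleArea (squareAngle y) = y :=
  angleAreaHomeo.apply_symm_apply y

lemma squareAngle_angleArea (θ : ℝ) : squareAngle (angleArea θ) = θ :=
  angleAreaHomeo.symm_apply_apply θ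

lemma continuous_squareAngle : Continuous squareAngle := angleAreaHomeo.symm.continuous

lemma squareAngle_neg (y : ℝ) : squareAngle (-y) = -squareAngle y := by
  apply strictMono_angleArea.injective
  rw [angleArea_squareAngle, angleArea_neg, angleArea_squareAngle]

lemma squareAngle_lt_iff {y θ : ℝ} : squareAngle y < θ ↔ y < angleArea θ := by
  conv_rhs => rw [← angleArea_squareAngle y]
  exact strictMono_angleArea.lt_iff_lt.symm

lemma lt_squareAngle_iff {y θ : ℝ} : θ < squareAngle y ↔ angleArea θ < y := by
  conv_rhs => rw [← angleArea_squareAngle y]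
  exact strictMono_angleArea.lt_iff_lt.symm

lemma squareAngle_mem {y : ℝ} (hy : y ∈ Ioo (-1 : ℝ) 1) :
    squareAngle y ∈ Ioo (-(Real.pi / 2)) (Real.pi / 2) := by
  refine ⟨?_, ?_⟩
  · rw [lt_squareAngle_iff, angleArea_neg, angleArea_pi_div_two]; exact hy.1
  · rw [squareAngle_lt_iff, angleArea_pi_div_two]; exact hy.2

lemma cos_squareAngle_pos {y : ℝ} (hy : y ∈ Ioo (-1 : ℝ) 1) : 0 < Real.cos (squareAngle y) :=
  Real.cos_pos_of_mem_Ioo (squareAngle_mem hy)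

lemma squareAngle_one : squareAngle 1 = Real.pi / 2 := by
  rw [← angleArea_pi_div_two, squareAngle_angleArea]

/-- Smoothness stops at `±1`, where the derivative of `angleArea` vanishes. This does no harm, as
the twist will be the identity near the boundary of the square. -/
lemma contDiffAt_squareAngle {y : ℝ} (hy : y ∈ Ioo (-1 : ℝ) 1) :
    ContDiffAt ℝ ∞ squareAngle y := by
  have hpos := cos_squareAngle_pos hy
  refine OpenPartialHomeomorph.contDiffAt_symm_deriv angleAreaHomeo.toOpenPartialHomeomorph
    (f₀' := 4 * Real.cos (squareAngle y) ^ 2 / Real.pi) (by have := Real.pi_pos; positivity)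
    (mem_univ y) (hasDerivAt_angleArea _) contDiff_angleArea.contDiffAt

lemma hasDerivAt_squareAngle {y : ℝ} (hy : y ∈ Ioo (-1 : ℝ) 1) :
    HasDerivAt squareAngle (Real.pi / (4 * Real.cos (squareAngle y) ^ 2)) y := by
  have hpos := cos_squareAngle_pos hy
  have := HasDerivAt.of_local_left_inverse (f := angleArea) (g := squareAngle)
    continuous_squareAngle.continuousAt (hasDerivAt_angleArea (squareAngle y))
    (by have := Real.pi_pos; positivity) (Eventually.of_forall angleArea_squareAngle)
  rwa [inv_div] at this

/-- The open square `(-1, 1)²`. -/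
def unitSquare : Set (ℝ × ℝ) := Ioo (-1) 1 ×ˢ Ioo (-1) 1

lemma isOpen_unitSquare : IsOpen unitSquare := isOpen_Ioo.prod isOpen_Ioo

/-- The map of the square onto the unit disc, with constant Jacobian. -/
def squareToDisc (x : ℝ × ℝ) : ℝ × ℝ :=
  (x.1 * Real.cos (squareAngle x.2), Real.sin (squareAngle x.2))

/-- The inverse of `squareToDisc`. -/
def discToSquare (w : ℝ × ℝ) : ℝ × ℝ :=
  (w.1 / Real.cos (Real.arcsin w.2), angleArea (Real.arcsin w.2))

/-- The squared Euclidean norm on `ℝ × ℝ`. -/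
def radiusSq (w : ℝ × ℝ) : ℝ := w.1 ^ 2 + w.2 ^ 2

/-- This factorization expresses closeness to the rim of the disc in the coordinates of the square.
It governs the support of the twist and the collar where the twist is not a reflection. -/
lemma one_sub_radiusSq_squareToDisc (x : ℝ × ℝ) :
    1 - radiusSq (squareToDisc x) = (1 - x.1 ^ 2) * Real.cos (squareAngle x.2) ^ 2 := by
  simp only [radiusSq, squareToDisc]
  linear_combination -Real.sin_sq_add_cos_sq (squareAngle x.2)

lemma radiusSq_squareToDisc_lt {x : ℝ × ℝ} (hx : x ∈ unitSquare) :
    radiusSq (squareToDisc x) < 1 := by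
  have h := one_sub_radiusSq_squareToDisc x
  have h1 : 0 < 1 - x.1 ^ 2 := by nlinarith [hx.1.1, hx.1.2]
  have h2 := cos_squareAngle_pos hx.2
  have : 0 < (1 - x.1 ^ 2) * Real.cos (squareAngle x.2) ^ 2 := by positivity
  linarith

lemma arcsin_mem {w : ℝ × ℝ} (hw : radiusSq w < 1) :
    w.2 ∈ Ioo (-1 : ℝ) 1 ∧ Real.arcsin w.2 ∈ Ioo (-(Real.pi / 2)) (Real.pi / 2) ∧
      0 < Real.cos (Real.arcsin w.2) := by
  have h2 : w.2 ∈ Ioo (-1 : ℝ) 1 := by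
    have : |w.2| < 1 := by
      rw [← sq_lt_one_iff_abs_lt_one]; unfold radiusSq at hw; nlinarith [sq_nonneg w.1]
    exact abs_lt.1 this
  have h3 : Real.arcsin w.2 ∈ Ioo (-(Real.pi / 2)) (Real.pi / 2) :=
    ⟨Real.neg_pi_div_two_lt_arcsin.2 h2.1, Real.arcsin_lt_pi_div_two.2 h2.2⟩
  exact ⟨h2, h3, Real.cos_pos_of_mem_Ioo h3⟩

lemma discToSquare_squareToDisc {x : ℝ × ℝ} (hx : x ∈ unitSquare) :
    discToSquare (squareToDisc x) = x := by
  have h := squareAngle_mem hx.2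
  have h2 := cos_squareAngle_pos hx.2
  simp only [discToSquare, squareToDisc]
  rw [Real.arcsin_sin h.1.le h.2.le, angleArea_squareAngle, mul_div_cancel_right₀ _ h2.ne']

lemma squareToDisc_discToSquare {w : ℝ × ℝ} (hw : radiusSq w < 1) :
    squareToDisc (discToSquare w) = w := by
  obtain ⟨h1, h2, h3⟩ := arcsin_mem hw
  simp only [discToSquare, squareToDisc]
  rw [squareAngle_angleArea, Real.sin_arcsin h1.1.le h1.2.le, div_mul_cancel₀ _ h3.ne']

lemma discToSquare_mem {w : ℝ × ℝ} (hw : radiusSq w < 1) : discToSquare w ∈ unitSquare := by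
  obtain ⟨h1, h2, h3⟩ := arcsin_mem hw
  refine ⟨?_, ?_, ?_⟩
  · have h4 := one_sub_radiusSq_squareToDisc (discToSquare w)
    rw [squareToDisc_discToSquare hw] at h4
    have h5 : 0 < 1 - (discToSquare w).1 ^ 2 := by
      by_contra! hcon
      nlinarith [sq_nonneg (Real.cos (squareAngle (discToSquare w).2))]
    exact abs_lt.1 ((sq_lt_one_iff_abs_lt_one _).1 (by linarith))
  · show -1 < angleArea (Real.arcsin w.2)
    rw [← angleArea_pi_div_two, ← angleArea_neg]
    exact strictMono_angleArea h2.1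
  · show angleArea (Real.arcsin w.2) < 1
    rw [← angleArea_pi_div_two]
    exact strictMono_angleArea h2.2

lemma squareToDisc_neg (x : ℝ × ℝ) : squareToDisc (-x) = -squareToDisc x := by
  simp [squareToDisc, squareAngle_neg]

lemma contDiffAt_squareToDisc {x : ℝ × ℝ} (hx : x ∈ unitSquare) :
    ContDiffAt ℝ ∞ squareToDisc x := by
  have h : ContDiffAt ℝ ∞ (fun x : ℝ × ℝ => squareAngle x.2) x :=
    (contDiffAt_squareAngle hx.2).comp x contDiffAt_snd
  exact (contDiffAt_fst.mul (Real.contDiff_cos.contDiffAt.comp x h)).prodMk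
    (Real.contDiff_sin.contDiffAt.comp x h)

lemma contDiffAt_discToSquare {w : ℝ × ℝ} (hw : radiusSq w < 1) :
    ContDiffAt ℝ ∞ discToSquare w := by
  obtain ⟨h1, h2, h3⟩ := arcsin_mem hw
  have h : ContDiffAt ℝ ∞ (fun x : ℝ × ℝ => Real.arcsin x.2) w :=
    (Real.contDiffAt_arcsin h1.1.ne' h1.2.ne).comp w contDiffAt_snd
  exact (contDiffAt_fst.div (Real.contDiff_cos.contDiffAt.comp w h) h3.ne').prodMk
    (contDiff_angleArea.contDiffAt.comp w h)

/-- The linear map of the plane with the given matrix. -/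
def planeMap (a b c d : ℝ) : ℝ × ℝ →L[ℝ] ℝ × ℝ :=
  (Matrix.toLin (Module.Basis.finTwoProd ℝ) (Module.Basis.finTwoProd ℝ)
    !![a, b; c, d]).toContinuousLinearMap

lemma planeMap_apply (a b c d : ℝ) (x : ℝ × ℝ) :
    planeMap a b c d x = (a * x.1 + b * x.2, c * x.1 + d * x.2) := by
  simp [planeMap, Matrix.toLin_finTwoProd_apply]

lemma det_planeMap (a b c d : ℝ) : (planeMap a b c d).det = a * d - b * c := by
  simp [planeMap, LinearMap.det_toLin, Matrix.det_fin_two_of]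

/-- The differential is upper triangular; the vertical speed compensates for the width `cos θ` of
the disc at height `sin θ`. The constant is the ratio of the areas `π` and `4`. -/
lemma hasFDerivAt_squareToDisc {x : ℝ × ℝ} (hx : x ∈ unitSquare) :
    ∃ f' : ℝ × ℝ →L[ℝ] ℝ × ℝ, HasFDerivAt squareToDisc f' x ∧ f'.det = Real.pi / 4 := by
  have hpos := cos_squareAngle_pos hx.2
  set θ := squareAngle x.2 with hθ
  set d := Real.pi / (4 * Real.cos θ ^ 2) with hd
  refine ⟨planeMap (Real.cos θ) (x.1 * (-Real.sin θ * d)) 0 (Real.cos θ * d), ?_, ?_⟩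
  · have h : HasFDerivAt (fun x : ℝ × ℝ => squareAngle x.2)
        (d • ContinuousLinearMap.snd ℝ ℝ ℝ) x :=
      (hasDerivAt_squareAngle hx.2).comp_hasFDerivAt x hasFDerivAt_snd
    have h1 := (hasFDerivAt_fst (𝕜 := ℝ) (p := x)).mul ((Real.hasDerivAt_cos _).comp_hasFDerivAt x h)
    have h2 := (Real.hasDerivAt_sin _).comp_hasFDerivAt x h
    refine (h1.prodMk h2).congr_fderiv ?_
    ext <;> simp [planeMap_apply, ← hθ]
  · rw [det_planeMap, hd]
    field_simp
    ring

/-- The angle by which the points at squared distance `s` from the centre turn. -/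
def twistAngle (η s : ℝ) : ℝ := Real.pi * Real.smoothTransition ((1 - η - s) / η)

lemma contDiff_twistAngle (η : ℝ) : ContDiff ℝ ∞ (twistAngle η) := by
  unfold twistAngle
  exact contDiff_const.mul (Real.smoothTransition.contDiff.comp (by fun_prop))

/-- The twist of the disc. -/
def discTwist (η t : ℝ) (w : ℝ × ℝ) : ℝ × ℝ :=
  (w.1 * Real.cos (t * twistAngle η (radiusSq w)) - w.2 * Real.sin (t * twistAngle η (radiusSq w)),
    w.1 * Real.sin (t * twistAngle η (radiusSq w)) + w.2 * Real.cos (t * twistAngle η (radiusSq w)))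

lemma radiusSq_discTwist (η t : ℝ) (w : ℝ × ℝ) : radiusSq (discTwist η t w) = radiusSq w := by
  conv_lhs => rw [radiusSq]
  simp only [discTwist]
  set θ := t * twistAngle η (radiusSq w)
  rw [radiusSq]
  linear_combination (w.1 ^ 2 + w.2 ^ 2) * Real.sin_sq_add_cos_sq θ

/-- The angle depends only on the radius, which the rotation preserves, so successive angles add up
and the twist is a flow. -/
lemma discTwist_add (η s t : ℝ) (w : ℝ × ℝ) :
    discTwist η (s + t) w = discTwist η s (discTwist η t w) := by
  conv_rhs => rw [discTwist, radiusSq_discTwist]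
  simp only [discTwist, add_mul, Real.cos_add, Real.sin_add]
  ext <;> simp only <;> ring

lemma discTwist_zero (η : ℝ) (w : ℝ × ℝ) : discTwist η 0 w = w := by simp [discTwist]

lemma discTwist_of_le {η : ℝ} (hη : 0 < η) (t : ℝ) {w : ℝ × ℝ} (hw : 1 - η ≤ radiusSq w) :
    discTwist η t w = w := by
  have : twistAngle η (radiusSq w) = 0 := by
    rw [twistAngle, Real.smoothTransition.zero_of_nonpos, mul_zero]
    exact div_nonpos_of_nonpos_of_nonneg (by linarith) hη.le
  simp [discTwist, this]

/-- The angle passes from `π` to `0` while the squared radius runs from `1 - 2η` to `1 - η`; inside,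
time one is a half turn. -/
lemma discTwist_one {η : ℝ} (hη : 0 < η) {w : ℝ × ℝ} (hw : radiusSq w ≤ 1 - 2 * η) :
    discTwist η 1 w = -w := by
  have : twistAngle η (radiusSq w) = Real.pi := by
    rw [twistAngle, Real.smoothTransition.one_of_one_le, mul_one]
    rw [le_div_iff₀ hη]; linarith
  ext <;> simp [discTwist, this]

lemma contDiff_discTwist (η : ℝ) : ContDiff ℝ ∞ fun p : ℝ × ℝ × ℝ => discTwist η p.1 p.2 := by
  have h : ContDiff ℝ ∞ fun p : ℝ × ℝ × ℝ => p.1 * twistAngle η (radiusSq p.2) :=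
    contDiff_fst.mul ((contDiff_twistAngle η).comp (by unfold radiusSq; fun_prop))
  unfold discTwist
  have hc := Real.contDiff_cos.comp h
  have hs := Real.contDiff_sin.comp h
  have h1 : ContDiff ℝ ∞ fun p : ℝ × ℝ × ℝ => p.2.1 := by fun_prop
  have h2 : ContDiff ℝ ∞ fun p : ℝ × ℝ × ℝ => p.2.2 := by fun_prop
  exact ((h1.mul hc).sub (h2.mul hs)).prodMk ((h1.mul hs).add (h2.mul hc))

/-- A rotation by an angle that varies with the radius only adds a shear along the circles, which
does not change the Jacobian. -/
lemma hasFDerivAt_discTwist (η t : ℝ) (w : ℝ × ℝ) :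
    ∃ f' : ℝ × ℝ →L[ℝ] ℝ × ℝ, HasFDerivAt (discTwist η t) f' w ∧ f'.det = 1 := by
  obtain ⟨g, hg⟩ : ∃ g, HasDerivAt (fun s => t * twistAngle η s) g (radiusSq w) :=
    ⟨_, (((contDiff_twistAngle η).differentiable (by simp)).differentiableAt.hasDerivAt).const_mul t⟩
  have hr : HasFDerivAt radiusSq ((2 * w.1) • ContinuousLinearMap.fst ℝ ℝ ℝ +
      (2 * w.2) • ContinuousLinearMap.snd ℝ ℝ ℝ) w := by
    have h := ((hasFDerivAt_fst (𝕜 := ℝ) (p := w)).pow 2).add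
      ((hasFDerivAt_snd (𝕜 := ℝ) (p := w)).pow 2)
    refine h.congr_fderiv ?_
    ext <;> simp
  have hθ := hg.comp_hasFDerivAt w hr
  have hc := (Real.hasDerivAt_cos _).comp_hasFDerivAt w hθ
  have hs := (Real.hasDerivAt_sin _).comp_hasFDerivAt w hθ
  set θ := t * twistAngle η (radiusSq w) with hθd
  have h1 := ((hasFDerivAt_fst (𝕜 := ℝ) (p := w)).mul hc).sub
    ((hasFDerivAt_snd (𝕜 := ℝ) (p := w)).mul hs)
  have h2 := ((hasFDerivAt_fst (𝕜 := ℝ) (p := w)).mul hs).add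
    ((hasFDerivAt_snd (𝕜 := ℝ) (p := w)).mul hc)
  set c := Real.cos θ
  set s := Real.sin θ
  set P := w.1 * c - w.2 * s with hP
  set Q := w.1 * s + w.2 * c with hQ
  refine ⟨planeMap (c - Q * (2 * w.1 * g)) (-s - Q * (2 * w.2 * g)) (s + P * (2 * w.1 * g))
    (c + P * (2 * w.2 * g)), ?_, ?_⟩
  · refine (h1.prodMk h2).congr_fderiv ?_
    ext <;> simp [planeMap_apply, hP, hQ, c, s, θ] <;> ring
  · rw [det_planeMap, hP, hQ]
    linear_combination (1 + (w.2 * c - s * w.1) * 0) * Real.sin_sq_add_cos_sq θ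

open Classical in
/-- The twist of the square. -/
def squareTwist (η t : ℝ) (x : ℝ × ℝ) : ℝ × ℝ :=
  if x ∈ unitSquare then discToSquare (discTwist η t (squareToDisc x)) else x

/-- The compact subset of the square outside which `squareTwist η` is the identity. -/
def twistSupport (η : ℝ) : Set (ℝ × ℝ) :=
  (Icc (-1) 1 ×ˢ Icc (-1) 1) ∩ {x | η ≤ (1 - x.1 ^ 2) * Real.cos (squareAngle x.2) ^ 2}

lemma isCompact_twistSupport (η : ℝ) : IsCompact (twistSupport η) := by
  refine (isCompact_Icc.prod isCompact_Icc).inter_right (isClosed_le continuous_const ?_)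
  have := continuous_squareAngle
  fun_prop

lemma twistSupport_subset {η : ℝ} (hη : 0 < η) : twistSupport η ⊆ unitSquare := by
  rintro ⟨x, y⟩ ⟨⟨⟨hx1, hx2⟩, ⟨hy1, hy2⟩⟩, h⟩
  simp only [mem_ofPred_eq] at hx1 hx2 hy1 hy2 h
  refine ⟨⟨lt_of_le_of_ne hx1 ?_, lt_of_le_of_ne hx2 ?_⟩,
    ⟨lt_of_le_of_ne hy1 ?_, lt_of_le_of_ne hy2 ?_⟩⟩ <;> rintro rfl <;> revert h <;>
    simp [squareAngle_neg, squareAngle_one, hη]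

lemma squareTwist_of_mem {η t : ℝ} {x : ℝ × ℝ} (hx : x ∈ unitSquare) :
    squareTwist η t x = discToSquare (discTwist η t (squareToDisc x)) := if_pos hx

lemma squareTwist_of_notMem {η : ℝ} (hη : 0 < η) (t : ℝ) {x : ℝ × ℝ} (hx : x ∉ twistSupport η) :
    squareTwist η t x = x := by
  by_cases h : x ∈ unitSquare
  · have h1 : (1 - x.1 ^ 2) * Real.cos (squareAngle x.2) ^ 2 < η := by
      by_contra! hcon
      exact hx ⟨⟨Ioo_subset_Icc_self h.1, Ioo_subset_Icc_self h.2⟩, hcon⟩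
    rw [squareTwist_of_mem h, discTwist_of_le hη, discToSquare_squareToDisc h]
    linarith [one_sub_radiusSq_squareToDisc x]
  · exact if_neg h

lemma squareTwist_mem {η t : ℝ} {x : ℝ × ℝ} (hx : x ∈ unitSquare) :
    squareTwist η t x ∈ unitSquare := by
  rw [squareTwist_of_mem hx]
  exact discToSquare_mem (by rw [radiusSq_discTwist]; exact radiusSq_squareToDisc_lt hx)

lemma squareToDisc_squareTwist {η t : ℝ} {x : ℝ × ℝ} (hx : x ∈ unitSquare) :
    squareToDisc (squareTwist η t x) = discTwist η t (squareToDisc x) := by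
  rw [squareTwist_of_mem hx, squareToDisc_discToSquare]
  rw [radiusSq_discTwist]; exact radiusSq_squareToDisc_lt hx

lemma squareTwist_zero (η : ℝ) (x : ℝ × ℝ) : squareTwist η 0 x = x := by
  by_cases h : x ∈ unitSquare
  · rw [squareTwist_of_mem h, discTwist_zero, discToSquare_squareToDisc h]
  · exact if_neg h

lemma squareTwist_add (η s t : ℝ) (x : ℝ × ℝ) :
    squareTwist η (s + t) x = squareTwist η s (squareTwist η t x) := by
  by_cases h : x ∈ unitSquare
  · rw [squareTwist_of_mem h, squareTwist_of_mem (squareTwist_mem h), squareToDisc_squareTwist h,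
      discTwist_add]
  · have h1 (r : ℝ) : squareTwist η r x = x := if_neg h
    rw [h1, h1, h1]

/-- Inside the square this is a composition of smooth maps. A point outside has a neighbourhood that
misses the compact set `twistSupport η`, and there the map is the identity. -/
lemma contDiff_squareTwist {η : ℝ} (hη : 0 < η) :
    ContDiff ℝ ∞ fun p : ℝ × ℝ × ℝ => squareTwist η p.1 p.2 := by
  rw [contDiff_iff_contDiffAt]
  rintro ⟨t, x⟩
  by_cases h : x ∈ unitSquare
  · have h1 : (fun p : ℝ × ℝ × ℝ => squareTwist η p.1 p.2) =ᶠ[𝓝 (t, x)]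
        fun p => discToSquare (discTwist η p.1 (squareToDisc p.2)) := by
      have : ∀ᶠ p : ℝ × ℝ × ℝ in 𝓝 (t, x), p.2 ∈ unitSquare :=
        continuous_snd.continuousAt.eventually (isOpen_unitSquare.mem_nhds h)
      filter_upwards [this] with p hp using squareTwist_of_mem hp
    refine ContDiffAt.congr_of_eventuallyEq ?_ h1
    have h2 : ContDiffAt ℝ ∞ (fun p : ℝ × ℝ × ℝ => (p.1, squareToDisc p.2)) (t, x) :=
      contDiffAt_fst.prodMk ((contDiffAt_squareToDisc h).comp (t, x) contDiffAt_snd)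
    have h3 : ContDiffAt ℝ ∞ (fun p : ℝ × ℝ × ℝ => discTwist η p.1 (squareToDisc p.2)) (t, x) :=
      (contDiff_discTwist η).contDiffAt.comp (t, x) h2
    refine ContDiffAt.comp (t, x) (contDiffAt_discToSquare ?_) h3
    rw [radiusSq_discTwist]; exact radiusSq_squareToDisc_lt h
  · have hL : x ∉ twistSupport η := fun hx => h (twistSupport_subset hη hx)
    have h1 : (fun p : ℝ × ℝ × ℝ => squareTwist η p.1 p.2) =ᶠ[𝓝 (t, x)] fun p => p.2 := by
      have : ∀ᶠ p : ℝ × ℝ × ℝ in 𝓝 (t, x), p.2 ∈ (twistSupport η)ᶜ :=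
        continuous_snd.continuousAt.eventually
          ((isCompact_twistSupport η).isClosed.isOpen_compl.mem_nhds hL)
      filter_upwards [this] with p hp using squareTwist_of_notMem hη _ hp
    exact contDiffAt_snd.congr_of_eventuallyEq h1

lemma volume_image_squareToDisc {s : Set (ℝ × ℝ)} (hs : MeasurableSet s) (h : s ⊆ unitSquare) :
    volume (squareToDisc '' s) = ENNReal.ofReal (Real.pi / 4) * volume s := by
  have h1 (x : ℝ × ℝ) (hx : x ∈ s) := hasFDerivAt_squareToDisc (h hx)
  choose! f' hf hdet using h1
  rw [← lintegral_abs_det_fderiv_eq_addHaar_image volume hs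
    (fun x hx => (hf x hx).hasFDerivWithinAt)]
  · rw [setLIntegral_congr_fun (g := fun _ => ENNReal.ofReal (Real.pi / 4)) hs]
    · simp
    · intro x hx
      simp only
      rw [hdet x hx, abs_of_pos (by positivity)]
  · intro x hx y hy hxy
    rw [← discToSquare_squareToDisc (h hx), hxy, discToSquare_squareToDisc (h hy)]

lemma volume_image_discTwist (η t : ℝ) {s : Set (ℝ × ℝ)} (hs : MeasurableSet s) :
    volume (discTwist η t '' s) = volume s := by
  choose f' hf hdet using hasFDerivAt_discTwist η t
  rw [← lintegral_abs_det_fderiv_eq_addHaar_image volume hs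
    (fun x _ => (hf x).hasFDerivWithinAt)]
  · simp [hdet]
  · intro x _ y _ hxy
    rw [← discTwist_zero η x, ← discTwist_zero η y, ← neg_add_cancel t, discTwist_add,
      discTwist_add, hxy]

lemma continuous_squareTwist {η : ℝ} (hη : 0 < η) (t : ℝ) : Continuous (squareTwist η t) :=
  (contDiff_squareTwist hη).continuous.comp (by fun_prop : Continuous fun x : ℝ × ℝ => (t, x))

lemma squareTwist_neg_squareTwist (η t : ℝ) (x : ℝ × ℝ) :
    squareTwist η (-t) (squareTwist η t x) = x := by
  rw [← squareTwist_add, neg_add_cancel, squareTwist_zero]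

lemma preimage_squareTwist (η t : ℝ) (s : Set (ℝ × ℝ)) :
    squareTwist η t ⁻¹' s = squareTwist η (-t) '' s := by
  ext x
  constructor
  · intro hx
    exact ⟨_, hx, squareTwist_neg_squareTwist η t x⟩
  · rintro ⟨y, hy, rfl⟩
    have := squareTwist_neg_squareTwist η (-t) y
    rw [neg_neg] at this
    rwa [mem_preimage, this]

/-- `squareToDisc` scales all areas by the same factor, which cancels in the conjugated map. -/
lemma volume_image_squareTwist {η : ℝ} (hη : 0 < η) (t : ℝ) {s : Set (ℝ × ℝ)}
    (hs : MeasurableSet s) (h : s ⊆ unitSquare) : volume (squareTwist η t '' s) = volume s := by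
  have hsq (r : ℝ) (u : Set (ℝ × ℝ)) (hu : u ⊆ unitSquare) :
      squareTwist η r '' u ⊆ unitSquare := by
    rintro _ ⟨x, hx, rfl⟩
    exact squareTwist_mem (hu hx)
  have him : MeasurableSet (squareTwist η t '' s) := by
    rw [← neg_neg t, ← preimage_squareTwist]
    exact (continuous_squareTwist hη _).measurable hs
  have h1 : squareToDisc '' (squareTwist η t '' s) = discTwist η t '' (squareToDisc '' s) := by
    rw [image_image, image_image]
    exact image_congr fun x hx => squareToDisc_squareTwist (h hx)
  have hdm : MeasurableSet (squareToDisc '' s) :=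
    hs.image_of_continuousOn_injOn
      (fun x hx => (contDiffAt_squareToDisc (h hx)).continuousAt.continuousWithinAt)
      (fun x hx y hy hxy => by
        rw [← discToSquare_squareToDisc (h hx), hxy, discToSquare_squareToDisc (h hy)])
  have h2 := volume_image_squareToDisc him (hsq t s h)
  rw [h1, volume_image_discTwist η t hdm, volume_image_squareToDisc hs h] at h2
  refine (ENNReal.mul_right_inj ?_ ENNReal.ofReal_ne_top).1 h2.symm
  simp [Real.pi_pos]

lemma measurePreserving_squareTwist {η : ℝ} (hη : 0 < η) (t : ℝ) :
    MeasurePreserving (squareTwist η t) volume volume := by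
  refine ⟨(continuous_squareTwist hη t).measurable, ?_⟩
  ext s hs
  have hU := isOpen_unitSquare.measurableSet
  rw [Measure.map_apply (continuous_squareTwist hη t).measurable hs,
    ← measure_inter_add_sdiff _ hU, ← measure_inter_add_sdiff s hU]
  have h1 (x : ℝ × ℝ) : squareTwist η t x ∈ unitSquare ↔ x ∈ unitSquare := by
    refine ⟨fun hx => ?_, squareTwist_mem⟩
    rw [← squareTwist_neg_squareTwist η t x]
    exact squareTwist_mem hx
  have e1 : squareTwist η t ⁻¹' s ∩ unitSquare = squareTwist η (-t) '' (s ∩ unitSquare) := by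
    rw [← preimage_squareTwist]
    ext x
    simp [h1]
  have e2 : squareTwist η t ⁻¹' s \ unitSquare = s \ unitSquare := by
    ext x
    by_cases hx : x ∈ unitSquare
    · simp [hx]
    · have : squareTwist η t x = x := if_neg hx
      simp [hx, this]
  rw [e1, e2, volume_image_squareTwist hη _ (hs.inter hU) inter_subset_right]

lemma squareTwist_one {η : ℝ} (hη : 0 < η) {x : ℝ × ℝ} (hx : x ∈ unitSquare)
    (h : 2 * η ≤ (1 - x.1 ^ 2) * Real.cos (squareAngle x.2) ^ 2) : squareTwist η 1 x = -x := by
  have hneg : -x ∈ unitSquare :=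
    ⟨⟨by have := hx.1.2; simp; linarith, by have := hx.1.1; simp; linarith⟩,
      ⟨by have := hx.2.2; simp; linarith, by have := hx.2.1; simp; linarith⟩⟩
  rw [squareTwist_of_mem hx, discTwist_one hη, ← squareToDisc_neg, discToSquare_squareToDisc hneg]
  linarith [one_sub_radiusSq_squareToDisc x]

/-- The function is positive on the open square, so the collars shrink to the empty set as `η → 0`.
-/
lemma exists_small_collar {ε : ENNReal} (hε : ε ≠ 0) : ∃ η > 0, volume {x : ℝ × ℝ | x ∈ unitSquare ∧
    (1 - x.1 ^ 2) * Real.cos (squareAngle x.2) ^ 2 < 2 * η} ≤ ε := by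
  set g : ℝ × ℝ → ℝ := fun x => (1 - x.1 ^ 2) * Real.cos (squareAngle x.2) ^ 2 with hg
  have hgc : Continuous g := by
    have := continuous_squareAngle
    fun_prop
  let D : ℕ → Set (ℝ × ℝ) := fun n => {x | x ∈ unitSquare ∧ g x < 2 * (1 / ((n : ℝ) + 1))}
  have hD (n : ℕ) : MeasurableSet (D n) :=
    isOpen_unitSquare.measurableSet.inter (hgc.measurable measurableSet_Iio)
  have hfin (n : ℕ) : volume (D n) ≠ ⊤ := by
    have hb : Bornology.IsBounded unitSquare :=
      (Metric.isBounded_Ioo (-1 : ℝ) 1).prod (Metric.isBounded_Ioo (-1 : ℝ) 1)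
    exact ((hb.subset fun x hx => hx.1).measure_lt_top).ne
  have hanti : Antitone D := by
    intro m n hmn x hx
    refine ⟨hx.1, hx.2.trans_le ?_⟩
    gcongr
  have hlim := tendsto_measure_iInter_atTop (μ := volume) (fun n => (hD n).nullMeasurableSet) hanti
    ⟨0, hfin 0⟩
  have hempty : ⋂ n, D n = ∅ := by
    rw [eq_empty_iff_forall_notMem]
    intro x hx
    rw [mem_iInter] at hx
    have hx0 := (hx 0).1
    have hpos : 0 < g x := by
      have h2 := cos_squareAngle_pos hx0.2
      have h1 : 0 < 1 - x.1 ^ 2 := by nlinarith [hx0.1.1, hx0.1.2]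
      simp only [hg]; positivity
    obtain ⟨n, hn⟩ := exists_nat_one_div_lt (half_pos hpos)
    have := (hx n).2
    linarith
  rw [hempty, measure_empty] at hlim
  obtain ⟨n, hn⟩ := (hlim.eventually (gt_mem_nhds (pos_iff_ne_zero.2 hε))).exists
  exact ⟨1 / ((n : ℝ) + 1), by positivity, hn.le⟩

/-! ### The twist of a box in the plane -/

/-- The open box with half side lengths `h 0`, `h 1` centred at the origin. -/
def box (h : Plane) : Set Plane := {x | ∀ i, |x i| < h i}

lemma isOpen_box (h : Plane) : IsOpen (box h) := by
  have : box h = ⋂ i, {x | |x i| < h i} := by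
    ext x; simp [box]
  rw [this]
  exact isOpen_iInter_of_finite fun i => isOpen_lt (by fun_prop) continuous_const

lemma neg_mem_box {h x : Plane} (hx : x ∈ box h) : -x ∈ box h := fun i => by
  simpa using hx i

/-- The linear equivalence that maps `box h` to the square `(-1, 1)²`. -/
def boxEquiv (h : Plane) (hh : ∀ i, 0 < h i) : Plane ≃L[ℝ] ℝ × ℝ :=
  LinearEquiv.toContinuousLinearEquiv
    { toFun := fun x => (x 0 / h 0, x 1 / h 1)
      invFun := fun w => !₂[w.1 * h 0, w.2 * h 1]
      map_add' := fun x y => by ext <;> simp <;> ring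
      map_smul' := fun c x => by ext <;> simp <;> ring
      left_inv := fun x => by
        have h0 := (hh 0).ne'
        have h1 := (hh 1).ne'
        ext i; fin_cases i <;> simp [h0, h1]
      right_inv := fun w => by
        have h0 := (hh 0).ne'
        have h1 := (hh 1).ne'
        ext <;> simp [h0, h1] }

lemma boxEquiv_mem_unitSquare (h : Plane) (hh : ∀ i, 0 < h i) (x : Plane) :
    boxEquiv h hh x ∈ unitSquare ↔ x ∈ box h := by
  have key (i : Fin 2) : x i / h i ∈ Ioo (-1 : ℝ) 1 ↔ |x i| < h i := by
    rw [mem_Ioo, ← abs_lt, abs_div, abs_of_pos (hh i), div_lt_one (hh i)]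
  have : boxEquiv h hh x ∈ unitSquare ↔
      (x 0 / h 0 ∈ Ioo (-1 : ℝ) 1 ∧ x 1 / h 1 ∈ Ioo (-1 : ℝ) 1) := Iff.rfl
  rw [this, key, key]
  exact (Fin.forall_fin_two (p := fun i => |x i| < h i)).symm

/-- A smooth one-parameter group of area preserving maps of the plane, supported in a box, whose
time one map is close to the reflection of the box in its centre. -/
theorem exists_box_twist (h : Plane) (hh : ∀ i, 0 < h i) {ε : ENNReal} (hε : ε ≠ 0) :
    ∃ F : ℝ → Plane → Plane, ∃ L ⊆ box h, IsCompact L ∧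
      ContDiff ℝ ∞ (fun p : ℝ × Plane => F p.1 p.2) ∧ (∀ x, F 0 x = x) ∧
      (∀ s t x, F (s + t) x = F s (F t x)) ∧ (∀ t, ∀ x ∉ L, F t x = x) ∧
      (∀ t, MeasurePreserving (F t) volume volume) ∧
      volume {x | x ∈ box h ∧ F 1 x ≠ -x} ≤ ε := by
  set e := boxEquiv h hh with he
  let μ : Measure Plane := Measure.map e.symm volume
  have hμ : μ.IsAddHaarMeasure := e.symm.isAddHaarMeasure_map volume
  -- The linear change of coordinates scales area by some constant `c`, whence the tolerance `ε / c`
  -- on the square.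
  obtain ⟨c, hc0, hct, hc⟩ : ∃ c : ENNReal, c ≠ 0 ∧ c ≠ ⊤ ∧ (volume : Measure Plane) = c • μ :=
    ⟨Measure.addHaarScalarFactor volume μ,
      by simpa using (Measure.addHaarScalarFactor_pos_of_isAddHaarMeasure volume μ).ne',
      ENNReal.coe_ne_top, Measure.isAddLeftInvariant_eq_smul volume μ⟩
  obtain ⟨η, hη, hsmall⟩ := exists_small_collar (ε := ε / c) (by simp [hε, hct])
  have hsymm : Measurable (e.symm : ℝ × ℝ → Plane) := e.symm.continuous.measurable
  have hem : Measurable (e : Plane → ℝ × ℝ) := e.continuous.measurable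
  have hmp1 : MeasurePreserving (e.symm : ℝ × ℝ → Plane) volume μ := ⟨hsymm, rfl⟩
  have hmp2 : MeasurePreserving (e : Plane → ℝ × ℝ) μ volume := by
    refine ⟨hem, ?_⟩
    have hid : (e : Plane → ℝ × ℝ) ∘ (e.symm : ℝ × ℝ → Plane) = id :=
      funext e.apply_symm_apply
    rw [Measure.map_map hem hsymm, hid, Measure.map_id]
  refine ⟨fun t x => e.symm (squareTwist η t (e x)), e ⁻¹' twistSupport η, ?_, ?_, ?_, ?_, ?_, ?_,
    ?_, ?_⟩
  · intro x hx
    rw [← boxEquiv_mem_unitSquare h hh]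
    exact twistSupport_subset hη hx
  · have := (isCompact_twistSupport η).image e.symm.continuous
    convert this using 1
    exact (e.symm.toEquiv.image_eq_preimage_symm _).symm
  · exact e.symm.contDiff.comp ((contDiff_squareTwist hη).comp
      (contDiff_fst.prodMk (e.contDiff.comp contDiff_snd)))
  · intro x
    simp [squareTwist_zero]
  · intro s t x
    simp [squareTwist_add]
  · intro t x hx
    simp only
    rw [squareTwist_of_notMem hη t hx, e.symm_apply_apply]
  · intro t
    rw [hc]
    exact (hmp1.comp ((measurePreserving_squareTwist hη t).comp hmp2)).smul_measure c
  · have hsub : {x | x ∈ box h ∧ e.symm (squareTwist η 1 (e x)) ≠ -x} ⊆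
        e ⁻¹' {x | x ∈ unitSquare ∧ (1 - x.1 ^ 2) * Real.cos (squareAngle x.2) ^ 2 < 2 * η} := by
      rintro x ⟨hx, hne⟩
      have hx' := (boxEquiv_mem_unitSquare h hh x).2 hx
      refine ⟨hx', ?_⟩
      by_contra! hcon
      refine hne ?_
      rw [squareTwist_one hη hx' hcon, map_neg, e.symm_apply_apply]
    have hem' : MeasurableEmbedding (e : Plane → ℝ × ℝ) :=
      e.toHomeomorph.measurableEmbedding
    calc volume {x | x ∈ box h ∧ e.symm (squareTwist η 1 (e x)) ≠ -x}
        ≤ volume (e ⁻¹' _) := measure_mono hsub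
      _ = c * volume _ := by
        conv_lhs => rw [hc]
        rw [Measure.smul_apply, hmp2.measure_preimage_emb hem', smul_eq_mul]
      _ ≤ c * (ε / c) := by gcongr
      _ = ε := ENNReal.mul_div_cancel hc0 hct

/-! ### Null sets, the Dirichlet domain and the area of the surface -/

/-- A set on which a function vanishes together with none of its differentials is null. -/
lemma measure_eq_zero_of_hasFDerivAt_ne_zero {E : Type*} [NormedAddCommGroup E] [NormedSpace ℝ E]
    [FiniteDimensional ℝ E] [MeasurableSpace E] [BorelSpace E] (μ : Measure E) [μ.IsAddHaarMeasure]
    {ρ : E → ℝ} {Z : Set E} (h0 : ∀ x ∈ Z, ρ x = 0)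
    (h1 : ∀ x ∈ Z, ∃ ρ' : E →L[ℝ] ℝ, ρ' ≠ 0 ∧ HasFDerivAt ρ ρ' x) : μ Z = 0 := by
  choose! ρ' hne hρ using h1
  have hw (x : E) (hx : x ∈ Z) : ∃ w, ρ' x w = 1 := by
    obtain ⟨w, hw⟩ := DFunLike.ne_iff.1 (hne x hx)
    exact ⟨(ρ' x w)⁻¹ • w, by simpa using inv_mul_cancel₀ hw⟩
  choose! w hw using hw
  -- With `x` fixed, the identity agrees on `Z` with `y ↦ y - ρ y • w x`, since `ρ` vanishes there.
  -- Within `Z` it therefore has a derivative at `x` that kills `w x`, so `Z` is its own image under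
  -- a map with zero Jacobian. Neither continuity of the differential nor measurability of `Z` is
  -- needed.
  have := addHaar_image_eq_zero_of_det_fderivWithin_eq_zero μ (s := Z) (f := id)
    (f' := fun x => ContinuousLinearMap.id ℝ E - (ρ' x).smulRight (w x)) ?_ ?_
  · simpa using this
  · intro x hx
    have h := (hasFDerivAt_id x).sub ((hρ x hx).smul_const (w x))
    refine h.hasFDerivWithinAt.congr ?_ ?_
    · intro y hy; simp [h0 y hy]
    · simp [h0 x hx]
  · intro x hx
    by_contra hdet
    have hk : (ContinuousLinearMap.id ℝ E - (ρ' x).smulRight (w x)) (w x) = 0 := by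
      simp [hw x hx]
    have hw0 : w x = 0 := by
      have hinj := (LinearEquiv.ofIsUnitDet (f := ((ContinuousLinearMap.id ℝ E -
        (ρ' x).smulRight (w x) : E →L[ℝ] E) : E →ₗ[ℝ] E)) (v := Module.finBasis ℝ E)
        (v' := Module.finBasis ℝ E) (by
          rw [LinearMap.det_toMatrix]
          exact isUnit_iff_ne_zero.2 hdet)).injective
      apply hinj
      rw [map_zero]
      exact hk
    have := hw x hx
    rw [hw0, map_zero] at this
    exact zero_ne_one this

/-- The difference of the squared distances to `u` and `v` is affine, with gradient `2 (v - u) ≠ 0`.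
-/
lemma volume_bisector {u v : Plane} (huv : u ≠ v) :
    volume {x : Plane | ‖x - u‖ = ‖x - v‖} = 0 := by
  refine measure_eq_zero_of_hasFDerivAt_ne_zero volume
    (ρ := fun x => 2 * inner ℝ (v - u) x + (‖u‖ ^ 2 - ‖v‖ ^ 2)) (fun x hx => ?_) (fun x _ => ?_)
  · have h1 := norm_sub_sq_real x u
    have h2 := norm_sub_sq_real x v
    have h3 : ‖x - u‖ = ‖x - v‖ := hx
    rw [h3] at h1
    simp only [inner_sub_left, real_inner_comm u x, real_inner_comm v x] at *
    linarith
  · refine ⟨(2 : ℝ) • innerSL ℝ (v - u), ?_, ?_⟩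
    · intro h
      have h2 : 2 * inner ℝ (v - u) (v - u) = 0 := DFunLike.congr_fun h (v - u)
      have h3 : inner ℝ (v - u) (v - u) = 0 := by linarith
      exact huv (sub_eq_zero.1 (inner_self_eq_zero.1 h3)).symm
    · exact (((innerSL ℝ (v - u)).hasFDerivAt).const_mul 2).add_const _

variable (Λ : AddSubgroup Plane)

lemma isClosed_dirichletDomain : IsClosed (dirichletDomain Λ) := by
  have : dirichletDomain Λ = ⋂ v ∈ Λ, {x | ‖x‖ ≤ ‖x - v‖} := by
    ext x; simp [dirichletDomain]
  rw [this]
  exact isClosed_biInter fun v _ => isClosed_le (by fun_prop) (by fun_prop)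

section

variable {Λ}

lemma proj_eq_iff {x y : Plane} : proj Λ x = proj Λ y ↔ ∃ g : Λ, g +ᵥ x = y := by
  rw [proj, proj, QuotientAddGroup.eq]
  constructor
  · intro h
    refine ⟨⟨_, h⟩, ?_⟩
    rw [AddSubgroup.vadd_def, vadd_eq_add, add_comm, add_neg_cancel_left]
  · rintro ⟨g, rfl⟩
    rw [AddSubgroup.vadd_def, vadd_eq_add]
    rw [add_comm (g : Plane), neg_add_cancel_left]
    exact g.2

lemma continuous_proj : Continuous (proj Λ) := QuotientAddGroup.continuous_mk

lemma isOpenMap_proj : IsOpenMap (proj Λ) := QuotientAddGroup.isOpenMap_coe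

lemma preimage_image_proj (R : Set Plane) : proj Λ ⁻¹' (proj Λ '' R) = ⋃ g : Λ, g +ᵥ R := by
  ext x
  simp only [mem_preimage, mem_image, mem_iUnion, proj_eq_iff, mem_vadd_set]
  constructor
  · rintro ⟨y, hy, g, rfl⟩
    exact ⟨g, y, hy, rfl⟩
  · rintro ⟨g, y, hy, rfl⟩
    exact ⟨y, hy, g, rfl⟩

lemma area_apply {M : Set (Surface Λ)} (hM : MeasurableSet M) (E : Set M) :
    area M E = surfaceArea Λ (Subtype.val '' E) :=
  (MeasurableEmbedding.subtype_coe hM).comap_apply _ _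

end

variable [DiscreteTopology Λ]

instance : IsClosed (Λ : Set Plane) := AddSubgroup.isClosed_of_discrete

instance : Countable Λ := TopologicalSpace.separableSpace_iff_countable.1 inferInstance

/-- A discrete subgroup is closed, so every point has a closest element of `Λ`, and subtracting it
gives a point of the domain. A point common to the translates by `g` and `g'` is equidistant from
`g` and `g'`, hence on a null line. -/
lemma isAddFundamentalDomain_dirichletDomain :
    IsAddFundamentalDomain Λ (dirichletDomain Λ) volume where
  nullMeasurableSet := (isClosed_dirichletDomain Λ).measurableSet.nullMeasurableSet
  ae_covers := by
    refine Eventually.of_forall fun x => ?_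
    obtain ⟨y, hy, hxy⟩ := IsClosed.exists_infDist_eq_dist (s := (Λ : Set Plane))
      inferInstance ⟨0, Λ.zero_mem⟩ x
    refine ⟨-⟨y, hy⟩, fun v hv => ?_⟩
    have h : Metric.infDist x (Λ : Set Plane) ≤ dist x (y + v) :=
      Metric.infDist_le_dist_of_mem (Λ.add_mem hy hv)
    rw [hxy, dist_eq_norm, dist_eq_norm] at h
    have e1 : (-⟨y, hy⟩ : Λ) +ᵥ x = x - y := by
      rw [AddSubgroup.vadd_def, AddSubgroup.coe_neg, vadd_eq_add]; abel
    rw [e1]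
    rwa [sub_sub]
  aedisjoint := by
    intro g g' hgg'
    refine measure_mono_null ?_ (volume_bisector (u := g) (v := g') (Subtype.coe_ne_coe.2 hgg'))
    rintro x ⟨hx, hx'⟩
    obtain ⟨y, hy, rfl⟩ := hx
    obtain ⟨z, hz, hyz⟩ := hx'
    have hyz' : (g' : Plane) + z = g + y := hyz
    have h1 := hy ((g' : Plane) - g) (Λ.sub_mem g'.2 g.2)
    have h2 := hz ((g : Plane) - g') (Λ.sub_mem g.2 g'.2)
    have e1 : y - ((g' : Plane) - g) = z := by
      rw [sub_sub_eq_add_sub, sub_eq_iff_eq_add, add_comm y, add_comm z, hyz']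
    have e2 : z - ((g : Plane) - g') = y := by rw [← e1]; abel
    rw [e1] at h1
    rw [e2] at h2
    show ‖(g : Plane) + y - g‖ = ‖(g : Plane) + y - g'‖
    rw [add_sub_cancel_left, ← hyz', add_sub_cancel_left]
    exact le_antisymm h1 h2

variable {Λ}

lemma measurableSet_image_proj {R : Set Plane} (hR : MeasurableSet R) :
    MeasurableSet (proj Λ '' R) := by
  have h : MeasurableSet (proj Λ ⁻¹' (proj Λ '' R)) := by
    rw [preimage_image_proj]
    exact MeasurableSet.iUnion fun g => hR.const_vadd g
  exact measurableSet_quotient.2 h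

lemma measurable_proj : Measurable (proj Λ) := (continuous_proj (Λ := Λ)).measurable

lemma surfaceArea_apply {E : Set (Surface Λ)} (hE : MeasurableSet E) :
    surfaceArea Λ E = volume (proj Λ ⁻¹' E ∩ dirichletDomain Λ) := by
  rw [surfaceArea, Measure.map_apply measurable_proj hE,
    Measure.restrict_apply (measurable_proj hE)]

lemma surfaceArea_image_proj_le {R : Set Plane} (hR : MeasurableSet R) :
    surfaceArea Λ (proj Λ '' R) ≤ volume R := by
  rw [surfaceArea_apply (measurableSet_image_proj hR), preimage_image_proj, iUnion_inter,
    (isAddFundamentalDomain_dirichletDomain Λ).measure_eq_tsum R]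
  exact measure_iUnion_le _

/-- Injectivity makes the translates of `R` disjoint, so the pieces that they cut out of the
Dirichlet domain add up without overlap. -/
lemma surfaceArea_image_proj {R : Set Plane} (hR : MeasurableSet R) (hinj : InjOn (proj Λ) R) :
    surfaceArea Λ (proj Λ '' R) = volume R := by
  rw [surfaceArea_apply (measurableSet_image_proj hR), preimage_image_proj, iUnion_inter,
    (isAddFundamentalDomain_dirichletDomain Λ).measure_eq_tsum R]
  refine measure_iUnion ?_ fun g => (hR.const_vadd g).inter
    (isClosed_dirichletDomain Λ).measurableSet
  intro g g' hgg'
  rw [Function.onFun, disjoint_left]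
  rintro _ ⟨⟨y, hy, rfl⟩, _⟩ ⟨⟨z, hz, hyz⟩, _⟩
  simp only at hyz
  have hp : proj Λ y = proj Λ z := by
    rw [proj_eq_iff.2 ⟨g, rfl⟩, ← hyz]
    exact (proj_eq_iff.2 ⟨g', rfl⟩).symm
  have hyz2 := hinj hy hz hp
  subst hyz2
  have : (g' : Plane) + y = g + y := hyz
  exact hgg' (Subtype.ext (add_right_cancel this)).symm

lemma surfaceArea_inter_image_proj {R : Set Plane} (hR : MeasurableSet R) (hinj : InjOn (proj Λ) R)
    {E : Set (Surface Λ)} (hE : MeasurableSet E) :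
    surfaceArea Λ (E ∩ proj Λ '' R) = volume (proj Λ ⁻¹' E ∩ R) := by
  rw [inter_comm, inter_comm _ R, ← surfaceArea_image_proj (hR.inter (measurable_proj hE))
    (hinj.mono inter_subset_left), image_inter_preimage]

/-! ### The boundary is null and the area is finite -/

section Domain

variable {M : Set (Surface Λ)}

lemma IsSmoothDomain.isClosed (hM : IsSmoothDomain M) : IsClosed M := hM.isCompact.isClosed

/-- Locally the boundary lies in `{ρ = 0}`, because `ρ < 0` forces an interior point, and `dρ ≠ 0`
persists near `p`. -/
lemma IsSmoothDomain.surfaceArea_frontier (hM : IsSmoothDomain M) :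
    surfaceArea Λ (frontier M) = 0 := by
  rw [surfaceArea_apply isClosed_frontier.measurableSet]
  refine measure_mono_null inter_subset_left ?_
  refine measure_null_of_locally_null _ fun p hp => ?_
  obtain ⟨ρ, hρ, hdρ, hev⟩ := hM.smooth_boundary p hp
  have hd : ∀ᶠ x in 𝓝 p, fderiv ℝ ρ x ≠ 0 :=
    (hρ.continuous_fderiv (by simp)).continuousAt.eventually_ne hdρ
  have hV := hev.eventually_nhds.and hd
  refine ⟨_, inter_mem_nhdsWithin _ hV, ?_⟩
  refine measure_eq_zero_of_hasFDerivAt_ne_zero volume (ρ := ρ) ?_ ?_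
  · rintro x ⟨hx, hx2, -⟩
    have hxM : proj Λ x ∈ M := hM.isClosed.frontier_subset hx
    refine le_antisymm (hx2.self_of_nhds.1 hxM) ?_
    by_contra! hneg
    have hlt : ∀ᶠ y in 𝓝 x, ρ y < 0 := hρ.continuous.continuousAt.eventually_lt_const hneg
    have hmem : proj Λ ⁻¹' M ∈ 𝓝 x := by
      filter_upwards [hlt, hx2] with y hy hy2 using hy2.2 hy.le
    have : M ∈ 𝓝 (proj Λ x) :=
      mem_of_superset (isOpenMap_proj.image_mem_nhds hmem) (image_preimage_subset _ _)
    exact hx.2 (mem_interior_iff_mem_nhds.2 this)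
  · rintro x ⟨-, -, hx⟩
    exact ⟨_, hx, (hρ.differentiable (by simp) x).hasFDerivAt⟩

lemma surfaceArea_lt_top_of_isCompact (hM : IsCompact M) : surfaceArea Λ M < ⊤ := by
  obtain ⟨n, hn⟩ := hM.elim_directed_cover (fun n : ℕ => proj Λ '' Metric.ball 0 n)
    (fun n => isOpenMap_proj _ Metric.isOpen_ball)
    (fun z _ => by
      obtain ⟨x, rfl⟩ := QuotientAddGroup.mk_surjective z
      obtain ⟨n, hn⟩ := exists_nat_gt ‖x‖
      exact mem_iUnion.2 ⟨n, x, by simpa using hn, rfl⟩)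
    (directed_of_isDirected_le fun m n hmn =>
      image_mono (Metric.ball_subset_ball (by exact_mod_cast hmn)))
  exact (measure_mono hn).trans_lt
    ((surfaceArea_image_proj_le Metric.isOpen_ball.measurableSet).trans_lt measure_ball_lt_top)

lemma isFiniteMeasure_area (hM : IsCompact M) : IsFiniteMeasure (area M) := by
  refine ⟨?_⟩
  rw [area_apply hM.isClosed.measurableSet]
  refine (measure_mono ?_).trans_lt (surfaceArea_lt_top_of_isCompact hM)
  simp

end Domain

/-! ### Composition of smooth maps and of isotopies -/

section Component

variable {Λ : AddSubgroup Plane} {M : Set (Surface Λ)}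

lemma IsSmoothFamily.isSmoothMap {f : ℝ → M → M} (hf : IsSmoothFamily f) {t : ℝ}
    (ht : t ∈ Icc (0 : ℝ) 1) : IsSmoothMap (f t) := by
  intro p hp
  obtain ⟨U, hU, F, hF, hfF⟩ := hf t ht p hp
  have hc : Continuous fun x : Plane => (t, x) := by fun_prop
  refine ⟨(fun x => (t, x)) ⁻¹' U, hc.continuousAt.preimage_mem_nhds hU, fun x => F (t, x), ?_,
    fun x hx hxM => hfF t ht x hx hxM⟩
  exact hF.comp (contDiff_prodMk_right t).contDiffOn fun x hx => ⟨hx.1, ht, hx.2⟩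

lemma IsSmoothMap.isSmoothFamily_const {f : M → M} (hf : IsSmoothMap f) :
    IsSmoothFamily fun _ => f := by
  intro t ht p hp
  obtain ⟨U, hU, F, hF, hfF⟩ := hf p hp
  refine ⟨Prod.snd ⁻¹' U, continuous_snd.continuousAt.preimage_mem_nhds hU, fun q => F q.2, ?_,
    fun s _ x hx hxM => hfF x hx hxM⟩
  exact hF.comp contDiff_snd.contDiffOn fun x hx => ⟨hx.1, hx.2.2⟩

/-- Local lifts to the plane compose. The inner lift is continuous only within the preimage of `M`,
so the neighbourhood for the outer lift is pulled back relative to that set. -/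
lemma IsSmoothFamily.comp {f g : ℝ → M → M} (hf : IsSmoothFamily f) (hg : IsSmoothFamily g) :
    IsSmoothFamily fun t => f t ∘ g t := by
  intro t ht p hp
  obtain ⟨U, hU, F, hF, hgF⟩ := hg t ht p hp
  have hq : proj Λ (F (t, p)) ∈ M := by
    rw [← hgF t ht p (mem_of_mem_nhds hU) hp]
    exact Subtype.coe_prop _
  obtain ⟨V, hV, G, hG, hfG⟩ := hf t ht (F (t, p)) hq
  have hA : (t, p) ∈ U ∩ Icc (0 : ℝ) 1 ×ˢ (proj Λ ⁻¹' M) := ⟨mem_of_mem_nhds hU, ht, hp⟩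
  have hcont : ContinuousWithinAt (fun q : ℝ × Plane => (q.1, F q))
      (U ∩ Icc (0 : ℝ) 1 ×ˢ (proj Λ ⁻¹' M)) (t, p) :=
    continuousWithinAt_fst.prodMk (hF.continuousOn _ hA)
  obtain ⟨W, hW, hWV⟩ := mem_nhdsWithin_iff_exists_mem_nhds_inter.1
    (hcont.preimage_mem_nhdsWithin hV)
  have hmem (s : ℝ) (hs : s ∈ Icc (0 : ℝ) 1) (x : Plane) (hx : (s, x) ∈ U) (hxM : proj Λ x ∈ M) :
      proj Λ (F (s, x)) ∈ M := by
    rw [← hgF s hs x hx hxM]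
    exact Subtype.coe_prop _
  refine ⟨U ∩ W, inter_mem hU hW, fun q => G (q.1, F q), ?_, ?_⟩
  · refine hG.comp (contDiffOn_fst.prodMk (hF.mono fun q hq => ⟨hq.1.1, hq.2⟩)) ?_
    rintro ⟨s, x⟩ ⟨⟨h1, h2⟩, hs, hx⟩
    exact ⟨hWV ⟨h2, h1, hs, hx⟩, hs, hmem s hs x h1 hx⟩
  · rintro s hs x ⟨hxU, hxW⟩ hxM
    have h1 := hfG s hs (F (s, x)) (hWV ⟨hxW, hxU, hs, hxM⟩) (hmem s hs x hxU hxM)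
    have h2 : g s ⟨proj Λ x, hxM⟩ = ⟨proj Λ (F (s, x)), hmem s hs x hxU hxM⟩ :=
      Subtype.ext (hgF s hs x hxU hxM)
    rw [← h1, ← h2]
    rfl

lemma IsSmoothMap.comp {f g : M → M} (hf : IsSmoothMap f) (hg : IsSmoothMap g) :
    IsSmoothMap (f ∘ g) :=
  (hf.isSmoothFamily_const.comp hg.isSmoothFamily_const).isSmoothMap (left_mem_Icc.2 zero_le_one)

lemma isSmoothMap_id : IsSmoothMap (id : M → M) := fun _ _ =>
  ⟨univ, univ_mem, id, contDiffOn_id, fun _ _ _ => rfl⟩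

lemma IsAreaPreservingDiffeo.refl : IsAreaPreservingDiffeo (Homeomorph.refl M) :=
  ⟨isSmoothMap_id, isSmoothMap_id, MeasurePreserving.id _⟩

lemma IsAreaPreservingDiffeo.trans {φ ψ : M ≃ₜ M} (hφ : IsAreaPreservingDiffeo φ)
    (hψ : IsAreaPreservingDiffeo ψ) : IsAreaPreservingDiffeo (φ.trans ψ) :=
  ⟨hψ.smooth.comp hφ.smooth, hφ.smooth_symm.comp hψ.smooth_symm,
    hψ.measurePreserving.comp hφ.measurePreserving⟩

lemma refl_mem_identityComponent : Homeomorph.refl M ∈ identityComponent M :=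
  ⟨fun _ => Homeomorph.refl M, fun _ _ => IsAreaPreservingDiffeo.refl,
    isSmoothMap_id.isSmoothFamily_const, rfl, rfl⟩

/-- The isotopies are composed at each time instead of being run in succession, so there is no
junction to smooth. -/
lemma trans_mem_identityComponent {φ ψ : M ≃ₜ M} (hφ : φ ∈ identityComponent M)
    (hψ : ψ ∈ identityComponent M) : φ.trans ψ ∈ identityComponent M := by
  obtain ⟨Φ, h1, h2, h3, h4⟩ := hφ
  obtain ⟨Ψ, k1, k2, k3, k4⟩ := hψ
  refine ⟨fun t => (Φ t).trans (Ψ t), fun t ht => (h1 t ht).trans (k1 t ht), k2.comp h2, ?_, ?_⟩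
  · ext z; simp [h3, k3]
  · ext z; simp [h4, k4]

lemma measurePreserving_of_mem_identityComponent {φ : M ≃ₜ M} (hφ : φ ∈ identityComponent M) :
    MeasurePreserving φ (area M) (area M) := by
  obtain ⟨Φ, h1, -, -, rfl⟩ := hφ
  exact (h1 1 (right_mem_Icc.2 zero_le_one)).measurePreserving

end Component

/-! ### Maps of a box carried to the surface; reflection of a cell -/

section Transplant

variable {Λ : AddSubgroup Plane}

open Classical in
/-- The map of the surface that acts like `G` on the translate by `x` of the image of `box h`, and
is the identity elsewhere. -/
def transplant (x : Surface Λ) (h : Plane) (G : Plane → Plane) (z : Surface Λ) : Surface Λ :=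
  if hz : ∃ v ∈ box h, x + proj Λ v = z then x + proj Λ (G hz.choose) else z

variable {x : Surface Λ} {h : Plane} {G : Plane → Plane}

lemma transplant_of_mem (hinj : InjOn (proj Λ) (box h)) {v : Plane} (hv : v ∈ box h) :
    transplant x h G (x + proj Λ v) = x + proj Λ (G v) := by
  have hz : ∃ w ∈ box h, x + proj Λ w = x + proj Λ v := ⟨v, hv, rfl⟩
  rw [transplant, dif_pos hz]
  congr 3
  exact hinj hz.choose_spec.1 hv (add_left_cancel hz.choose_spec.2)

lemma transplant_of_notMem {z : Surface Λ} (hz : ∀ v ∈ box h, x + proj Λ v ≠ z) :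
    transplant x h G z = z := by
  rw [transplant, dif_neg]
  push Not
  exact hz

lemma transplant_of_notMem_support {L : Set Plane} (hinj : InjOn (proj Λ) (box h))
    (hG : ∀ v ∉ L, G v = v) {z : Surface Λ} (hz : ∀ v ∈ L, x + proj Λ v ≠ z) :
    transplant x h G z = z := by
  by_cases hb : ∃ v ∈ box h, x + proj Λ v = z
  · obtain ⟨v, hv, rfl⟩ := hb
    rw [transplant_of_mem hinj hv, hG v fun hvL => hz v hvL rfl]
  · push Not at hb
    exact transplant_of_notMem hb

lemma transplant_transplant {G' : Plane → Plane} (hinj : InjOn (proj Λ) (box h))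
    (hG : MapsTo G (box h) (box h)) (z : Surface Λ) :
    transplant x h G' (transplant x h G z) = transplant x h (G' ∘ G) z := by
  by_cases hb : ∃ v ∈ box h, x + proj Λ v = z
  · obtain ⟨v, hv, rfl⟩ := hb
    rw [transplant_of_mem hinj hv, transplant_of_mem hinj (hG hv), transplant_of_mem hinj hv]
    rfl
  · push Not at hb
    rw [transplant_of_notMem hb, transplant_of_notMem hb, transplant_of_notMem hb]

lemma transplant_id (hinj : InjOn (proj Λ) (box h)) (z : Surface Λ) :
    transplant x h id z = z :=
  transplant_of_notMem_support (L := ∅) hinj (fun _ _ => rfl) (by simp)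

lemma transplant_mem {M : Set (Surface Λ)} (hinj : InjOn (proj Λ) (box h))
    (hG : MapsTo G (box h) (box h)) (hM : ∀ v ∈ box h, x + proj Λ v ∈ M) {z : Surface Λ}
    (hz : z ∈ M) : transplant x h G z ∈ M := by
  by_cases hb : ∃ v ∈ box h, x + proj Λ v = z
  · obtain ⟨v, hv, rfl⟩ := hb
    rw [transplant_of_mem hinj hv]
    exact hM _ (hG hv)
  · push Not at hb
    rwa [transplant_of_notMem hb]

lemma proj_sub' (u v : Plane) : proj Λ (u - v) = proj Λ u - proj Λ v := rfl

lemma proj_add' (u v : Plane) : proj Λ (u + v) = proj Λ u + proj Λ v := rfl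

lemma proj_neg' (u : Plane) : proj Λ (-u) = -proj Λ u := rfl

/-- A point of the cell is lifted in the chart of the cell. Any other point has a neighbourhood off
the image of `L`, which is compact and hence closed, and there the map is the identity. -/
lemma exists_local_lift_transplant [DiscreteTopology Λ] (hinj : InjOn (proj Λ) (box h))
    {F : ℝ → Plane → Plane} {L : Set Plane} (hL : IsCompact L) (hLb : L ⊆ box h)
    (hF : ContDiff ℝ ∞ fun p : ℝ × Plane => F p.1 p.2) (hFL : ∀ t, ∀ v ∉ L, F t v = v)
    (p : Plane) : ∃ V ∈ 𝓝 p, ∃ H : ℝ × Plane → Plane, ContDiff ℝ ∞ H ∧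
      ∀ s, ∀ y ∈ V, transplant x h (F s) (proj Λ y) = proj Λ (H (s, y)) := by
  by_cases hb : ∃ v ∈ box h, x + proj Λ v = proj Λ p
  · obtain ⟨v, hv, hvp⟩ := hb
    have hx : x = proj Λ (p - v) := by rw [proj_sub', ← hvp, add_sub_cancel_right]
    refine ⟨{y | y - (p - v) ∈ box h}, ?_, fun q => p - v + F q.1 (q.2 - (p - v)), ?_, ?_⟩
    · have hc : Continuous fun y : Plane => y - (p - v) := by fun_prop
      refine ((isOpen_box h).preimage hc).mem_nhds ?_
      simpa using hv
    · exact contDiff_const.add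
        (hF.comp (f := fun q : ℝ × Plane => (q.1, q.2 - (p - v))) (by fun_prop))
    · intro s y hy
      have hy' : proj Λ y = x + proj Λ (y - (p - v)) := by
        rw [hx, ← proj_add', add_sub_cancel]
      rw [hy', transplant_of_mem hinj hy, hx, ← proj_add']
  · push Not at hb
    have hcl : IsClosed ((fun v => x + proj Λ v) '' L) :=
      (hL.image (continuous_const.add continuous_proj)).isClosed
    refine ⟨proj Λ ⁻¹' ((fun v => x + proj Λ v) '' L)ᶜ, ?_, fun q => q.2, contDiff_snd, ?_⟩
    · refine (hcl.isOpen_compl.preimage continuous_proj).mem_nhds ?_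
      rintro ⟨v, hv, hvp⟩
      exact hb v (hLb hv) hvp
    · intro s y hy
      refine transplant_of_notMem_support hinj (hFL s) fun v hv hvy => hy ⟨v, hv, hvy⟩

lemma measurePreserving_transplant [DiscreteTopology Λ] (hinj : InjOn (proj Λ) (box h))
    (hG : MeasurePreserving G volume volume) (hGb : ∀ v, G v ∈ box h ↔ v ∈ box h)
    (hT : Measurable (transplant x h G)) :
    MeasurePreserving (transplant x h G) (surfaceArea Λ) (surfaceArea Λ) := by
  refine ⟨hT, ?_⟩
  ext E hE
  rw [Measure.map_apply hT hE]
  obtain ⟨c, rfl⟩ := QuotientAddGroup.mk_surjective x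
  set R : Set Plane := (fun y => y - c) ⁻¹' box h with hR
  have hRm : MeasurableSet R := (isOpen_box h).measurableSet.preimage (measurable_id.sub_const c)
  have hRinj : InjOn (proj Λ) R := by
    intro y hy z hz hyz
    have : proj Λ (y - c) = proj Λ (z - c) := by rw [proj_sub', proj_sub', hyz]
    exact sub_left_injective (hinj hy hz this)
  have hC := measurableSet_image_proj (Λ := Λ) hRm
  have hdecomp (y : Plane) : proj Λ y = proj Λ c + proj Λ (y - c) := by
    rw [← proj_add', add_sub_cancel]
  rw [← measure_inter_add_sdiff _ hC, ← measure_inter_add_sdiff E hC,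
    surfaceArea_inter_image_proj hRm hRinj hE, surfaceArea_inter_image_proj hRm hRinj (hT hE)]
  congr 1
  · have hG' : MeasurePreserving (fun y => G (y - c) + c) volume volume :=
      (measurePreserving_add_right volume c).comp (hG.comp (measurePreserving_sub_right volume c))
    rw [← hG'.measure_preimage ((measurable_proj hE).inter hRm).nullMeasurableSet]
    congr 1
    ext y
    simp only [mem_inter_iff, mem_preimage, hR, add_sub_cancel_right, hGb]
    refine and_congr_left fun hy => ?_
    rw [hdecomp y, transplant_of_mem hinj hy, add_comm (G _), proj_add']
  · congr 1
    ext z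
    refine and_congr_left fun hz => ?_
    rw [mem_preimage, transplant_of_notMem]
    rintro v hv rfl
    exact hz ⟨c + v, by simpa [hR] using hv, proj_add' c v⟩

lemma measurePreserving_area {M : Set (Surface Λ)} (hM : MeasurableSet M)
    {T : Surface Λ → Surface Λ} (hT : MeasurePreserving T (surfaceArea Λ) (surfaceArea Λ))
    (hTM : ∀ z, T z ∈ M ↔ z ∈ M) {f : M → M} (hf : ∀ z, (f z : Surface Λ) = T z) :
    MeasurePreserving f (area M) (area M) := by
  have hfm : Measurable f := by
    rw [← (MeasurableEmbedding.subtype_coe hM).measurable_comp_iff]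
    have h : Subtype.val ∘ f = T ∘ Subtype.val := funext hf
    rw [h]
    exact hT.measurable.comp measurable_subtype_coe
  refine ⟨hfm, ?_⟩
  ext E hE
  rw [Measure.map_apply hfm hE, area_apply hM, area_apply hM,
    ← hT.measure_preimage (hM.subtype_image hE).nullMeasurableSet]
  congr 1
  ext z
  simp only [mem_image, mem_preimage, Subtype.exists, exists_and_right, exists_eq_right]
  constructor
  · rintro ⟨hz, h⟩
    refine ⟨(hTM z).2 hz, ?_⟩
    convert h using 1
    exact Subtype.ext (hf ⟨z, hz⟩).symm
  · rintro ⟨hz, h⟩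
    refine ⟨(hTM z).1 hz, ?_⟩
    convert h using 1
    exact Subtype.ext (hf ⟨z, _⟩)

/-- `T` agrees, outside sets of arbitrarily small area, with area preserving diffeomorphisms of `M`
in the identity component. -/
def Approximable (M : Set (Surface Λ)) (T : Surface Λ → Surface Λ) : Prop :=
  ∀ ε : ENNReal, ε ≠ 0 → ∃ φ ∈ identityComponent M, area M {z | (φ z : Surface Λ) ≠ T z} ≤ ε

lemma approximable_id (M : Set (Surface Λ)) : Approximable M id := fun ε _ =>
  ⟨_, refl_mem_identityComponent, by simp⟩

/-- A point is bad only if it is bad for `ψ` or if `ψ` sends it to a bad point of `φ`; the second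
set keeps its area because `ψ` preserves area. -/
lemma Approximable.comp [DiscreteTopology Λ] {M : Set (Surface Λ)} {S T : Surface Λ → Surface Λ}
    (hS : Approximable M S) (hT : Approximable M T) : Approximable M (S ∘ T) := by
  intro ε hε
  have hε2 : ε / 2 ≠ 0 := by simp [hε]
  obtain ⟨φ, hφ, hφS⟩ := hS _ hε2
  obtain ⟨ψ, hψ, hψT⟩ := hT _ hε2
  refine ⟨ψ.trans φ, trans_mem_identityComponent hψ hφ, ?_⟩
  have hsub : {z | ((ψ.trans φ) z : Surface Λ) ≠ (S ∘ T) z} ⊆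
      {z | (ψ z : Surface Λ) ≠ T z} ∪ ψ ⁻¹' {w | (φ w : Surface Λ) ≠ S w} := by
    intro z hz
    by_contra hcon
    simp only [mem_union, not_or, mem_preimage, mem_ofPred_eq, not_not] at hcon
    exact hz (by simp [hcon.1, hcon.2])
  refine (measure_mono hsub).trans ((measure_union_le _ _).trans ?_)
  rw [(measurePreserving_of_mem_identityComponent hψ).measure_preimage_emb
    ψ.measurableEmbedding, ← ENNReal.add_halves ε]
  exact add_le_add hψT hφS

lemma Approximable.congr_ae {M : Set (Surface Λ)} (hM : MeasurableSet M)
    {S T : Surface Λ → Surface Λ} (hS : Approximable M S)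
    (h : surfaceArea Λ {z | S z ≠ T z} = 0) : Approximable M T := by
  intro ε hε
  obtain ⟨φ, hφ, hφS⟩ := hS _ hε
  refine ⟨φ, hφ, ?_⟩
  have hsub : {z : M | (φ z : Surface Λ) ≠ T z} ⊆
      {z | (φ z : Surface Λ) ≠ S z} ∪ {z : M | S z ≠ T z} := by
    intro z hz
    by_contra hcon
    simp only [mem_union, not_or, mem_ofPred_eq, not_not] at hcon
    exact hz (hcon.1.trans hcon.2)
  refine (measure_mono hsub).trans ((measure_union_le _ _).trans ?_)
  have h0 : area M {z : M | S z ≠ T z} = 0 := by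
    rw [area_apply hM]
    refine measure_mono_null ?_ h
    rintro _ ⟨z, hz, rfl⟩
    exact hz
  rw [h0, add_zero]
  exact hφS

/-- The translate by `x` of the image of `box h` in the surface. -/
def cell (h : Plane) (x : Surface Λ) : Set (Surface Λ) := {z | z - x ∈ proj Λ '' box h}

lemma add_proj_mem_cell {v : Plane} (hv : v ∈ box h) : x + proj Λ v ∈ cell h x :=
  ⟨v, hv, (add_sub_cancel_left _ _).symm⟩

lemma mem_cell {z : Surface Λ} : z ∈ cell h x ↔ ∃ v ∈ box h, x + proj Λ v = z := by
  refine exists_congr fun v => and_congr_right fun _ => ?_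
  rw [eq_sub_iff_add_eq, add_comm]

open Classical in
/-- The map that reflects a cell in its centre and is the identity elsewhere. -/
def cellReflection (h : Plane) (x z : Surface Λ) : Surface Λ :=
  if z ∈ cell h x then x + x - z else z

/-- The flow of `exists_box_twist`, transplanted to the cell, is an isotopy from the identity, and
its time one map misses the reflection only on a small set. -/
theorem approximable_cellReflection [DiscreteTopology Λ] {M : Set (Surface Λ)} (hM : IsClosed M)
    (hh : ∀ i, 0 < h i) (hinj : InjOn (proj Λ) (box h)) (hxM : cell h x ⊆ M) :
    Approximable M (cellReflection h x) := by
  intro ε hε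
  obtain ⟨F, L, hLb, hL, hF, hF0, hFadd, hFL, hFmp, hFε⟩ := exists_box_twist h hh hε
  have hneg (t : ℝ) (v : Plane) : F (-t) (F t v) = v := by rw [← hFadd, neg_add_cancel, hF0]
  have hmaps (t : ℝ) : MapsTo (F t) (box h) (box h) := by
    intro v hv
    by_contra hcon
    have h1 := hFL (-t) _ fun hx => hcon (hLb hx)
    rw [hneg] at h1
    exact hcon (h1 ▸ hv)
  have hiff (t : ℝ) (v : Plane) : F t v ∈ box h ↔ v ∈ box h := by
    refine ⟨fun hv => ?_, fun hv => hmaps t hv⟩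
    rw [← hneg t v]
    exact hmaps _ hv
  have hin (v : Plane) (hv : v ∈ box h) : x + proj Λ v ∈ M := hxM (add_proj_mem_cell hv)
  set T : ℝ → Surface Λ → Surface Λ := fun t => transplant x h (F t) with hT
  have hTM (t : ℝ) (z : Surface Λ) (hz : z ∈ M) : T t z ∈ M :=
    transplant_mem hinj (hmaps t) hin hz
  have hTneg (t : ℝ) (z : Surface Λ) : T (-t) (T t z) = z := by
    simp only [hT]
    rw [transplant_transplant hinj (hmaps t)]
    have : F (-t) ∘ F t = id := funext (hneg t)
    rw [this, transplant_id hinj]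
  have hTneg' (t : ℝ) (z : Surface Λ) : T t (T (-t) z) = z := by
    have := hTneg (-t) z
    rwa [neg_neg] at this
  have hlift := exists_local_lift_transplant (x := x) hinj hL hLb hF hFL
  have hTc (t : ℝ) : Continuous (T t) := by
    rw [(QuotientAddGroup.isQuotientMap_mk (N := Λ)).continuous_iff, continuous_iff_continuousAt]
    intro p
    obtain ⟨V, hV, H, hH, hVH⟩ := hlift p
    have hc : Continuous fun y : Plane => proj Λ (H (t, y)) :=
      continuous_proj.comp (hH.continuous.comp (by fun_prop))
    refine hc.continuousAt.congr ?_
    filter_upwards [hV] with y hy using (hVH t y hy).symm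
  let Φ : ℝ → (M ≃ₜ M) := fun t =>
    { toFun := fun z => ⟨T t z, hTM t z z.2⟩
      invFun := fun z => ⟨T (-t) z, hTM (-t) z z.2⟩
      left_inv := fun z => Subtype.ext (hTneg t z)
      right_inv := fun z => Subtype.ext (hTneg' t z)
      continuous_toFun := ((hTc t).comp continuous_subtype_val).subtype_mk _
      continuous_invFun := ((hTc (-t)).comp continuous_subtype_val).subtype_mk _ }
  -- With `a = 1` this is the isotopy. For general `a`, the member at time one shows that `Φ a` is
  -- smooth; negative `a` gives the inverses.
  have hfam (a : ℝ) : IsSmoothFamily fun t => (Φ (a * t) : M → M) := by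
    intro t _ p _
    obtain ⟨V, hV, H, hH, hVH⟩ := hlift p
    refine ⟨Prod.snd ⁻¹' V, continuous_snd.continuousAt.preimage_mem_nhds hV,
      fun q => H (a * q.1, q.2), ?_, fun s _ y hy hyM => hVH (a * s) y hy⟩
    exact (hH.comp (by fun_prop : ContDiff ℝ ∞ fun q : ℝ × Plane => (a * q.1, q.2))).contDiffOn
  have hmap (t : ℝ) : IsSmoothMap (Φ t) := by
    simpa using (hfam t).isSmoothMap (right_mem_Icc.2 zero_le_one)
  refine ⟨Φ 1, ⟨Φ, fun t _ => ⟨hmap t, ?_, ?_⟩, by simpa using hfam 1, ?_, rfl⟩, ?_⟩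
  · exact hmap (-t)
  · refine measurePreserving_area hM.measurableSet
      (measurePreserving_transplant hinj (hFmp t) (hiff t) (hTc t).measurable)
      (fun z => ⟨fun hz => ?_, hTM t z⟩) fun z => rfl
    rw [← hTneg t z]
    exact hTM _ _ hz
  · ext z
    show T 0 z = z
    have : F 0 = id := funext hF0
    simp only [hT, this]
    exact transplant_id hinj _
  · rw [area_apply hM.measurableSet]
    set B : Set Plane := {v | v ∈ box h ∧ F 1 v ≠ -v} with hB
    obtain ⟨c, rfl⟩ := QuotientAddGroup.mk_surjective x
    have hBm : MeasurableSet B := by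
      refine (isOpen_box h).measurableSet.inter (IsOpen.measurableSet ?_)
      have hc : Continuous (F 1) := hF.continuous.comp (by fun_prop : Continuous fun v => ((1 : ℝ), v))
      exact isOpen_ne_fun hc continuous_neg
    have hsub : Subtype.val '' {z : M | (Φ 1 z : Surface Λ) ≠ cellReflection h (proj Λ c) z} ⊆
        proj Λ '' ((fun y => y - c) ⁻¹' B) := by
      rintro _ ⟨⟨z, hzM⟩, hz, rfl⟩
      have hz' : T 1 z ≠ cellReflection h (proj Λ c) z := hz
      by_cases hzc : z ∈ cell h (proj Λ c)
      · obtain ⟨v, hv, rfl⟩ := mem_cell.1 hzc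
        refine ⟨c + v, ⟨by simpa using hv, fun hFv => hz' ?_⟩, proj_add' c v⟩
        simp only [add_sub_cancel_left] at hFv
        simp only [hT]
        rw [cellReflection, if_pos hzc, transplant_of_mem hinj hv, hFv, proj_neg']
        abel
      · refine absurd ?_ hz'
        rw [cellReflection, if_neg hzc]
        exact transplant_of_notMem fun v hv hvz => hzc (mem_cell.2 ⟨v, hv, hvz⟩)
    have hmp := measurePreserving_sub_right (volume : Measure Plane) c
    calc _ ≤ _ := measure_mono hsub
      _ ≤ volume ((fun y => y - c) ⁻¹' B) :=
        surfaceArea_image_proj_le (hmp.measurable hBm)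
      _ = volume B := hmp.measure_preimage hBm.nullMeasurableSet
      _ ≤ ε := hFε

end Transplant

/-! ### Exchange of two cells by reflections -/

section Swap

variable {Λ : AddSubgroup Plane}

lemma mem_box_iff {i j : Fin 2} (hij : i ≠ j) {h v : Plane} :
    v ∈ box h ↔ |v i| < h i ∧ |v j| < h j := by
  refine ⟨fun hv => ⟨hv i, hv j⟩, fun hv k => ?_⟩
  have : k = i ∨ k = j := by omega
  rcases this with rfl | rfl
  exacts [hv.1, hv.2]

lemma box_mono {h h' : Plane} (hh : ∀ i, h i ≤ h' i) : box h ⊆ box h' := fun _ hv i =>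
  (hv i).trans_le (hh i)

/-- The unit vector in the direction of the axis `i`. -/
abbrev axis (i : Fin 2) : Plane := EuclideanSpace.single i 1

open Classical in
/-- The map of the plane that reflects the box `d + box h` in its centre and is the identity
elsewhere. -/
def boxReflection (h d v : Plane) : Plane := if v - d ∈ box h then d + d - v else v

open Classical in
/-- The map that exchanges two disjoint cells by translations and is the identity elsewhere. -/
def cellSwap (h : Plane) (x y z : Surface Λ) : Surface Λ :=
  if z ∈ cell h x then z - x + y else if z ∈ cell h y then z - y + x else z

open Classical in
/-- The map of the plane that exchanges the boxes `d + box h` and `e + box h`. -/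
def boxSwap (h d e v : Plane) : Plane :=
  if v - d ∈ box h then v - d + e else if v - e ∈ box h then v - e + d else v

variable {c : Surface Λ} {h H d e : Plane}

lemma eq_transplant {f : Surface Λ → Surface Λ} {G : Plane → Plane}
    (hinj : InjOn (proj Λ) (box H)) (h1 : ∀ v ∈ box H, f (c + proj Λ v) = c + proj Λ (G v))
    (h2 : ∀ z ∉ cell H c, f z = z) : f = transplant c H G := by
  ext z
  by_cases hz : z ∈ cell H c
  · obtain ⟨v, hv, rfl⟩ := mem_cell.1 hz
    rw [h1 v hv, transplant_of_mem hinj hv]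
  · rw [h2 z hz, transplant_of_notMem fun v hv hvz => hz (mem_cell.2 ⟨v, hv, hvz⟩)]

lemma mem_cell_add_proj_iff (hinj : InjOn (proj Λ) (box H)) (hd : ∀ u ∈ box h, d + u ∈ box H)
    {v : Plane} (hv : v ∈ box H) : c + proj Λ v ∈ cell h (c + proj Λ d) ↔ v - d ∈ box h := by
  rw [mem_cell]
  constructor
  · rintro ⟨u, hu, huv⟩
    rw [add_assoc, ← proj_add'] at huv
    have := hinj (hd u hu) hv (add_left_cancel huv)
    rwa [← this, add_sub_cancel_left]
  · intro hu
    exact ⟨v - d, hu, by rw [add_assoc, ← proj_add', add_sub_cancel]⟩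

lemma cell_add_proj_subset (hd : ∀ u ∈ box h, d + u ∈ box H) :
    cell h (c + proj Λ d) ⊆ cell H c := by
  intro z hz
  obtain ⟨u, hu, rfl⟩ := mem_cell.1 hz
  exact mem_cell.2 ⟨d + u, hd u hu, by rw [add_assoc, ← proj_add']⟩

lemma cellReflection_eq_transplant (hinj : InjOn (proj Λ) (box H))
    (hd : ∀ u ∈ box h, d + u ∈ box H) :
    cellReflection h (c + proj Λ d) = transplant c H (boxReflection h d) := by
  refine eq_transplant hinj (fun v hv => ?_) fun z hz => ?_
  · have hiff := mem_cell_add_proj_iff (c := c) hinj hd hv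
    rw [cellReflection, boxReflection]
    by_cases hvd : v - d ∈ box h
    · rw [if_pos (hiff.2 hvd), if_pos hvd, proj_sub', proj_add']
      abel
    · rw [if_neg fun hx => hvd (hiff.1 hx), if_neg hvd]
  · rw [cellReflection, if_neg fun hx => hz (cell_add_proj_subset hd hx)]

lemma cellSwap_eq_transplant (hinj : InjOn (proj Λ) (box H))
    (hd : ∀ u ∈ box h, d + u ∈ box H) (he : ∀ u ∈ box h, e + u ∈ box H) :
    cellSwap h (c + proj Λ d) (c + proj Λ e) = transplant c H (boxSwap h d e) := by
  refine eq_transplant hinj (fun v hv => ?_) fun z hz => ?_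
  · have hiff := mem_cell_add_proj_iff (c := c) hinj hd hv
    have hiff' := mem_cell_add_proj_iff (c := c) hinj he hv
    rw [cellSwap, boxSwap]
    by_cases hvd : v - d ∈ box h
    · rw [if_pos (hiff.2 hvd), if_pos hvd, proj_add', proj_sub']
      abel
    · rw [if_neg fun hx => hvd (hiff.1 hx), if_neg hvd]
      by_cases hve : v - e ∈ box h
      · rw [if_pos (hiff'.2 hve), if_pos hve, proj_add', proj_sub']
        abel
      · rw [if_neg fun hx => hve (hiff'.1 hx), if_neg hve]
  · rw [cellSwap, if_neg fun hx => hz (cell_add_proj_subset hd hx),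
      if_neg fun hx => hz (cell_add_proj_subset he hx)]

lemma mapsTo_boxReflection (hd : ∀ u ∈ box h, d + u ∈ box H) :
    MapsTo (boxReflection h d) (box H) (box H) := by
  intro v hv
  rw [boxReflection]
  split_ifs with hvd
  · have := hd _ (neg_mem_box hvd)
    rwa [neg_sub, ← add_sub_assoc] at this
  · exact hv

/-- The exchange of two boxes in a row, as a product of four reflections. -/
lemma boxReflection_comp_eq_boxSwap {i j : Fin 2} (hij : i ≠ j) {a : ℝ} (hi : 0 < h i)
    (ha : 2 * h i < a) {v : Plane} (hv : v ∈ box (h + (a / 2) • axis i))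
    (hvi : |v i| ≠ a / 2 - h i) :
    boxReflection (h + (a / 2) • axis i) 0 (boxReflection h (-(a / 2) • axis i)
      (boxReflection h ((a / 2) • axis i)
        (boxReflection (h + (a / 2 - 2 * h i) • axis i) 0 v))) =
      boxSwap h (-(a / 2) • axis i) ((a / 2) • axis i) v := by
  -- The gap between the boxes is reflected first, then each box, then the whole row. A point of the
  -- gap is reflected twice in the same centre and returns. A point of a box is reflected in the
  -- centre of its box and then in that of the row, which is a translation onto the other box. The
  -- hypothesis `hvi` excludes the edges of the gap.
  have hji : j ≠ i := hij.symm
  rw [mem_box_iff hij] at hv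
  simp only [PiLp.add_apply, PiLp.smul_apply, PiLp.single_apply, smul_eq_mul, if_true, hji,
    if_false, mul_one, mul_zero, add_zero] at hv
  obtain ⟨hv1, hv2⟩ := hv
  have hv1' := abs_lt.1 hv1
  have key (s : ℝ) (u : Plane) (b : ℝ) : u - s • axis i ∈ box (h + b • axis i) ↔
      |u i - s| < h i + b ∧ |u j| < h j := by
    rw [mem_box_iff hij]
    simp [hji]
  have key0 (s : ℝ) (u : Plane) : u - s • axis i ∈ box h ↔ |u i - s| < h i ∧ |u j| < h j := by
    simpa using key s u 0
  have keyz (u : Plane) (b : ℝ) : u - 0 ∈ box (h + b • axis i) ↔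
      |u i| < h i + b ∧ |u j| < h j := by
    simpa using key 0 u b
  rcases lt_or_gt_of_ne hvi with hlt | hgt
  · have hlt' := abs_lt.1 hlt
    have m1 : v - 0 ∈ box (h + (a / 2 - 2 * h i) • axis i) :=
      (keyz _ _).2 ⟨by rw [abs_lt]; constructor <;> linarith, hv2⟩
    have n1 (u : Plane) (hu : |u i| < a / 2 - h i) : u - (a / 2) • axis i ∉ box h := by
      intro hx
      have := abs_lt.1 ((key0 _ _).1 hx).1
      have := abs_lt.1 hu
      linarith
    have n2 (u : Plane) (hu : |u i| < a / 2 - h i) : u - (-(a / 2)) • axis i ∉ box h := by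
      intro hx
      have := abs_lt.1 ((key0 _ _).1 hx).1
      have := abs_lt.1 hu
      linarith
    have hneg : |(0 + 0 - v : Plane) i| < a / 2 - h i := by simpa using hlt
    have m2 : (0 + 0 - v) - 0 ∈ box (h + (a / 2) • axis i) :=
      (keyz _ _).2 ⟨by simpa using hv1, by simpa using hv2⟩
    rw [boxSwap, if_neg (n2 v hlt), if_neg (n1 v hlt)]
    rw [boxReflection, boxReflection, boxReflection, boxReflection, if_pos m1, if_neg (n1 _ hneg),
      if_neg (n2 _ hneg), if_pos m2]
    simp
  · have n1 : v - 0 ∉ box (h + (a / 2 - 2 * h i) • axis i) := by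
      intro hx
      have := ((keyz _ _).1 hx).1
      linarith
    rcases lt_abs.1 hgt with hpos | hneg
    · have m2 : v - (a / 2) • axis i ∈ box h :=
        (key0 _ _).2 ⟨by rw [abs_lt]; constructor <;> linarith, hv2⟩
      have n3 : v - (-(a / 2)) • axis i ∉ box h := by
        intro hx
        have := abs_lt.1 ((key0 _ _).1 hx).1
        linarith
      set w := (a / 2) • axis i + (a / 2) • axis i - v with hw
      have hwi : w i = a - v i := by simp [hw]
      have hwj : w j = -v j := by simp [hw, hji]
      have n4 : w - (-(a / 2)) • axis i ∉ box h := by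
        intro hx
        have := abs_lt.1 ((key0 _ _).1 hx).1
        rw [hwi] at this
        linarith
      have m5 : w - 0 ∈ box (h + (a / 2) • axis i) :=
        (keyz _ _).2 ⟨by rw [hwi, abs_lt]; constructor <;> linarith, by rwa [hwj, abs_neg]⟩
      rw [boxSwap, if_neg n3, if_pos m2]
      rw [boxReflection, boxReflection, boxReflection, boxReflection, if_neg n1, if_pos m2, ← hw,
        if_neg n4, if_pos m5, hw, neg_smul]
      simp only [add_zero, zero_sub, neg_sub]
      rw [← sub_sub, ← sub_eq_add_neg]
    · have n2 : v - (a / 2) • axis i ∉ box h := by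
        intro hx
        have := abs_lt.1 ((key0 _ _).1 hx).1
        linarith
      have m3 : v - (-(a / 2)) • axis i ∈ box h :=
        (key0 _ _).2 ⟨by rw [abs_lt]; constructor <;> linarith, hv2⟩
      set w := -(a / 2) • axis i + -(a / 2) • axis i - v with hw
      have hwi : w i = -a - v i := by simp [hw]; ring
      have hwj : w j = -v j := by simp [hw, hji]
      have m5 : w - 0 ∈ box (h + (a / 2) • axis i) :=
        (keyz _ _).2 ⟨by rw [hwi, abs_lt]; constructor <;> linarith, by rwa [hwj, abs_neg]⟩
      rw [boxSwap, if_pos m3]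
      rw [boxReflection, boxReflection, boxReflection, boxReflection, if_neg n1, if_neg n2,
        if_pos m3, ← hw, if_pos m5, hw, neg_smul]
      simp only [add_zero, zero_sub, neg_sub]
      rw [← sub_sub, sub_neg_eq_add, sub_neg_eq_add]

lemma volume_coord_eq (i : Fin 2) (b : ℝ) : volume {v : Plane | v i = b} = 0 := by
  refine measure_eq_zero_of_hasFDerivAt_ne_zero volume (ρ := fun v => v i - b)
    (fun v (hv : v i = b) => sub_eq_zero.2 hv) fun v _ =>
      ⟨(EuclideanSpace.proj i : Plane →L[ℝ] ℝ), ?_, ?_⟩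
  · intro h0
    have := DFunLike.congr_fun h0 (axis i)
    simp at this
  · exact ((EuclideanSpace.proj i : Plane →L[ℝ] ℝ).hasFDerivAt).sub_const b

lemma volume_abs_coord_sub_eq (i : Fin 2) (b a : ℝ) :
    volume {v : Plane | |v i - b| = a} = 0 := by
  refine measure_mono_null (fun v hv => ?_)
    (measure_union_null (volume_coord_eq i (b + a)) (volume_coord_eq i (b - a)))
  have hv' : |v i - b| = a := hv
  rcases eq_or_eq_neg_of_abs_eq hv' with h | h
  · exact Or.inl (show v i = b + a by linarith)
  · exact Or.inr (show v i = b - a by linarith)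

lemma surfaceArea_transplant_ne [DiscreteTopology Λ] {G G' : Plane → Plane}
    (hinj : InjOn (proj Λ) (box H)) {Z : Set Plane} (hZ : volume Z = 0)
    (hG : ∀ v ∈ box H, v ∉ Z → G v = G' v) :
    surfaceArea Λ {z | transplant c H G z ≠ transplant c H G' z} = 0 := by
  obtain ⟨c, rfl⟩ := QuotientAddGroup.mk_surjective c
  have hZ' := measure_toMeasurable (μ := volume) Z
  have hmp := measurePreserving_sub_right (volume : Measure Plane) c
  have hm := measurableSet_toMeasurable volume Z
  refine measure_mono_null (t := proj Λ '' ((fun y => y - c) ⁻¹' toMeasurable volume Z))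
    (fun z hz => ?_) ?_
  · by_cases hzc : z ∈ cell H (proj Λ c)
    · obtain ⟨v, hv, rfl⟩ := mem_cell.1 hzc
      refine ⟨c + v, ?_, proj_add' c v⟩
      simp only [mem_preimage, add_sub_cancel_left]
      by_contra hvZ
      refine hz ?_
      rw [transplant_of_mem hinj hv, transplant_of_mem hinj hv,
        hG v hv fun hx => hvZ (subset_toMeasurable _ _ hx)]
    · refine absurd ?_ hz
      have h1 : ∀ v ∈ box H, proj Λ c + proj Λ v ≠ z := fun v hv hvz =>
        hzc (mem_cell.2 ⟨v, hv, hvz⟩)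
      rw [transplant_of_notMem h1, transplant_of_notMem h1]
  · refine le_antisymm ((surfaceArea_image_proj_le (hmp.measurable hm)).trans ?_) bot_le
    rw [hmp.measure_preimage hm.nullMeasurableSet, hZ', hZ]

/-- In the chart of the row `H`, which contains both cells, the four reflections compose to the
exchange off two null lines. The strict inequality `ha` gives the gap positive width, so that it is
itself a cell to be reflected. -/
lemma approximable_cellSwap_row [DiscreteTopology Λ] {M : Set (Surface Λ)} (hM : IsClosed M)
    {i j : Fin 2} (hij : i ≠ j) {a : ℝ} (hh : ∀ k, 0 < h k) (ha : 2 * h i < a)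
    (hinj : InjOn (proj Λ) (box (h + (a / 2) • axis i)))
    (hcM : cell (h + (a / 2) • axis i) c ⊆ M) :
    Approximable M (cellSwap h (c + proj Λ (-(a / 2) • axis i))
      (c + proj Λ ((a / 2) • axis i))) := by
  have hji : j ≠ i := hij.symm
  set H := h + (a / 2) • axis i with hH
  have hi := hh i
  have hj := hh j
  have sub1 : ∀ u ∈ box h, -(a / 2) • axis i + u ∈ box H := by
    intro u hu
    rw [mem_box_iff hij] at hu ⊢
    have := abs_lt.1 hu.1
    refine ⟨?_, by simpa [hH, hji] using hu.2⟩
    simp only [hH, PiLp.add_apply, PiLp.smul_apply, PiLp.single_apply, smul_eq_mul, if_true]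
    rw [abs_lt]; constructor <;> linarith
  have sub2 : ∀ u ∈ box h, (a / 2) • axis i + u ∈ box H := by
    intro u hu
    rw [mem_box_iff hij] at hu ⊢
    have := abs_lt.1 hu.1
    refine ⟨?_, by simpa [hH, hji] using hu.2⟩
    simp only [hH, PiLp.add_apply, PiLp.smul_apply, PiLp.single_apply, smul_eq_mul, if_true]
    rw [abs_lt]; constructor <;> linarith
  have sub3 : ∀ u ∈ box (h + (a / 2 - 2 * h i) • axis i), 0 + u ∈ box H := by
    intro u hu
    rw [zero_add]
    refine box_mono (fun k => ?_) hu
    have : k = i ∨ k = j := by omega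
    rcases this with rfl | rfl
    · simp [hH]; linarith
    · simp [hH, hji]
  have sub4 : ∀ u ∈ box H, 0 + u ∈ box H := fun u hu => by rwa [zero_add]
  have r1 := approximable_cellReflection (x := c + proj Λ (-(a / 2) • axis i)) hM hh
    (hinj.mono fun u hu => box_mono (fun k => by
      have : k = i ∨ k = j := by omega
      rcases this with rfl | rfl
      · simp [hH]; linarith
      · simp [hH, hji]) hu) ((cell_add_proj_subset sub1).trans hcM)
  have r2 := approximable_cellReflection (x := c + proj Λ ((a / 2) • axis i)) hM hh
    (hinj.mono fun u hu => box_mono (fun k => by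
      have : k = i ∨ k = j := by omega
      rcases this with rfl | rfl
      · simp [hH]; linarith
      · simp [hH, hji]) hu) ((cell_add_proj_subset sub2).trans hcM)
  have r3 := approximable_cellReflection (x := c + proj Λ 0)
    (h := h + (a / 2 - 2 * h i) • axis i) hM (fun k => by
      have : k = i ∨ k = j := by omega
      rcases this with rfl | rfl
      · simp; linarith
      · simpa [hji] using hj) (hinj.mono fun u hu => by simpa using sub3 u hu)
      ((cell_add_proj_subset sub3).trans hcM)
  have r4 := approximable_cellReflection (x := c + proj Λ 0) (h := H) hM (fun k => by
      have : k = i ∨ k = j := by omega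
      rcases this with rfl | rfl
      · simp [hH]; linarith
      · simpa [hH, hji] using hj) hinj ((cell_add_proj_subset sub4).trans hcM)
  have r := (r4.comp r1).comp (r2.comp r3)
  rw [cellReflection_eq_transplant hinj sub1, cellReflection_eq_transplant hinj sub2,
    cellReflection_eq_transplant hinj sub3, cellReflection_eq_transplant hinj sub4] at r
  rw [cellSwap_eq_transplant hinj sub1 sub2]
  have hcomp : (transplant c H (boxReflection H 0) ∘
      transplant c H (boxReflection h (-(a / 2) • axis i))) ∘
      (transplant c H (boxReflection h ((a / 2) • axis i)) ∘
        transplant c H (boxReflection (h + (a / 2 - 2 * h i) • axis i) 0)) =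
      transplant c H ((boxReflection H 0 ∘ boxReflection h (-(a / 2) • axis i)) ∘
        (boxReflection h ((a / 2) • axis i) ∘
          boxReflection (h + (a / 2 - 2 * h i) • axis i) 0)) := by
    ext z
    simp only [Function.comp_apply]
    rw [transplant_transplant hinj (mapsTo_boxReflection sub3),
      transplant_transplant hinj ((mapsTo_boxReflection sub2).comp (mapsTo_boxReflection sub3)),
      transplant_transplant hinj ((mapsTo_boxReflection sub1).comp
        ((mapsTo_boxReflection sub2).comp (mapsTo_boxReflection sub3)))]
    rfl
  rw [hcomp] at r
  refine r.congr_ae hM.measurableSet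
    (surfaceArea_transplant_ne hinj (volume_abs_coord_sub_eq i 0 (a / 2 - h i))
      fun v hv hvZ => ?_)
  exact boxReflection_comp_eq_boxSwap hij hi ha hv fun hx => hvZ (by simpa using hx)

lemma sub_add_mem_cell {x y z : Surface Λ} (hz : z ∈ cell h x) : z - x + y ∈ cell h y := by
  obtain ⟨v, hv, hvz⟩ := hz
  exact ⟨v, hv, by rw [hvz, add_sub_cancel_right]⟩

lemma cellSwap_comm {x y : Surface Λ} (hxy : Disjoint (cell h x) (cell h y)) :
    cellSwap h x y = cellSwap h y x := by
  ext z
  rw [cellSwap, cellSwap]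
  by_cases hx : z ∈ cell h x
  · rw [if_pos hx, if_neg (disjoint_left.1 hxy hx), if_pos hx]
  · rw [if_neg hx, if_neg hx]

/-- This is the identity `(x y)(y z)(x y) = (x z)` for transpositions. It holds pointwise because
cells are moved by translations, which cancel. -/
lemma cellSwap_conj {x y z : Surface Λ} (hxy : Disjoint (cell h x) (cell h y))
    (hyz : Disjoint (cell h y) (cell h z)) (hxz : Disjoint (cell h x) (cell h z)) :
    cellSwap h x y ∘ cellSwap h y z ∘ cellSwap h x y = cellSwap h x z := by
  ext w
  have e1 (a b : Surface Λ) (u : Surface Λ) : u - a + b - b = u - a := add_sub_cancel_right _ _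
  simp only [Function.comp_apply]
  by_cases hx : w ∈ cell h x
  · have h1 : w - x + y ∈ cell h y := sub_add_mem_cell hx
    have h2 : w - x + z ∈ cell h z := sub_add_mem_cell hx
    have s1 : cellSwap h x y w = w - x + y := if_pos hx
    have s2 : cellSwap h y z (w - x + y) = w - x + z := by
      rw [cellSwap, if_pos h1, e1]
    have s3 : cellSwap h x y (w - x + z) = w - x + z := by
      rw [cellSwap, if_neg (disjoint_right.1 hxz h2), if_neg (disjoint_right.1 hyz h2)]
    have s4 : cellSwap h x z w = w - x + z := if_pos hx
    rw [s1, s2, s3, s4]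
  · by_cases hy : w ∈ cell h y
    · have h1 : w - y + x ∈ cell h x := sub_add_mem_cell hy
      have s1 : cellSwap h x y w = w - y + x := by rw [cellSwap, if_neg hx, if_pos hy]
      have s2 : cellSwap h y z (w - y + x) = w - y + x := by
        rw [cellSwap, if_neg (disjoint_left.1 hxy h1), if_neg (disjoint_left.1 hxz h1)]
      have s3 : cellSwap h x y (w - y + x) = w := by
        rw [cellSwap, if_pos h1, e1, sub_add_cancel]
      have s4 : cellSwap h x z w = w := by
        rw [cellSwap, if_neg hx, if_neg (disjoint_left.1 hyz hy)]
      rw [s1, s2, s3, s4]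
    · have s1 : cellSwap h x y w = w := by rw [cellSwap, if_neg hx, if_neg hy]
      rw [s1]
      by_cases hz : w ∈ cell h z
      · have h1 : w - z + y ∈ cell h y := sub_add_mem_cell hz
        have s2 : cellSwap h y z w = w - z + y := by rw [cellSwap, if_neg hy, if_pos hz]
        have s3 : cellSwap h x y (w - z + y) = w - z + x := by
          rw [cellSwap, if_neg (disjoint_right.1 hxy h1), if_pos h1, e1]
        have s4 : cellSwap h x z w = w - z + x := by rw [cellSwap, if_neg hx, if_pos hz]
        rw [s2, s3, s4]
      · have s2 : cellSwap h y z w = w := by rw [cellSwap, if_neg hy, if_neg hz]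
        have s4 : cellSwap h x z w = w := by rw [cellSwap, if_neg hx, if_neg hz]
        rw [s2, s1, s4]

lemma Approximable.cellSwap_trans [DiscreteTopology Λ] {M : Set (Surface Λ)} {x y z : Surface Λ}
    (hxy : Disjoint (cell h x) (cell h y)) (hyz : Disjoint (cell h y) (cell h z))
    (hxz : Disjoint (cell h x) (cell h z)) (h1 : Approximable M (cellSwap h x y))
    (h2 : Approximable M (cellSwap h y z)) : Approximable M (cellSwap h x z) := by
  rw [← cellSwap_conj hxy hyz hxz]
  exact h1.comp (h2.comp h1)

end Swap

/-! ### From exchanges along an axis to exchanges across the interior -/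

section LocalSwap

variable {Λ : AddSubgroup Plane}

/-- The vector with both coordinates equal to `κ`. -/
def diag (κ : ℝ) : Plane := !₂[κ, κ]

@[simp] lemma diag_apply (κ : ℝ) (i : Fin 2) : diag κ i = κ := by fin_cases i <;> rfl

lemma add_mem_box {h h' h'' u v : Plane} (hu : u ∈ box h) (hv : v ∈ box h')
    (hh : ∀ i, h i + h' i ≤ h'' i) : u + v ∈ box h'' := fun i => by
  have := abs_add_le (u i) (v i)
  have := hu i
  have := hv i
  have := hh i
  simp only [PiLp.add_apply]
  linarith

lemma disjoint_cell_add_proj {c : Surface Λ} {h H d e : Plane} (hinj : InjOn (proj Λ) (box H))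
    (hd : ∀ u ∈ box h, d + u ∈ box H) (he : ∀ u ∈ box h, e + u ∈ box H) {i : Fin 2}
    (hi : 2 * h i ≤ |d i - e i|) :
    Disjoint (cell h (c + proj Λ d)) (cell h (c + proj Λ e)) := by
  rw [disjoint_left]
  intro z hz hz'
  obtain ⟨u, hu, rfl⟩ := mem_cell.1 hz
  rw [add_assoc, ← proj_add', mem_cell_add_proj_iff hinj he (hd u hu)] at hz'
  have h1 := abs_lt.1 (hz' i)
  have h2 := abs_lt.1 (hu i)
  simp only [PiLp.sub_apply, PiLp.add_apply] at h1
  have h3 : |d i - e i| < 2 * h i := by rw [abs_lt]; constructor <;> linarith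
  linarith

/-- The row is centred at the midpoint `u + (a / 2) • axis i`. The bounds give `a ≤ 8κ`, so its half
length is at most `5κ` and it fits in the box of size `10κ`. -/
lemma approximable_cellSwap_add_smul_axis [DiscreteTopology Λ] {M : Set (Surface Λ)}
    (hM : IsClosed M) {x : Surface Λ} {κ : ℝ} (hinj : InjOn (proj Λ) (box (diag (10 * κ))))
    (hxM : cell (diag (10 * κ)) x ⊆ M) {h : Plane} (hh : ∀ k, 0 < h k) (hκ : ∀ k, h k ≤ κ)
    {u : Plane} (hu : ∀ k, |u k| ≤ 4 * κ) {i : Fin 2} {a : ℝ} (ha : 2 * h i < a)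
    (hua : |u i + a| ≤ 4 * κ) :
    Approximable M (cellSwap h (x + proj Λ u) (x + proj Λ (u + a • axis i))) := by
  obtain ⟨j, hij⟩ : ∃ j, i ≠ j := ⟨i + 1, by fin_cases i <;> decide⟩
  have hji := hij.symm
  have hi := hκ i
  have hj := hκ j
  have hi' := hh i
  have hj' := hh j
  have hui := abs_le.1 (hu i)
  have huj := abs_le.1 (hu j)
  have hua' := abs_le.1 hua
  set c := x + proj Λ (u + (a / 2) • axis i) with hc
  have h1 : x + proj Λ u = c + proj Λ (-(a / 2) • axis i) := by
    rw [hc, add_assoc, ← proj_add', add_assoc, ← add_smul, add_neg_cancel, zero_smul, add_zero]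
  have h2 : x + proj Λ (u + a • axis i) = c + proj Λ ((a / 2) • axis i) := by
    rw [hc, add_assoc, ← proj_add', add_assoc, ← add_smul, add_halves]
  rw [h1, h2]
  refine approximable_cellSwap_row hM hij hh ha (hinj.mono ?_) ?_
  · intro v hv
    rw [mem_box_iff hij] at hv ⊢
    simp only [PiLp.add_apply, PiLp.smul_apply, PiLp.single_apply, smul_eq_mul, if_true, hji,
      if_false, mul_one, mul_zero, add_zero] at hv
    simp only [diag_apply]
    constructor <;> linarith
  · refine (cell_add_proj_subset fun v hv => ?_).trans hxM
    rw [mem_box_iff hij] at hv ⊢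
    simp only [PiLp.add_apply, PiLp.smul_apply, PiLp.single_apply, smul_eq_mul, if_true, hji,
      if_false, mul_one, mul_zero, add_zero] at hv ⊢
    simp only [diag_apply]
    have hv1 := abs_lt.1 hv.1
    have hv2 := abs_lt.1 hv.2
    constructor <;> rw [abs_lt] <;> constructor <;> linarith

/-- The corner is a parking place, reached by one move along each axis. Both moves are longer than
`2κ`, so the cells met on the way are disjoint. Through it one can exchange cells that are not
aligned, or that touch. -/
lemma approximable_cellSwap_corner [DiscreteTopology Λ] {M : Set (Surface Λ)}
    (hM : IsClosed M) {x : Surface Λ} {κ : ℝ} (hinj : InjOn (proj Λ) (box (diag (10 * κ))))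
    (hxM : cell (diag (10 * κ)) x ⊆ M) {h : Plane} (hh : ∀ k, 0 < h k) (hκ : ∀ k, h k ≤ κ / 2)
    {u : Plane} (hu : u ∈ box (diag κ)) :
    Approximable M (cellSwap h (x + proj Λ u) (x + proj Λ (diag (3 * κ)))) ∧
      Disjoint (cell h (x + proj Λ u)) (cell h (x + proj Λ (diag (3 * κ)))) := by
  have h0 := abs_lt.1 (hu 0)
  have h1 := abs_lt.1 (hu 1)
  simp only [diag_apply] at h0 h1
  have k0 := hκ 0
  have k1 := hκ 1
  have p0 := hh 0
  have p1 := hh 1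
  have hκ' (k : Fin 2) : h k ≤ κ := by linarith [hκ k, hh k]
  set v : Plane := u + (3 * κ - u 0) • axis 0 with hv
  have hv0 : v 0 = 3 * κ := by simp [hv]
  have hv1 : v 1 = u 1 := by simp [hv]
  have hw : v + (3 * κ - u 1) • axis 1 = diag (3 * κ) := by
    ext k; fin_cases k
    · simp [hv0]
    · simp [hv1]
  have hin (w : Plane) (hw : ∀ k, |w k| ≤ 4 * κ) : ∀ b ∈ box h, w + b ∈ box (diag (10 * κ)) := by
    intro b hb k
    have := abs_add_le (w k) (b k)
    have := hb k
    have := hw k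
    have := hκ' k
    simp only [PiLp.add_apply, diag_apply]
    linarith
  have bu : ∀ k, |u k| ≤ 4 * κ := by
    rw [Fin.forall_fin_two]; constructor <;> rw [abs_le] <;> constructor <;> linarith
  have bv : ∀ k, |v k| ≤ 4 * κ := by
    rw [Fin.forall_fin_two, hv0, hv1]; constructor <;> rw [abs_le] <;> constructor <;> linarith
  have bw : ∀ k, |(diag (3 * κ)) k| ≤ 4 * κ := by
    intro k; rw [diag_apply, abs_le]; constructor <;> linarith
  have d1 : Disjoint (cell h (x + proj Λ u)) (cell h (x + proj Λ v)) :=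
    disjoint_cell_add_proj hinj (hin u bu) (hin v bv) (i := 0) (by
      rw [hv0, abs_sub_comm]; exact le_trans (by linarith) (le_abs_self _))
  have d2 : Disjoint (cell h (x + proj Λ v)) (cell h (x + proj Λ (diag (3 * κ)))) :=
    disjoint_cell_add_proj hinj (hin v bv) (hin _ bw) (i := 1) (by
      rw [hv1, abs_sub_comm, diag_apply]; exact le_trans (by linarith) (le_abs_self _))
  have d3 : Disjoint (cell h (x + proj Λ u)) (cell h (x + proj Λ (diag (3 * κ)))) :=
    disjoint_cell_add_proj hinj (hin u bu) (hin _ bw) (i := 0) (by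
      rw [abs_sub_comm, diag_apply]; exact le_trans (by linarith) (le_abs_self _))
  refine ⟨?_, d3⟩
  have a1 : Approximable M (cellSwap h (x + proj Λ u) (x + proj Λ v)) :=
    approximable_cellSwap_add_smul_axis hM hinj hxM hh hκ' bu (by linarith)
      (by rw [abs_le]; constructor <;> linarith)
  have a2 : Approximable M (cellSwap h (x + proj Λ v) (x + proj Λ (diag (3 * κ)))) := by
    rw [← hw]
    exact approximable_cellSwap_add_smul_axis hM hinj hxM hh hκ' bv (by linarith)
      (by rw [hv1, abs_le]; constructor <;> linarith)
  exact a1.cellSwap_trans d1 d2 d3 a2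

lemma approximable_cellSwap_local [DiscreteTopology Λ] {M : Set (Surface Λ)}
    (hM : IsClosed M) {x : Surface Λ} {κ : ℝ} (hinj : InjOn (proj Λ) (box (diag (10 * κ))))
    (hxM : cell (diag (10 * κ)) x ⊆ M) {h : Plane} (hh : ∀ k, 0 < h k) (hκ : ∀ k, h k ≤ κ / 2)
    {u v : Plane} (hu : u ∈ box (diag κ)) (hv : v ∈ box (diag κ))
    (huv : Disjoint (cell h (x + proj Λ u)) (cell h (x + proj Λ v))) :
    Approximable M (cellSwap h (x + proj Λ u) (x + proj Λ v)) := by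
  obtain ⟨a1, d1⟩ := approximable_cellSwap_corner hM hinj hxM hh hκ hu
  obtain ⟨a2, d2⟩ := approximable_cellSwap_corner hM hinj hxM hh hκ hv
  rw [cellSwap_comm d2] at a2
  exact a1.cellSwap_trans d1 d2.symm huv a2

lemma zero_mem_box {h : Plane} (hh : ∀ k, 0 < h k) : (0 : Plane) ∈ box h := fun k => by
  simpa using hh k

lemma cell_mem_nhds {h : Plane} (hh : ∀ k, 0 < h k) (x : Surface Λ) : cell h x ∈ 𝓝 x := by
  have h1 : proj Λ '' box h ∈ 𝓝 (0 : Surface Λ) :=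
    isOpenMap_proj.image_mem_nhds ((isOpen_box h).mem_nhds (zero_mem_box hh))
  have hc : Continuous fun z : Surface Λ => z - x := continuous_id.sub continuous_const
  exact hc.continuousAt.preimage_mem_nhds (by simpa using h1)

lemma norm_lt_of_mem_box {r : ℝ} {v : Plane} (hv : v ∈ box (diag r)) : ‖v‖ < 2 * r := by
  rw [EuclideanSpace.norm_eq, Fin.sum_univ_two]
  have h0 := hv 0
  have h1 := hv 1
  simp only [diag_apply] at h0 h1
  have hr : 0 < r := (abs_nonneg _).trans_lt h0
  rw [← Real.sqrt_sq (by positivity : 0 ≤ 2 * r)]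
  apply Real.sqrt_lt_sqrt (by positivity)
  simp only [Real.norm_eq_abs]
  nlinarith [abs_nonneg (v 0), abs_nonneg (v 1)]

lemma exists_box_subset {U : Set Plane} (hU : U ∈ 𝓝 0) : ∃ κ > 0, box (diag κ) ⊆ U := by
  obtain ⟨r, hr, hrU⟩ := Metric.mem_nhds_iff.1 hU
  refine ⟨r / 2, by positivity, fun v hv => hrU ?_⟩
  rw [mem_ball_zero_iff]
  linarith [norm_lt_of_mem_box hv]

/-- Two points of the half-size box differ by a vector of the full box, which by discreteness
contains no nonzero element of `Λ`. -/
lemma exists_injOn_box [DiscreteTopology Λ] : ∃ κ > 0, InjOn (proj Λ) (box (diag κ)) := by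
  obtain ⟨U, hU, hUΛ⟩ : ∃ U ∈ 𝓝 (0 : Plane), ∀ v ∈ U, v ∈ Λ → v = 0 := by
    have h := (isOpen_discrete ({0} : Set Λ)).mem_nhds (mem_singleton 0)
    rw [nhds_subtype_eq_comap, mem_comap] at h
    obtain ⟨U, hU, hU0⟩ := h
    refine ⟨U, hU, fun v hv hvΛ => ?_⟩
    have : (⟨v, hvΛ⟩ : Λ) ∈ ({0} : Set Λ) := hU0 hv
    simpa using congrArg Subtype.val this
  obtain ⟨κ, hκ, hκU⟩ := exists_box_subset hU
  refine ⟨κ / 2, by positivity, fun u hu v hv huv => ?_⟩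
  have hmem : -u + v ∈ Λ := QuotientAddGroup.eq.1 huv
  have := hUΛ _ (hκU (add_mem_box (neg_mem_box hu) hv fun i => by simp)) hmem
  rwa [neg_add_eq_zero] at this

lemma exists_cell_subset {x : Surface Λ} {U : Set (Surface Λ)} (hU : U ∈ 𝓝 x) :
    ∃ κ > 0, cell (diag κ) x ⊆ U := by
  have hc : Continuous fun v : Plane => x + proj Λ v := continuous_const.add continuous_proj
  have h0 : x + proj Λ 0 = x := add_zero x
  obtain ⟨κ, hκ, hκU⟩ := exists_box_subset (hc.continuousAt.preimage_mem_nhds (by rwa [h0]))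
  refine ⟨κ, hκ, fun z hz => ?_⟩
  obtain ⟨v, hv, rfl⟩ := mem_cell.1 hz
  exact hκU hv

lemma cell_mono {h h' : Plane} (hh : ∀ i, h i ≤ h' i) (x : Surface Λ) : cell h x ⊆ cell h' x := by
  intro z hz
  obtain ⟨v, hv, rfl⟩ := mem_cell.1 hz
  exact add_proj_mem_cell (box_mono hh hv)

/-- Small disjoint cells near `x` and near `y` can be exchanged approximately. -/
def LocallySwappable (M : Set (Surface Λ)) (x y : Surface Λ) : Prop :=
  ∃ κ > 0, ∀ p ∈ cell (diag κ) x, ∀ q ∈ cell (diag κ) y, ∀ h : Plane, (∀ k, 0 < h k) →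
    (∀ k, h k ≤ κ) → Disjoint (cell h p) (cell h q) → Approximable M (cellSwap h p q)

lemma LocallySwappable.symm {M : Set (Surface Λ)} {x y : Surface Λ}
    (hxy : LocallySwappable M x y) : LocallySwappable M y x := by
  obtain ⟨κ, hκ, H⟩ := hxy
  refine ⟨κ, hκ, fun p hp q hq h hh hhκ hpq => ?_⟩
  rw [cellSwap_comm hpq]
  exact H q hq p hp h hh hhκ hpq.symm

lemma eventually_locallySwappable [DiscreteTopology Λ] {M : Set (Surface Λ)} (hM : IsClosed M)
    {x : Surface Λ} (hx : x ∈ interior M) : ∀ᶠ y in 𝓝 x, LocallySwappable M x y := by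
  obtain ⟨κ₁, hκ₁, hinj⟩ := exists_injOn_box (Λ := Λ)
  obtain ⟨κ₂, hκ₂, hxM⟩ := exists_cell_subset (mem_interior_iff_mem_nhds.1 hx)
  obtain ⟨κ, hκ, h1, h2⟩ : ∃ κ > 0, 10 * κ ≤ κ₁ ∧ 10 * κ ≤ κ₂ :=
    ⟨min κ₁ κ₂ / 10, by positivity, by linarith [min_le_left κ₁ κ₂],
      by linarith [min_le_right κ₁ κ₂]⟩
  have hinj' : InjOn (proj Λ) (box (diag (10 * κ))) :=
    hinj.mono (box_mono fun k => by simpa using h1)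
  have hxM' : cell (diag (10 * κ)) x ⊆ M := (cell_mono (fun k => by simpa using h2) x).trans hxM
  filter_upwards [cell_mem_nhds (h := diag (κ / 2)) (fun k => by rw [diag_apply]; positivity) x]
    with y hy
  obtain ⟨w, hw, rfl⟩ := mem_cell.1 hy
  refine ⟨κ / 2, by positivity, fun p hp q hq h hh hhκ hpq => ?_⟩
  obtain ⟨u, hu, rfl⟩ := mem_cell.1 hp
  obtain ⟨v, hv, rfl⟩ := mem_cell.1 hq
  rw [add_assoc, ← proj_add'] at hpq ⊢
  exact approximable_cellSwap_local hM hinj' hxM' hh hhκ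
    (box_mono (fun k => by simp only [diag_apply]; linarith) hu)
    (add_mem_box hw hv fun k => by simp) hpq

/-- A small cell meets at most one of the cells of a widely spaced row. -/
lemma not_meets_two {κ : ℝ} (hinj : InjOn (proj Λ) (box (diag (10 * κ)))) {h : Plane}
    (hκ : 0 < κ) (hhκ : ∀ k, h k ≤ κ) {p y : Surface Λ} {a b : ℝ} (ha : a ∈ Icc 0 (9 * κ))
    (hb : b ∈ Icc 0 (9 * κ)) (hab : 4 * κ ≤ |a - b|)
    (hpa : ¬ Disjoint (cell h p) (cell h (y + proj Λ (a • axis 0))))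
    (hpb : ¬ Disjoint (cell h p) (cell h (y + proj Λ (b • axis 0)))) : False := by
  obtain ⟨z, hz, hz'⟩ := not_disjoint_iff.1 hpa
  obtain ⟨w, hw, hw'⟩ := not_disjoint_iff.1 hpb
  obtain ⟨z1, hz1, rfl⟩ := mem_cell.1 hz
  obtain ⟨z2, hz2, hzz⟩ := mem_cell.1 hz'
  obtain ⟨w1, hw1, rfl⟩ := mem_cell.1 hw
  obtain ⟨w2, hw2, hww⟩ := mem_cell.1 hw'
  -- If the cell at `p` met both, `(a - b) • axis 0` would be congruent to a vector with coordinates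
  -- below `4κ`. Injectivity on the box of size `10κ` makes the two vectors equal, against `4κ ≤ |a
  -- - b|`.
  have hd : proj Λ ((a - b) • axis 0) = proj Λ (z1 - z2 - (w1 - w2)) := by
    rw [sub_smul, proj_sub', proj_sub', proj_sub', proj_sub']
    have e1 : proj Λ (a • axis 0) = p + proj Λ z1 - proj Λ z2 - y := by rw [← hzz]; abel
    have e2 : proj Λ (b • axis 0) = p + proj Λ w1 - proj Λ w2 - y := by rw [← hww]; abel
    rw [e1, e2]; abel
  have hb1 (k : Fin 2) : |(z1 - z2 - (w1 - w2)) k| < 4 * κ := by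
    have := abs_lt.1 (hz1 k)
    have := abs_lt.1 (hz2 k)
    have := abs_lt.1 (hw1 k)
    have := abs_lt.1 (hw2 k)
    have := hhκ k
    simp only [PiLp.sub_apply]
    rw [abs_lt]; constructor <;> linarith
  have hm1 : z1 - z2 - (w1 - w2) ∈ box (diag (10 * κ)) := fun k => by
    rw [diag_apply]; linarith [hb1 k]
  have hm2 : (a - b) • axis 0 ∈ box (diag (10 * κ)) := by
    rw [mem_box_iff (i := 0) (j := 1) (by decide)]
    obtain ⟨ha1, ha2⟩ := ha
    obtain ⟨hb1, hb2⟩ := hb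
    constructor
    · simp only [PiLp.smul_apply, PiLp.single_apply, smul_eq_mul, if_true, mul_one, diag_apply]
      rw [abs_lt]; constructor <;> linarith
    · simp [hκ]
  have heq := hinj hm2 hm1 hd
  have h0 := hb1 0
  rw [← heq] at h0
  simp only [PiLp.smul_apply, PiLp.single_apply, smul_eq_mul, if_true, mul_one] at h0
  linarith

/-- The exchange passes through an auxiliary cell near `y`. It has to avoid the cells at `p` and
`q`, which may themselves lie near `y`. -/
lemma LocallySwappable.trans [DiscreteTopology Λ] {M : Set (Surface Λ)} {x y z : Surface Λ}
    (hxy : LocallySwappable M x y) (hyz : LocallySwappable M y z) : LocallySwappable M x z := by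
  obtain ⟨κ₀, hκ₀, hinj⟩ := exists_injOn_box (Λ := Λ)
  obtain ⟨κ₁, hκ₁, H1⟩ := hxy
  obtain ⟨κ₂, hκ₂, H2⟩ := hyz
  obtain ⟨κ, hκ, h0, h1, h2⟩ : ∃ κ > 0, 10 * κ ≤ κ₀ ∧ 10 * κ ≤ κ₁ ∧ 10 * κ ≤ κ₂ := by
    refine ⟨min κ₀ (min κ₁ κ₂) / 10, by positivity, ?_, ?_, ?_⟩
    · linarith [min_le_left κ₀ (min κ₁ κ₂)]
    · linarith [min_le_right κ₀ (min κ₁ κ₂), min_le_left κ₁ κ₂]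
    · linarith [min_le_right κ₀ (min κ₁ κ₂), min_le_right κ₁ κ₂]
  have hinj' : InjOn (proj Λ) (box (diag (10 * κ))) :=
    hinj.mono (box_mono fun k => by simpa using h0)
  refine ⟨κ, hκ, fun p hp q hq h hh hhκ hpq => ?_⟩
  -- The candidates `0`, `4κ` and `8κ` are so far apart that each of the two given cells meets at
  -- most one of the three; a third one is free.
  obtain ⟨a, ha, hpa, hqa⟩ : ∃ a ∈ Icc 0 (9 * κ),
      Disjoint (cell h p) (cell h (y + proj Λ (a • axis 0))) ∧
      Disjoint (cell h q) (cell h (y + proj Λ (a • axis 0))) := by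
    have m0 : (0 : ℝ) ∈ Icc 0 (9 * κ) := ⟨le_rfl, by positivity⟩
    have m1 : 4 * κ ∈ Icc 0 (9 * κ) := ⟨by positivity, by linarith⟩
    have m2 : 8 * κ ∈ Icc 0 (9 * κ) := ⟨by positivity, by linarith⟩
    have d1 : 4 * κ ≤ |0 - 4 * κ| := by
      rw [zero_sub, abs_neg]; exact le_abs_self _
    have d2 : 4 * κ ≤ |0 - 8 * κ| := by
      rw [zero_sub, abs_neg]; exact le_trans (by linarith) (le_abs_self _)
    have d3 : 4 * κ ≤ |4 * κ - 8 * κ| := by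
      rw [abs_sub_comm]; exact le_trans (by linarith) (le_abs_self _)
    set D : Surface Λ → ℝ → Prop := fun r a =>
      Disjoint (cell h r) (cell h (y + proj Λ (a • axis 0)))
    have P (r : Surface Λ) (a b : ℝ) (ha : a ∈ Icc 0 (9 * κ)) (hb : b ∈ Icc 0 (9 * κ))
        (hab : 4 * κ ≤ |a - b|) (hra : ¬ D r a) : D r b := by
      by_contra hrb
      exact not_meets_two hinj' hκ hhκ ha hb hab hra hrb
    by_cases p0 : D p 0
    · by_cases q0 : D q 0
      · exact ⟨0, m0, p0, q0⟩
      · by_cases p1 : D p (4 * κ)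
        · exact ⟨_, m1, p1, P q _ _ m0 m1 d1 q0⟩
        · exact ⟨_, m2, P p _ _ m1 m2 d3 p1, P q _ _ m0 m2 d2 q0⟩
    · by_cases q1 : D q (4 * κ)
      · exact ⟨_, m1, P p _ _ m0 m1 d1 p0, q1⟩
      · exact ⟨_, m2, P p _ _ m0 m2 d2 p0, P q _ _ m1 m2 d3 q1⟩
  have hr : a • axis 0 ∈ box (diag (10 * κ)) := by
    rw [mem_box_iff (i := 0) (j := 1) (by decide)]
    constructor
    · simp only [PiLp.smul_apply, PiLp.single_apply, smul_eq_mul, if_true, mul_one, diag_apply]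
      rw [abs_lt]; constructor <;> linarith [ha.1, ha.2]
    · simp [hκ]
  have a1 := H1 p (cell_mono (fun k => by simp only [diag_apply]; linarith) _ hp)
    (y + proj Λ (a • axis 0)) (add_proj_mem_cell (box_mono (fun k => by simpa using h1) hr)) h hh
    (fun k => (hhκ k).trans (by linarith)) hpa
  have a2 := H2 (y + proj Λ (a • axis 0))
    (add_proj_mem_cell (box_mono (fun k => by simpa using h2) hr)) q
    (cell_mono (fun k => by simp only [diag_apply]; linarith) _ hq) h hh
    (fun k => (hhκ k).trans (by linarith)) hqa.symm
  exact a1.cellSwap_trans hpa hqa.symm hpq a2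

/-- The relation is symmetric and transitive and relates every interior point to its neighbours, so
it is total on the connected interior. -/
lemma locallySwappable_of_mem_interior [DiscreteTopology Λ] {M : Set (Surface Λ)}
    (hM : IsSmoothDomain M) {x y : Surface Λ} (hx : x ∈ interior M) (hy : y ∈ interior M) :
    LocallySwappable M x y :=
  hM.isConnected_interior.isPreconnected.induction₂ (LocallySwappable M)
    (fun _ hx => (eventually_locallySwappable hM.isClosed hx).filter_mono nhdsWithin_le_nhds)
    (fun _ _ _ _ _ _ h1 h2 => h1.trans h2) (fun _ _ _ _ h => h.symm) hx hy

/-- Sufficiently small disjoint cells with centres in a compact subset of the interior of `M` can be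
exchanged approximately. -/
theorem exists_uniform_swap [DiscreteTopology Λ] {M : Set (Surface Λ)}
    (hM : IsSmoothDomain M) {K : Set (Surface Λ)} (hK : IsCompact K) (hKM : K ⊆ interior M) :
    ∃ κ > 0, ∀ p ∈ K, ∀ q ∈ K, ∀ h : Plane, (∀ k, 0 < h k) → (∀ k, h k ≤ κ) →
      Disjoint (cell h p) (cell h q) → Approximable M (cellSwap h p q) := by
  suffices H : ∃ κ > 0, ∀ r ∈ K ×ˢ K, ∀ h : Plane, (∀ k, 0 < h k) → (∀ k, h k ≤ κ) →
      Disjoint (cell h r.1) (cell h r.2) → Approximable M (cellSwap h r.1 r.2) by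
    obtain ⟨κ, hκ, H⟩ := H
    exact ⟨κ, hκ, fun p hp q hq => H (p, q) ⟨hp, hq⟩⟩
  refine (hK.prod hK).induction_on (p := fun S => ∃ κ > 0, ∀ r ∈ S, ∀ h : Plane, (∀ k, 0 < h k) →
    (∀ k, h k ≤ κ) → Disjoint (cell h r.1) (cell h r.2) →
      Approximable M (cellSwap h r.1 r.2)) ?_ ?_ ?_ ?_
  · exact ⟨1, one_pos, by simp⟩
  · rintro s t hst ⟨κ, hκ, H⟩
    exact ⟨κ, hκ, fun r hr => H r (hst hr)⟩
  · rintro s t ⟨κ, hκ, H⟩ ⟨κ', hκ', H'⟩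
    refine ⟨min κ κ', lt_min hκ hκ', fun r hr h hh hhκ => ?_⟩
    rcases hr with hr | hr
    · exact H r hr h hh fun k => (hhκ k).trans (min_le_left _ _)
    · exact H' r hr h hh fun k => (hhκ k).trans (min_le_right _ _)
  · rintro ⟨x, y⟩ ⟨hx, hy⟩
    obtain ⟨κ, hκ, H⟩ := locallySwappable_of_mem_interior hM (hKM hx) (hKM hy)
    have hκ' : ∀ k, 0 < (diag κ) k := fun k => by rwa [diag_apply]
    exact ⟨cell (diag κ) x ×ˢ cell (diag κ) y,
      mem_nhdsWithin_of_mem_nhds (prod_mem_nhds (cell_mem_nhds hκ' x) (cell_mem_nhds hκ' y)),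
      κ, hκ, fun r hr h hh hhκ hd => H r.1 hr.1 r.2 hr.2 h hh hhκ hd⟩

end LocalSwap

/-! ### Permutations of cells, and a grid that nearly fills the domain -/

section Grid

variable {Λ : AddSubgroup Plane}

/-- Transpositions generate the symmetric group. Only the cell in which a point lands is recorded,
which suffices for functions that are nearly constant on cells. -/
lemma exists_approximable_perm [DiscreteTopology Λ] {M : Set (Surface Λ)} {ι : Type*} [Finite ι]
    {h : Plane} {x : ι → Surface Λ}
    (hdisj : Pairwise fun i j => Disjoint (cell h (x i)) (cell h (x j)))
    (hswap : ∀ i j, i ≠ j → Approximable M (cellSwap h (x i) (x j))) (σ : Equiv.Perm ι) :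
    ∃ T, Approximable M T ∧ ∀ i, MapsTo T (cell h (x i)) (cell h (x (σ i))) := by
  classical
  induction σ using Equiv.Perm.swap_induction_on with
  | one => exact ⟨id, approximable_id M, fun i => mapsTo_id _⟩
  | swap_mul f i j hij IH =>
    obtain ⟨T, hT, hmaps⟩ := IH
    refine ⟨_, (hswap i j hij).comp hT, fun k z hz => ?_⟩
    have h1 := hmaps k hz
    simp only [Function.comp_apply, Equiv.Perm.mul_apply]
    by_cases hki : f k = i
    · rw [hki] at h1 ⊢
      rw [Equiv.swap_apply_left, cellSwap, if_pos h1]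
      exact sub_add_mem_cell h1
    · by_cases hkj : f k = j
      · rw [hkj] at h1 ⊢
        rw [Equiv.swap_apply_right, cellSwap, if_neg (disjoint_right.1 (hdisj hij) h1), if_pos h1]
        exact sub_add_mem_cell h1
      · rw [Equiv.swap_apply_of_ne_of_ne hki hkj, cellSwap,
          if_neg (disjoint_left.1 (hdisj hki) h1), if_neg (disjoint_left.1 (hdisj hkj) h1)]
        exact h1

lemma isOpen_cell (h : Plane) (x : Surface Λ) : IsOpen (cell h x) := by
  have hc : Continuous fun z : Surface Λ => z - x := continuous_id.sub continuous_const
  exact (isOpenMap_proj _ (isOpen_box h)).preimage hc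

lemma cell_proj_eq (h c : Plane) : cell h (proj Λ c) = proj Λ '' ((fun y => y - c) ⁻¹' box h) := by
  ext z
  rw [mem_cell]
  constructor
  · rintro ⟨v, hv, rfl⟩
    exact ⟨c + v, by simpa using hv, proj_add' c v⟩
  · rintro ⟨y, hy, rfl⟩
    exact ⟨y - c, hy, by rw [← proj_add', add_sub_cancel]⟩

lemma volume_box (h : Plane) (hh : ∀ i, 0 < h i) :
    volume (box h) = ENNReal.ofReal (4 * h 0 * h 1) := by
  have e : box h = (WithLp.ofLp : Plane → (Fin 2 → ℝ)) ⁻¹'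
      (univ.pi fun i => Ioo (-h i) (h i)) := by
    ext v; simp [box, abs_lt]
  rw [e, (PiLp.volume_preserving_ofLp (Fin 2)).measure_preimage
    (MeasurableSet.univ_pi fun i => measurableSet_Ioo).nullMeasurableSet, Real.volume_pi_Ioo,
    Fin.prod_univ_two, ← ENNReal.ofReal_mul (by linarith [hh 0])]
  congr 1
  ring

lemma surfaceArea_cell [DiscreteTopology Λ] {h : Plane} (hinj : InjOn (proj Λ) (box h))
    (x : Surface Λ) : surfaceArea Λ (cell h x) = volume (box h) := by
  obtain ⟨c, rfl⟩ := QuotientAddGroup.mk_surjective x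
  have hmp := measurePreserving_sub_right (volume : Measure Plane) c
  have hm := (isOpen_box h).measurableSet
  have e : cell h ((c : Plane) : Surface Λ) = proj Λ '' ((fun y => y - c) ⁻¹' box h) :=
    cell_proj_eq h c
  rw [e, surfaceArea_image_proj (hmp.measurable hm), hmp.measure_preimage hm.nullMeasurableSet]
  intro y hy z hz hyz
  have : proj Λ (y - c) = proj Λ (z - c) := by rw [proj_sub', proj_sub', hyz]
  exact sub_left_injective (hinj hy hz this)

variable (Λ) in
/-- The points whose only closest point in `Λ` is the origin. -/
def strictDirichletDomain : Set Plane := {x | ∀ v ∈ Λ, v ≠ 0 → ‖x‖ < ‖x - v‖}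

lemma measurableSet_strictDirichletDomain [DiscreteTopology Λ] :
    MeasurableSet (strictDirichletDomain Λ) := by
  have : strictDirichletDomain Λ = ⋂ v : Λ, ⋂ _ : (v : Plane) ≠ 0, {x : Plane | ‖x‖ < ‖x - v‖} := by
    ext x; simp [strictDirichletDomain]
  rw [this]
  exact MeasurableSet.iInter fun v => MeasurableSet.iInter fun _ =>
    (isOpen_lt (by fun_prop) (by fun_prop)).measurableSet

/-- Of two distinct congruent points, each would be strictly shorter than the other. -/
lemma injOn_strictDirichletDomain : InjOn (proj Λ) (strictDirichletDomain Λ) := by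
  intro x hx y hy hxy
  have hmem : -x + y ∈ Λ := QuotientAddGroup.eq.1 hxy
  by_contra hne
  have h1 := hx (-(-x + y)) (Λ.neg_mem hmem) (by
    rw [neg_ne_zero, Ne, neg_add_eq_zero]; exact hne)
  have h2 := hy (-x + y) hmem (by rw [Ne, neg_add_eq_zero]; exact hne)
  rw [sub_neg_eq_add, add_neg_cancel_left] at h1
  rw [add_comm, ← sub_eq_add_neg, sub_sub_cancel] at h2
  exact lt_asymm h1 h2

lemma volume_diff_strictDirichletDomain [DiscreteTopology Λ] :
    volume (dirichletDomain Λ \ strictDirichletDomain Λ) = 0 := by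
  refine measure_mono_null (t := ⋃ v : Λ, ⋃ _ : (v : Plane) ≠ 0, {x : Plane | ‖x - 0‖ = ‖x - v‖})
    ?_ ?_
  · rintro x ⟨hx, hx'⟩
    simp only [strictDirichletDomain, mem_ofPred_eq] at hx'
    push Not at hx'
    obtain ⟨v, hv, hv0, hxv⟩ := hx'
    simp only [mem_iUnion]
    exact ⟨⟨v, hv⟩, hv0, by simpa using le_antisymm (hx v hv) hxv⟩
  · exact measure_iUnion_null fun v => measure_iUnion_null fun hv => volume_bisector (Ne.symm hv)

/-- The differences of points of `K` form a compact set that misses the closed set `Λ \ {0}`, hence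
keeps some distance `δ` from it; displacements below `δ / 2` cannot bridge this. -/
lemma exists_injOn_thickening [DiscreteTopology Λ] {K : Set Plane} (hK : IsCompact K)
    (hinj : InjOn (proj Λ) K) : ∃ r > 0, InjOn (proj Λ) (Metric.thickening r K) := by
  have hclosed : IsClosed (Subtype.val '' {v : Λ | v ≠ 0}) :=
    (inferInstance : IsClosed (Λ : Set Plane)).isClosedEmbedding_subtypeVal.isClosedMap _
      (isClosed_discrete _)
  have hcomp : IsCompact ((fun p : Plane × Plane => -p.1 + p.2) '' K ×ˢ K) :=
    (hK.prod hK).image (by fun_prop)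
  have hdisj : Disjoint ((fun p : Plane × Plane => -p.1 + p.2) '' K ×ˢ K)
      (Subtype.val '' {v : Λ | v ≠ 0}) := by
    rw [disjoint_left]
    rintro _ ⟨⟨a, b⟩, ⟨ha, hb⟩, rfl⟩ ⟨v, hv, hvab⟩
    have hvab' : (v : Plane) = -a + b := hvab
    have hab : proj Λ a = proj Λ b := QuotientAddGroup.eq.2 (hvab' ▸ v.2)
    refine hv (Subtype.ext ?_)
    have hab' : a = b := hinj ha hb hab
    rw [hvab', hab', neg_add_cancel]
    rfl
  obtain ⟨δ, hδ, hthick⟩ := hdisj.exists_thickenings hcomp hclosed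
  refine ⟨δ / 2, by positivity, fun y hy y' hy' hyy' => ?_⟩
  obtain ⟨a, ha, hya⟩ := Metric.mem_thickening_iff.1 hy
  obtain ⟨b, hb, hyb⟩ := Metric.mem_thickening_iff.1 hy'
  have hmem : -y + y' ∈ Λ := QuotientAddGroup.eq.1 hyy'
  by_contra hne
  have m1 : -y + y' ∈ Metric.thickening δ ((fun p : Plane × Plane => -p.1 + p.2) '' K ×ˢ K) := by
    refine Metric.mem_thickening_iff.2 ⟨-a + b, ⟨(a, b), ⟨ha, hb⟩, rfl⟩, ?_⟩
    calc dist (-y + y') (-a + b) ≤ dist (-y) (-a) + dist y' b := dist_add_add_le _ _ _ _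
      _ = dist y a + dist y' b := by rw [dist_neg_neg]
      _ < δ := by linarith
  have m2 : -y + y' ∈ Metric.thickening δ (Subtype.val '' {v : Λ | v ≠ 0}) := by
    refine Metric.self_subset_thickening hδ _ ⟨⟨_, hmem⟩, ?_, rfl⟩
    intro h0
    exact hne (neg_add_eq_zero.1 (congrArg Subtype.val h0))
  exact disjoint_left.1 hthick m1 m2

/-- The centre of a square of the grid with mesh `2 * δ`. -/
def gridPoint (δ : ℝ) (k : Fin 2 → ℤ) : Plane := WithLp.toLp 2 fun i => 2 * δ * k i

@[simp] lemma gridPoint_apply (δ : ℝ) (k : Fin 2 → ℤ) (i : Fin 2) :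
    gridPoint δ k i = 2 * δ * k i := rfl

/-- The interior of `M` contains a finite family of disjoint equal square cells of full area up to
`ε`, whose sufficiently small subcells can be exchanged approximately. -/
theorem exists_grid [DiscreteTopology Λ] {M : Set (Surface Λ)} (hM : IsSmoothDomain M)
    {ε : ENNReal} (hε : ε ≠ 0) {κ₀ : ℝ} (hκ₀ : 0 < κ₀) :
    ∃ δ > 0, δ < κ₀ ∧ InjOn (proj Λ) (box (diag δ)) ∧
      ∃ (s : Finset (Fin 2 → ℤ)) (x : s → Surface Λ),
        (Pairwise fun i j => Disjoint (cell (diag δ) (x i)) (cell (diag δ) (x j))) ∧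
        (∀ i, cell (diag δ) (x i) ⊆ M) ∧
        surfaceArea Λ (M \ ⋃ i, cell (diag δ) (x i)) ≤ ε ∧
        ∀ i j, ∀ p ∈ cell (diag δ) (x i), ∀ q ∈ cell (diag δ) (x j), ∀ h : Plane,
          (∀ k, 0 < h k) → (∀ k, h k ≤ δ) → Disjoint (cell h p) (cell h q) →
          Approximable M (cellSwap h p q) := by
  set O : Set Plane := proj Λ ⁻¹' interior M with hO
  have hOo : IsOpen O := isOpen_interior.preimage continuous_proj
  set S : Set Plane := strictDirichletDomain Λ ∩ O with hS
  have hSm : MeasurableSet S := measurableSet_strictDirichletDomain.inter hOo.measurableSet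
  have hsub : strictDirichletDomain Λ ⊆ dirichletDomain Λ := by
    intro x hx v hv
    by_cases hv0 : v = 0
    · simp [hv0]
    · exact (hx v hv hv0).le
  have hSfin : volume S ≠ ⊤ := by
    refine ne_top_of_le_ne_top (surfaceArea_lt_top_of_isCompact hM.isCompact).ne ?_
    rw [surfaceArea_apply hM.isClosed.measurableSet]
    exact measure_mono fun x hx =>
      ⟨(interior_subset : interior M ⊆ M) hx.2, hsub hx.1⟩
  -- Near a compact subset of the strict Dirichlet domain the projection is injective, so disjoint
  -- squares of a planar grid close to `K` give disjoint cells.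
  obtain ⟨K, hKS, hK, hKε⟩ := hSm.exists_isCompact_sdiff_lt hSfin hε
  obtain ⟨r₁, hr₁, hinj⟩ := exists_injOn_thickening hK
    (injOn_strictDirichletDomain.mono fun x hx => (hKS hx).1)
  obtain ⟨r₂, hr₂, hKO⟩ := hK.exists_cthickening_subset_open hOo fun x hx => (hKS hx).2
  obtain ⟨κ, hκ, hswap⟩ := exists_uniform_swap hM (K := proj Λ '' Metric.cthickening r₂ K)
    (hK.cthickening.image continuous_proj) (image_subset_iff.2 hKO)
  obtain ⟨κ₁, hκ₁, hinj₁⟩ := exists_injOn_box (Λ := Λ)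
  -- Points of one grid square are less than `4 * δ` apart, so a square that meets `K` stays within
  -- both thickenings.
  obtain ⟨δ, hδ, d1, d2, d3, d4, d5⟩ : ∃ δ > 0, δ < κ₀ ∧ δ ≤ κ₁ ∧ δ ≤ κ ∧ 4 * δ ≤ r₁ ∧
      4 * δ ≤ r₂ := by
    have hm : 0 < min κ₀ (min κ₁ (min κ (min r₁ r₂))) := by positivity
    refine ⟨min κ₀ (min κ₁ (min κ (min r₁ r₂))) / 4, by positivity, ?_, ?_, ?_, ?_, ?_⟩
    · linarith [min_le_left κ₀ (min κ₁ (min κ (min r₁ r₂)))]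
    all_goals
      have h1 := min_le_right κ₀ (min κ₁ (min κ (min r₁ r₂)))
      have h2 := min_le_left κ₁ (min κ (min r₁ r₂))
      have h3 := min_le_right κ₁ (min κ (min r₁ r₂))
      have h4 := min_le_left κ (min r₁ r₂)
      have h5 := min_le_right κ (min r₁ r₂)
      have h6 := min_le_left r₁ r₂
      have h7 := min_le_right r₁ r₂
      linarith
  set Q : (Fin 2 → ℤ) → Set Plane := fun k => (fun y => y - gridPoint δ k) ⁻¹' box (diag δ) with hQ
  have hQi (k : Fin 2 → ℤ) (y : Plane) : y ∈ Q k ↔ ∀ i, |y i - 2 * δ * k i| < δ := by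
    simp [hQ, box]
  have hfin : {k | (Q k ∩ K).Nonempty}.Finite := by
    obtain ⟨R, hR⟩ := hK.isBounded.exists_norm_le
    obtain ⟨n, hn⟩ := exists_nat_gt ((R + δ) / (2 * δ))
    rw [div_lt_iff₀ (by positivity)] at hn
    refine (finite_Icc (fun _ => -(n : ℤ) : Fin 2 → ℤ) fun _ => (n : ℤ)).subset ?_
    rintro k ⟨y, hy, hyK⟩
    have hk (i : Fin 2) : |(k i : ℝ)| < n := by
      have h1 := (hQi k y).1 hy i
      have h2 : |y i| ≤ R := (PiLp.norm_apply_le y i).trans (hR y hyK)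
      have h3 : |2 * δ * (k i : ℝ)| < n * (2 * δ) := by
        have := abs_sub_abs_le_abs_sub (2 * δ * (k i : ℝ)) (y i)
        rw [abs_sub_comm] at this
        linarith
      rw [abs_mul, abs_of_pos (by positivity : 0 < 2 * δ), mul_comm] at h3
      exact lt_of_mul_lt_mul_right h3 (by positivity)
    refine ⟨fun i => ?_, fun i => ?_⟩
    · have := (abs_lt.1 (hk i)).1
      exact_mod_cast this.le
    · have := (abs_lt.1 (hk i)).2
      exact_mod_cast this.le
  have hnear (k : Fin 2 → ℤ) (hk : (Q k ∩ K).Nonempty) (y : Plane) (hy : y ∈ Q k) :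
      ∃ w ∈ K, dist y w < 4 * δ := by
    obtain ⟨w, hw, hwK⟩ := hk
    refine ⟨w, hwK, ?_⟩
    rw [dist_eq_norm]
    have : y - w ∈ box (diag (2 * δ)) := by
      intro i
      have h1 := abs_lt.1 ((hQi k y).1 hy i)
      have h2 := abs_lt.1 ((hQi k w).1 hw i)
      simp only [PiLp.sub_apply, diag_apply]
      rw [abs_lt]; constructor <;> linarith
    linarith [norm_lt_of_mem_box this]
  have hcell (k : Fin 2 → ℤ) : cell (diag δ) (proj Λ (gridPoint δ k)) = proj Λ '' Q k :=
    cell_proj_eq _ _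
  have hQr₁ (k : Fin 2 → ℤ) (hk : (Q k ∩ K).Nonempty) : Q k ⊆ Metric.thickening r₁ K := by
    intro y hy
    obtain ⟨w, hw, hyw⟩ := hnear k hk y hy
    exact Metric.mem_thickening_iff.2 ⟨w, hw, hyw.trans_le d4⟩
  have hQr₂ (k : Fin 2 → ℤ) (hk : (Q k ∩ K).Nonempty) : Q k ⊆ Metric.cthickening r₂ K := by
    intro y hy
    obtain ⟨w, hw, hyw⟩ := hnear k hk y hy
    exact Metric.thickening_subset_cthickening _ _
      (Metric.mem_thickening_iff.2 ⟨w, hw, hyw.trans_le d5⟩)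
  have hs (k : hfin.toFinset) : (Q k ∩ K).Nonempty := hfin.mem_toFinset.1 k.2
  refine ⟨δ, hδ, d1, hinj₁.mono (box_mono fun k => by simpa using d2), hfin.toFinset,
    fun k => proj Λ (gridPoint δ k), ?_, ?_, ?_, ?_⟩
  · intro i j hij
    rw [hcell, hcell, disjoint_left]
    rintro _ ⟨y, hy, rfl⟩ ⟨y', hy', hyy'⟩
    have heq := hinj (hQr₁ j (hs j) hy') (hQr₁ i (hs i) hy) hyy'
    subst heq
    refine hij (Subtype.ext (funext fun a => ?_))
    have h1 := abs_lt.1 ((hQi _ _).1 hy a)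
    have h2 := abs_lt.1 ((hQi _ _).1 hy' a)
    have h3 : (i.1 a : ℝ) < j.1 a + 1 := by nlinarith
    have h4 : (j.1 a : ℝ) < i.1 a + 1 := by nlinarith
    have h3' : i.1 a < j.1 a + 1 := by exact_mod_cast h3
    have h4' : j.1 a < i.1 a + 1 := by exact_mod_cast h4
    omega
  · intro i
    rw [hcell]
    exact (image_mono (hQr₂ i (hs i))).trans
      ((image_subset_iff.2 hKO).trans interior_subset)
  · set U : Set (Surface Λ) := ⋃ i : hfin.toFinset, cell (diag δ) (proj Λ (gridPoint δ i)) with hU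
    have hUm : MeasurableSet U := (isOpen_iUnion fun i => isOpen_cell _ _).measurableSet
    -- The open squares omit only the grid lines; off these, rounding finds the square of a point.
    set lines : Set Plane := ⋃ i : Fin 2, ⋃ m : ℤ, {v | |v i - 2 * δ * m| = δ} with hlines
    have hlines0 : volume lines = 0 := measure_iUnion_null fun i => measure_iUnion_null fun m =>
      volume_abs_coord_sub_eq i _ _
    have hcov : proj Λ ⁻¹' (interior M \ U) ∩ dirichletDomain Λ ⊆
        (dirichletDomain Λ \ strictDirichletDomain Λ) ∪ (S \ K) ∪ lines := by
      rintro y ⟨⟨hyM, hyU⟩, hyD⟩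
      by_cases hy1 : y ∈ strictDirichletDomain Λ
      · by_cases hy2 : y ∈ K
        · right
          by_contra hyl
          refine hyU (mem_iUnion.2 ?_)
          have hyQ : y ∈ Q fun i => round (y i / (2 * δ)) := by
            rw [hQi]
            intro i
            refine lt_of_le_of_ne ?_ fun hne => hyl (mem_iUnion.2 ⟨i, mem_iUnion.2 ⟨_, hne⟩⟩)
            have h1 := abs_sub_round (y i / (2 * δ))
            have h2 : y i - 2 * δ * round (y i / (2 * δ)) =
                2 * δ * (y i / (2 * δ) - round (y i / (2 * δ))) := by
              field_simp
            rw [h2, abs_mul, abs_of_pos (by positivity : 0 < 2 * δ)]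
            nlinarith
          refine ⟨⟨_, hfin.mem_toFinset.2 ⟨y, hyQ, hy2⟩⟩, ?_⟩
          rw [hcell]
          exact ⟨y, hyQ, rfl⟩
        · exact Or.inl (Or.inr ⟨⟨hy1, hyM⟩, hy2⟩)
      · exact Or.inl (Or.inl ⟨hyD, hy1⟩)
    have hint : surfaceArea Λ (interior M \ U) ≤ ε := by
      rw [surfaceArea_apply (isOpen_interior.measurableSet.diff hUm)]
      calc _ ≤ _ := measure_mono hcov
        _ ≤ volume ((dirichletDomain Λ \ strictDirichletDomain Λ) ∪ (S \ K)) + volume lines :=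
          measure_union_le _ _
        _ ≤ volume (dirichletDomain Λ \ strictDirichletDomain Λ) + volume (S \ K) + volume lines :=
          by gcongr; exact measure_union_le _ _
        _ ≤ ε := by
          rw [volume_diff_strictDirichletDomain, hlines0, zero_add, add_zero]
          exact hKε.le
    have hMU : M \ U ⊆ (interior M \ U) ∪ frontier M := by
      rintro z ⟨hz, hzU⟩
      by_cases hzi : z ∈ interior M
      · exact Or.inl ⟨hzi, hzU⟩
      · exact Or.inr ⟨subset_closure hz, hzi⟩
    calc _ ≤ _ := measure_mono hMU
      _ ≤ surfaceArea Λ (interior M \ U) + surfaceArea Λ (frontier M) := measure_union_le _ _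
      _ ≤ ε := by rw [hM.surfaceArea_frontier, add_zero]; exact hint
  · intro i j p hp q hq h hh hhδ hpq
    rw [hcell] at hp hq
    exact hswap p (image_mono (hQr₂ i (hs i)) hp) q (image_mono (hQr₂ j (hs j)) hq) h hh
      (fun k => (hhδ k).trans d3) hpq

end Grid

end VortexPatch

namespace VortexPatch

open scoped Pointwise

/-! ### An approximate Hardy–Littlewood–Pólya theorem -/

section Majorization

variable {ι : Type*} [Fintype ι]

/-- Any two families of reals can be brought into the same order. -/
lemma exists_perm_monovary (g c : ι → ℝ) : ∃ σ : Equiv.Perm ι, Monovary g (c ∘ σ) := by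
  let e := Fintype.equivFin ι
  let τg := Tuple.sort (g ∘ e.symm)
  let τc := Tuple.sort (c ∘ e.symm)
  have hg : Monotone ((g ∘ e.symm) ∘ τg) := Tuple.monotone_sort _
  have hc : Monotone ((c ∘ e.symm) ∘ τc) := Tuple.monotone_sort _
  refine ⟨e.trans (τg.symm.trans (τc.trans e.symm)), fun i j hij => ?_⟩
  have h1 : τg.symm (e i) < τg.symm (e j) := by
    by_contra! hcon
    exact absurd hij (not_lt.2 (hc hcon))
  have h2 := hg h1.le
  simpa using h2

/-- The layer cake formula for a finite weighted sum. -/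
lemma sum_add_mul_le {g v : ι → ℝ} {m E : ℝ} (hm : 0 ≤ m) (hg : ∀ i, |g i| ≤ m)
    (h : ∀ t, ∑ i with t ≤ g i, v i ≤ E) : ∑ i, (g i + m) * v i ≤ 2 * m * E := by
  have hint (i : ι) : IntervalIntegrable ({t | t ≤ g i}.indicator fun _ => v i) volume (-m) m := by
    rw [intervalIntegrable_iff]
    exact (integrableOn_const (by simp)).indicator measurableSet_Iic
  -- The factor `g i + m` is the length of the set of `t ∈ [-m, m]` with `t ≤ g i`.
  have h1 : ∫ t in (-m)..m, ∑ i, {t | t ≤ g i}.indicator (fun _ => v i) t =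
      ∑ i, (g i + m) * v i := by
    rw [intervalIntegral.integral_finsetSum fun i _ => hint i]
    refine Finset.sum_congr rfl fun i _ => ?_
    rw [intervalIntegral.integral_indicator (abs_le.1 (hg i)), intervalIntegral.integral_const,
      smul_eq_mul, sub_neg_eq_add]
  have h2 : ∫ t in (-m)..m, ∑ i, {t | t ≤ g i}.indicator (fun _ => v i) t ≤
      ∫ _ in (-m)..m, E := by
    refine intervalIntegral.integral_mono_on (by linarith) ?_ (by simp) fun t _ => ?_
    · simpa only [Finset.sum_fn] using IntervalIntegrable.sum Finset.univ fun i _ => hint i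
    · refine le_trans (le_of_eq ?_) (h t)
      rw [Finset.sum_filter]
      rfl
  rw [h1, intervalIntegral.integral_const, smul_eq_mul] at h2
  linarith

/-- Let `k` minimize `c ∘ σ` on the superlevel set. As `c ∘ σ` is ordered like `g`, no index outside
exceeds `c (σ k)`. Hence the sum of positive parts at this threshold lives on the superlevel set,
and `h1` there is the claim. -/
lemma sum_superlevel_le {b c g : ι → ℝ} {E : ℝ} (hE : 0 ≤ E)
    (h1 : ∀ (I : Finset ι) (k : ι), ∑ i ∈ I, b i ≤ c k * I.card + ∑ i, max (c i - c k) 0 + E)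
    {σ : Equiv.Perm ι} (hσ : Monovary g (c ∘ σ)) (t : ℝ) :
    ∑ i with t ≤ g i, (b i - c (σ i)) ≤ E := by
  set I : Finset ι := Finset.univ.filter fun i => t ≤ g i with hI
  rcases I.eq_empty_or_nonempty with hemp | hne
  · rw [hemp, Finset.sum_empty]; exact hE
  obtain ⟨k, hkI, hk⟩ := I.exists_min_image (fun i => c (σ i)) hne
  have h := h1 I (σ k)
  have h2 : ∑ i, max (c i - c (σ k)) 0 = ∑ i ∈ I, (c (σ i) - c (σ k)) := by
    rw [← Equiv.sum_comp σ, ← Finset.sum_subset (Finset.subset_univ I)]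
    · exact Finset.sum_congr rfl fun i hi => max_eq_left (sub_nonneg.2 (hk i hi))
    · intro i _ hi
      refine max_eq_right (sub_nonpos.2 ?_)
      by_contra! hcon
      have h3 : g k ≤ g i := hσ hcon
      have h4 : t ≤ g k := (Finset.mem_filter.1 hkI).2
      exact hi (Finset.mem_filter.2 ⟨Finset.mem_univ i, h4.trans h3⟩)
  rw [h2, Finset.sum_sub_distrib, Finset.sum_const, nsmul_eq_mul] at h
  rw [Finset.sum_sub_distrib]
  linarith

/-- A family which is majorized by `c` up to an error is close to a convex combination of rearrangements of `c`. -/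
lemma exists_mem_convexHull_perm [DecidableEq ι] {b c : ι → ℝ} {E : ℝ} (hE : 0 ≤ E)
    (h1 : ∀ (I : Finset ι) (k : ι), ∑ i ∈ I, b i ≤ c k * I.card + ∑ i, max (c i - c k) 0 + E)
    (h2 : |∑ i, b i - ∑ i, c i| ≤ E) :
    ∃ w ∈ convexHull ℝ (range fun σ : Equiv.Perm ι => c ∘ σ), ∑ i, |b i - w i| ≤ 3 * E := by
  by_contra! hcon
  rcases isEmpty_or_nonempty ι with hemp | hne
  · have := hcon (c ∘ (1 : Equiv.Perm ι)) (subset_convexHull _ _ ⟨1, rfl⟩)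
    simp only [Finset.univ_eq_empty, Finset.sum_empty] at this
    linarith
  set B : Set (ι → ℝ) := {u | ∑ i, |u i| ≤ 3 * E} with hB
  have hBclosed : IsClosed B := isClosed_le (by fun_prop) continuous_const
  have hBconv : Convex ℝ B := by
    intro u hu v hv a b' ha hb' hab
    have hu' : ∑ i, |u i| ≤ 3 * E := hu
    have hv' : ∑ i, |v i| ≤ 3 * E := hv
    show ∑ i, |(a • u + b' • v) i| ≤ 3 * E
    calc ∑ i, |(a • u + b' • v) i| ≤ ∑ i, (a * |u i| + b' * |v i|) := by
          refine Finset.sum_le_sum fun i _ => ?_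
          simp only [Pi.add_apply, Pi.smul_apply, smul_eq_mul]
          refine (abs_add_le _ _).trans ?_
          rw [abs_mul, abs_mul, abs_of_nonneg ha, abs_of_nonneg hb']
      _ = a * ∑ i, |u i| + b' * ∑ i, |v i| := by
          rw [Finset.sum_add_distrib, Finset.mul_sum, Finset.mul_sum]
      _ ≤ a * (3 * E) + b' * (3 * E) := by gcongr
      _ = 3 * E := by rw [← add_mul, hab, one_mul]
  set C := convexHull ℝ (range fun σ : Equiv.Perm ι => c ∘ σ) with hC
  have hCcomp : IsCompact C := (finite_range _).isCompact_convexHull ℝ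
  have hnot : b ∉ C + B := by
    rintro ⟨w, hw, u, hu, hwu⟩
    have hu' : ∑ i, |u i| ≤ 3 * E := hu
    refine absurd hu' (not_le.2 ?_)
    have := hcon w hw
    have e : ∀ i, b i - w i = u i := fun i => by
      rw [← hwu]; simp
    simpa only [e] using this
  -- `C + B` is closed as the sum of a compact and a closed set, so `b` can be strictly separated
  -- from it.
  obtain ⟨f, r, hf1, hf2⟩ := geometric_hahn_banach_closed_point
    ((convex_convexHull ℝ _).add hBconv) (hBclosed.add_left_of_isCompact hCcomp) hnot
  set g : ι → ℝ := fun i => f (Pi.single i 1) with hg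
  have hfg (v : ι → ℝ) : f v = ∑ i, g i * v i := by
    have := LinearMap.pi_apply_eq_sum_univ (f : (ι → ℝ) →ₗ[ℝ] ℝ) v
    refine this.trans (Finset.sum_congr rfl fun i _ => ?_)
    rw [smul_eq_mul, mul_comm]
    simp only [hg]
    congr 1
    refine congrArg f (funext fun j => ?_)
    simp [Pi.single_apply, eq_comm]
  obtain ⟨i₀, hi₀⟩ := Finite.exists_max fun i => |g i|
  obtain ⟨σ, hσ⟩ := exists_perm_monovary g c
  set m := |g i₀| with hm
  have hlayer := sum_add_mul_le (v := fun i => b i - c (σ i)) (abs_nonneg (g i₀)) hi₀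
    (sum_superlevel_le hE h1 hσ)
  have hsum : ∑ i, (b i - c (σ i)) = ∑ i, b i - ∑ i, c i := by
    rw [Finset.sum_sub_distrib, Equiv.sum_comp σ c]
  have hexp : ∑ i, (g i + m) * (b i - c (σ i)) =
      f b - f (c ∘ σ) + m * (∑ i, b i - ∑ i, c i) := by
    rw [hfg, hfg, ← hsum, Finset.mul_sum, ← Finset.sum_sub_distrib, ← Finset.sum_add_distrib]
    refine Finset.sum_congr rfl fun i _ => ?_
    simp only [Function.comp_apply]
    ring
  have hm0 : 0 ≤ m := abs_nonneg _
  -- The layer cake bound contributes `2mE`, and undoing the shift of `g` by `m` costs another `mE`.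
  have hbound : f b - f (c ∘ σ) ≤ 3 * E * m := by
    rw [hexp] at hlayer
    have := mul_le_mul_of_nonneg_left (abs_le.1 h2).1 hm0
    nlinarith
  -- On the `ℓ¹` ball of radius `3E` the functional reaches `3Em`, at a vector concentrated where
  -- `|g|` is largest. Separation then contradicts `hbound`.
  have hmem : c ∘ σ + Pi.single i₀ (SignType.sign (g i₀) * (3 * E)) ∈ C + B := by
    refine add_mem_add (subset_convexHull _ _ ⟨σ, rfl⟩) ?_
    show ∑ i, |(Pi.single i₀ (SignType.sign (g i₀) * (3 * E)) : ι → ℝ) i| ≤ 3 * E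
    rw [Finset.sum_eq_single i₀]
    · rw [Pi.single_eq_same, abs_mul, abs_of_nonneg (by positivity : 0 ≤ 3 * E)]
      have : |((SignType.sign (g i₀) : SignType) : ℝ)| ≤ 1 := by
        rcases SignType.sign (g i₀) with _ | _ | _ <;> simp
      nlinarith
    · intro i _ hi
      rw [Pi.single_eq_of_ne hi, abs_zero]
    · simp
  have h3 := hf1 _ hmem
  have h4 : f (Pi.single i₀ (SignType.sign (g i₀) * (3 * E))) = m * (3 * E) := by
    rw [hfg, Finset.sum_eq_single i₀]
    · rw [Pi.single_eq_same, ← mul_assoc, mul_comm (g i₀), sign_mul_self]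
    · intro i _ hi
      rw [Pi.single_eq_of_ne hi, mul_zero]
    · simp
  rw [map_add, h4] at h3
  linarith

/-- A convex combination of finitely many vectors is approximated by their averages with
multiplicities. -/
lemma exists_average_near_of_mem_convexHull {κ F : Type*} [NormedAddCommGroup F] [NormedSpace ℝ F]
    {p : κ → F} {x : F} (hx : x ∈ convexHull ℝ (range p)) {η : ℝ} (hη : 0 < η) :
    ∃ J : ℕ, 0 < J ∧ ∃ σ : Fin J → κ, ‖x - (J : ℝ)⁻¹ • ∑ j, p (σ j)‖ < η := by
  obtain ⟨α, _, l, z, hl0, hl1, hz, hlx⟩ := mem_convexHull_iff_exists_fintype.1 hx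
  choose s hs using hz
  -- The weights become multiplicities `⌊l i * n⌋₊`. Their total `K n` need not be `n`, but `K n / n
  -- → 1`.
  set K : ℕ → ℕ := fun n => ∑ i, ⌊l i * n⌋₊ with hK
  have hfloor (i : α) : Tendsto (fun n : ℕ => (⌊l i * n⌋₊ : ℝ) / n) atTop (𝓝 (l i)) :=
    (tendsto_nat_floor_mul_div_atTop (hl0 i)).comp tendsto_natCast_atTop_atTop
  have hKlim : Tendsto (fun n : ℕ => (K n : ℝ) / n) atTop (𝓝 1) := by
    rw [← hl1]
    refine (tendsto_finsetSum Finset.univ fun i _ => hfloor i).congr fun n => ?_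
    rw [hK, Nat.cast_sum, Finset.sum_div]
  have hSlim : Tendsto (fun n : ℕ => ((K n : ℝ) / n)⁻¹ • ∑ i, ((⌊l i * n⌋₊ : ℝ) / n) • z i) atTop
      (𝓝 x) := by
    have := (hKlim.inv₀ one_ne_zero).smul
      (tendsto_finsetSum Finset.univ fun i _ => (hfloor i).smul_const (z i))
    rwa [hlx, inv_one, one_smul] at this
  obtain ⟨n, hn1, hn2, hn3⟩ := ((hSlim.eventually (Metric.ball_mem_nhds x hη)).and
    ((hKlim.eventually (lt_mem_nhds one_half_lt_one)).and (eventually_gt_atTop 0))).exists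
  have hn : (n : ℝ) ≠ 0 := by positivity
  have hKpos : 0 < K n := by
    by_contra! hcon
    rw [Nat.le_zero.1 hcon] at hn2
    norm_num at hn2
  let e : (Σ i, Fin ⌊l i * n⌋₊) ≃ Fin (K n) := Fintype.equivFinOfCardEq (by simp [hK])
  refine ⟨K n, hKpos, fun j => s (e.symm j).1, ?_⟩
  have hsum : ∑ j, p (s (e.symm j).1) = ∑ i, (⌊l i * n⌋₊ : ℝ) • z i := by
    rw [Equiv.sum_comp e.symm fun q => p (s q.1), Fintype.sum_sigma]
    refine Finset.sum_congr rfl fun i _ => ?_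
    simp only [hs]
    rw [Finset.sum_const, Finset.card_univ, Fintype.card_fin, Nat.cast_smul_eq_nsmul]
  rw [hsum, ← dist_eq_norm, dist_comm]
  convert hn1 using 2
  rw [Finset.smul_sum, Finset.smul_sum]
  refine Finset.sum_congr rfl fun i _ => ?_
  rw [smul_smul, smul_smul]
  congr 1
  field_simp

/-- An approximate form of the Hardy–Littlewood–Pólya theorem: a family which is majorized by `c` up
to an error is close to an average of rearrangements of `c`. -/
lemma exists_average_perm {b c : ι → ℝ} {E η : ℝ} (hE : 0 ≤ E) (hη : 0 < η)
    (h1 : ∀ (I : Finset ι) (k : ι), ∑ i ∈ I, b i ≤ c k * I.card + ∑ i, max (c i - c k) 0 + E)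
    (h2 : |∑ i, b i - ∑ i, c i| ≤ E) :
    ∃ J : ℕ, 0 < J ∧ ∃ σ : Fin J → Equiv.Perm ι,
      ∑ i, |b i - (J : ℝ)⁻¹ * ∑ j, c (σ j i)| ≤ 3 * E + η := by
  classical
  obtain ⟨w, hw, hbw⟩ := exists_mem_convexHull_perm hE h1 h2
  obtain ⟨J, hJ, σ, hσ⟩ := exists_average_near_of_mem_convexHull hw
    (show 0 < η / (Fintype.card ι + 1) by positivity)
  refine ⟨J, hJ, σ, ?_⟩
  have h3 (i : ι) : |w i - (J : ℝ)⁻¹ * ∑ j, c (σ j i)| ≤ η / (Fintype.card ι + 1) := by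
    refine le_trans (le_of_eq ?_) ((norm_le_pi_norm _ i).trans hσ.le)
    simp [Finset.sum_apply]
  calc ∑ i, |b i - (J : ℝ)⁻¹ * ∑ j, c (σ j i)|
      ≤ ∑ i, (|b i - w i| + |w i - (J : ℝ)⁻¹ * ∑ j, c (σ j i)|) :=
        Finset.sum_le_sum fun i _ => abs_sub_le _ _ _
    _ = ∑ i, |b i - w i| + ∑ i, |w i - (J : ℝ)⁻¹ * ∑ j, c (σ j i)| := Finset.sum_add_distrib
    _ ≤ 3 * E + ∑ _i : ι, η / (Fintype.card ι + 1) := add_le_add hbw (Finset.sum_le_sum fun i _ => h3 i)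
    _ ≤ 3 * E + η := by
      rw [Finset.sum_const, Finset.card_univ, nsmul_eq_mul]
      gcongr
      rw [mul_div_assoc', div_le_iff₀ (by positivity)]
      nlinarith

end Majorization

/-! ### Reduction of all levels to the values of the patch -/

section ConvexOrder

variable {α : Type*} [MeasurableSpace α] {μ : Measure α} [IsFiniteMeasure μ]

lemma integrable_max_sub {f : α → ℝ} (hf : Integrable f μ) (s : ℝ) :
    Integrable (fun x => max (f x - s) 0) μ :=
  (hf.sub (integrable_const s)).pos_part

/-- Among the inequalities `∫ (ω - s)₊ ≤ ∫ (f - s)₊`, those where `s` is a value of `f` suffice, if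
`f` takes finitely many values. -/
lemma integral_max_sub_le_of_forall_value {ι : Type*} [Finite ι] {a : ι → ℝ} {ω f : α → ℝ}
    (hω : Integrable ω μ) (hf : Integrable f μ) (hfa : ∀ᵐ x ∂μ, ∃ i, f x = a i)
    (h : ∀ i, ∫ x, max (ω x - a i) 0 ∂μ ≤ ∫ x, max (f x - a i) 0 ∂μ) (s : ℝ) :
    ∫ x, max (ω x - s) 0 ∂μ ≤ ∫ x, max (f x - s) 0 ∂μ := by
  rcases isEmpty_or_nonempty ι with hemp | hne
  · have : μ = 0 := by
      rw [← ae_eq_bot, ← Filter.eventually_false_iff_eq_bot]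
      filter_upwards [hfa] with x hx
      exact hemp.elim hx.choose
    simp [this]
  -- Below the least value `a k`, the function `(f - s)₊` equals `(f - a k)₊ + (a k - s)`; for `ω`
  -- this is an upper bound.
  by_cases hlow : ∃ i, a i ≤ s
  swap
  · push Not at hlow
    obtain ⟨k, hk⟩ := Finite.exists_min a
    calc ∫ x, max (ω x - s) 0 ∂μ ≤ ∫ x, (max (ω x - a k) 0 + (a k - s)) ∂μ := by
          refine integral_mono (integrable_max_sub hω s)
            ((integrable_max_sub hω _).add (integrable_const _)) fun x => ?_
          have := hlow k
          exact max_le (by linarith [le_max_left (ω x - a k) 0])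
            (by linarith [le_max_right (ω x - a k) 0])
      _ ≤ ∫ x, (max (f x - a k) 0 + (a k - s)) ∂μ := by
          rw [integral_add (integrable_max_sub hω _) (integrable_const _),
            integral_add (integrable_max_sub hf _) (integrable_const _)]
          linarith [h k]
      _ ≤ ∫ x, max (f x - s) 0 ∂μ := by
          refine integral_mono_ae ((integrable_max_sub hf _).add (integrable_const _))
            (integrable_max_sub hf s) ?_
          filter_upwards [hfa] with x ⟨i, hi⟩
          have := hk i
          refine le_trans (le_of_eq ?_) (le_max_left _ _)
          rw [max_eq_left (by linarith)]
          ring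
  -- Above the greatest value `a k` the level is lowered to `a k`, where the positive part of `f - a
  -- k` already vanishes.
  by_cases hhigh : ∃ i, s ≤ a i
  swap
  · push Not at hhigh
    obtain ⟨k, hk⟩ := Finite.exists_max a
    calc ∫ x, max (ω x - s) 0 ∂μ ≤ ∫ x, max (ω x - a k) 0 ∂μ := by
          refine integral_mono (integrable_max_sub hω s) (integrable_max_sub hω _)
            fun x => ?_
          have := hhigh k
          exact max_le_max (by linarith) le_rfl
      _ ≤ ∫ x, max (f x - a k) 0 ∂μ := h k
      _ ≤ ∫ x, max (f x - s) 0 ∂μ := by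
          refine integral_mono_ae (integrable_max_sub hf _) (integrable_max_sub hf s) ?_
          filter_upwards [hfa] with x ⟨i, hi⟩
          have := hk i
          rw [max_eq_right (by linarith)]
          exact le_max_right _ _
  have : Nonempty {i // a i ≤ s} := hlow.elim fun i hi => ⟨⟨i, hi⟩⟩
  have : Nonempty {i // s ≤ a i} := hhigh.elim fun i hi => ⟨⟨i, hi⟩⟩
  -- For neighbouring values `a p ≤ s ≤ a q`, convexity in the level bounds the side of `ω`. The
  -- same bound is attained for `f`, which has no value strictly between them.
  obtain ⟨⟨p, hps⟩, hp⟩ := Finite.exists_max fun i : {i // a i ≤ s} => a i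
  obtain ⟨⟨q, hqs⟩, hq⟩ := Finite.exists_min fun i : {i // s ≤ a i} => a i
  obtain ⟨t, u, ht, hu, htu, rfl⟩ : s ∈ segment ℝ (a p) (a q) := by
    rw [segment_eq_Icc (hps.trans hqs)]
    exact ⟨hps, hqs⟩
  simp only [smul_eq_mul] at *
  calc ∫ x, max (ω x - (t * a p + u * a q)) 0 ∂μ
      ≤ ∫ x, (t * max (ω x - a p) 0 + u * max (ω x - a q) 0) ∂μ := by
        refine integral_mono (integrable_max_sub hω _)
          (((integrable_max_sub hω _).const_mul _).add
            ((integrable_max_sub hω _).const_mul _)) fun x => ?_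
        refine max_le ?_ (by positivity)
        calc ω x - (t * a p + u * a q) = t * (ω x - a p) + u * (ω x - a q) := by
              linear_combination (-ω x) * htu
          _ ≤ _ := by gcongr <;> exact le_max_left _ _
    _ ≤ ∫ x, (t * max (f x - a p) 0 + u * max (f x - a q) 0) ∂μ := by
        rw [integral_add ((integrable_max_sub hω _).const_mul _)
            ((integrable_max_sub hω _).const_mul _),
          integral_add ((integrable_max_sub hf _).const_mul _)
            ((integrable_max_sub hf _).const_mul _)]
        simp only [integral_const_mul]
        exact add_le_add (mul_le_mul_of_nonneg_left (h p) ht) (mul_le_mul_of_nonneg_left (h q) hu)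
    _ ≤ ∫ x, max (f x - (t * a p + u * a q)) 0 ∂μ := by
        refine integral_mono_ae (((integrable_max_sub hf _).const_mul _).add
            ((integrable_max_sub hf _).const_mul _)) (integrable_max_sub hf _) ?_
        filter_upwards [hfa] with x ⟨i, hi⟩
        rw [hi]
        rcases le_total (a i) (t * a p + u * a q) with hle | hle
        · have h1 : a i ≤ a p := hp ⟨i, hle⟩
          rw [max_eq_right (sub_nonpos.2 h1), max_eq_right (by linarith : a i - a q ≤ 0)]
          simp
        · have h1 : a q ≤ a i := hq ⟨i, hle⟩
          rw [max_eq_left (sub_nonneg.2 h1), max_eq_left (by linarith : 0 ≤ a i - a p)]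
          refine le_trans (le_of_eq ?_) (le_max_left _ _)
          linear_combination (a i) * htu

end ConvexOrder

/-! ### Weak-* closures and lower semicontinuity -/

section WeakStar

variable {α : Type*} [MeasurableSpace α] {μ : Measure α}

lemma integral_mul_le_of_mem_weakStarClosure {S : Set (Lp ℝ ⊤ μ)} (g : Lp ℝ 1 μ) {C : ℝ}
    (h : ∀ η ∈ S, ∫ x, g x * η x ∂μ ≤ C) {ω : Lp ℝ ⊤ μ} (hω : ω ∈ weakStarClosure S) :
    ∫ x, g x * ω x ∂μ ≤ C := by
  have hc : @Continuous _ _ (weakStarTopology μ) _ fun ω : Lp ℝ ⊤ μ => ∫ x, g x * ω x ∂μ := by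
    have h1 : @Continuous _ _ (weakStarTopology μ) _
        fun (ω : Lp ℝ ⊤ μ) (g : Lp ℝ 1 μ) => ∫ x, g x * ω x ∂μ := continuous_induced_dom
    exact @Continuous.comp _ _ _ (weakStarTopology μ) _ _ _ (fun p : Lp ℝ 1 μ → ℝ => p g)
      (continuous_apply g) h1
  have hS : S ⊆ (fun ω : Lp ℝ ⊤ μ => ∫ x, g x * ω x ∂μ) ⁻¹' Iic C := h
  have hcl : weakStarClosure S ⊆ (fun ω : Lp ℝ ⊤ μ => ∫ x, g x * ω x ∂μ) ⁻¹' Iic C :=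
    @closure_minimal _ (weakStarTopology μ) _ _ hS
      (@IsClosed.preimage _ _ (weakStarTopology μ) _ _ hc _ isClosed_Iic)
  exact hcl hω

lemma mem_weakStarClosure {S : Set (Lp ℝ ⊤ μ)} {ω : Lp ℝ ⊤ μ}
    (h : ∀ I : Set (Lp ℝ 1 μ), I.Finite → ∀ ε > 0, ∃ η ∈ S, ∀ g ∈ I,
      |∫ x, g x * η x ∂μ - ∫ x, g x * ω x ∂μ| < ε) : ω ∈ weakStarClosure S := by
  refine (@mem_closure_iff_nhds _ (weakStarTopology μ) _ _).2 fun U hU => ?_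
  rw [nhds_induced, mem_comap] at hU
  obtain ⟨V, hV, hVU⟩ := hU
  rw [nhds_pi, Filter.mem_pi] at hV
  obtain ⟨I, hI, t, ht, htV⟩ := hV
  have hε : ∃ ε > 0, ∀ g ∈ I, Metric.ball (∫ x, g x * ω x ∂μ) ε ⊆ t g := by
    choose ε hε0 hε using fun g => Metric.mem_nhds_iff.1 (ht g)
    rcases I.eq_empty_or_nonempty with rfl | hne
    · exact ⟨1, one_pos, by simp⟩
    obtain ⟨k, -, hk⟩ := hI.exists_minimalFor ε I hne
    refine ⟨ε k, hε0 k, fun g hg => (Metric.ball_subset_ball ?_).trans (hε g)⟩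
    rcases le_total (ε k) (ε g) with h1 | h1
    · exact h1
    · exact hk hg h1
  obtain ⟨ε, hε0, hε⟩ := hε
  obtain ⟨η, hηS, hη⟩ := h I hI ε hε0
  refine ⟨η, hVU (htV fun g hg => hε g hg ?_), hηS⟩
  rw [Metric.mem_ball, Real.dist_eq]
  exact hη g hg

variable [IsFiniteMeasure μ]

lemma integrable_of_Lp_top (ω : Lp ℝ ⊤ μ) : Integrable ω μ := (Lp.memLp ω).integrable le_top

/-- Convex integral functionals are lower semicontinuous in the weak-* topology. -/
lemma integral_max_sub_le_of_mem_weakStarClosure {S : Set (Lp ℝ ⊤ μ)} {σ s C : ℝ}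
    (h : ∀ η ∈ S, ∫ x, max (σ * η x - s) 0 ∂μ ≤ C) {ω : Lp ℝ ⊤ μ} (hω : ω ∈ weakStarClosure S) :
    ∫ x, max (σ * ω x - s) 0 ∂μ ≤ C := by
  -- Integration of `σ η - s` over this fixed set is affine and continuous in `η`. It equals the
  -- integral of the positive part at `η = ω` and is at most that integral for other `η`. The sign
  -- `σ` gives bounds from both sides.
  set E : Set α := {x | s < σ * ω x} with hE
  have hEm : MeasurableSet E :=
    measurableSet_lt measurable_const ((Lp.stronglyMeasurable ω).measurable.const_mul σ)
  set g : Lp ℝ 1 μ := indicatorConstLp 1 hEm (measure_ne_top μ E) σ with hg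
  have hgη (η : Lp ℝ ⊤ μ) : ∫ x in E, (σ * η x - s) ∂μ = ∫ x, g x * η x ∂μ - s * μ.real E := by
    rw [integral_sub ((integrable_of_Lp_top η).const_mul σ).integrableOn (integrable_const s),
      integral_const, smul_eq_mul, measureReal_restrict_apply_univ, mul_comm s,
      ← integral_indicator hEm]
    congr 1
    refine integral_congr_ae ?_
    filter_upwards [indicatorConstLp_coeFn (p := 1) (hs := hEm) (hμs := measure_ne_top μ E)
      (c := σ)] with x hx
    rw [hg, hx]
    by_cases hxE : x ∈ E <;> simp [hxE]
  have hint (η : Lp ℝ ⊤ μ) : Integrable (fun x => max (σ * η x - s) 0) μ :=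
    integrable_max_sub ((integrable_of_Lp_top η).const_mul σ) s
  have h1 : ∫ x, max (σ * ω x - s) 0 ∂μ = ∫ x in E, (σ * ω x - s) ∂μ := by
    rw [← integral_indicator hEm]
    refine integral_congr_ae (Eventually.of_forall fun x => ?_)
    by_cases hxE : x ∈ E
    · have h2 : s < σ * ω x := hxE
      simp only [indicator_of_mem hxE]
      exact max_eq_left (by linarith)
    · have h2 : ¬ s < σ * ω x := hxE
      simp only [indicator_of_notMem hxE]
      exact max_eq_right (by linarith)
  rw [h1, hgη, sub_le_iff_le_add]
  refine integral_mul_le_of_mem_weakStarClosure g (fun η hη => ?_) hω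
  rw [← sub_le_iff_le_add, ← hgη]
  refine le_trans ?_ (h η hη)
  calc ∫ x in E, (σ * η x - s) ∂μ ≤ ∫ x in E, max (σ * η x - s) 0 ∂μ :=
        setIntegral_mono (((integrable_of_Lp_top η).const_mul σ).sub
          (integrable_const s)).integrableOn (hint η).integrableOn fun x => le_max_left _ _
    _ ≤ ∫ x, max (σ * η x - s) 0 ∂μ :=
        setIntegral_le_integral (hint η) (Eventually.of_forall fun x => le_max_right _ _)

lemma integral_eq_of_mem_weakStarClosure {S : Set (Lp ℝ ⊤ μ)} {C : ℝ}
    (h : ∀ η ∈ S, ∫ x, η x ∂μ = C) {ω : Lp ℝ ⊤ μ} (hω : ω ∈ weakStarClosure S) :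
    ∫ x, ω x ∂μ = C := by
  have key (σ : ℝ) : σ * ∫ x, ω x ∂μ ≤ σ * C := by
    have hg (η : Lp ℝ ⊤ μ) :
        ∫ x, indicatorConstLp 1 MeasurableSet.univ (measure_ne_top μ univ) σ x * η x ∂μ =
          σ * ∫ x, η x ∂μ := by
      rw [← integral_const_mul]
      refine integral_congr_ae ?_
      filter_upwards [indicatorConstLp_coeFn (p := 1) (hs := MeasurableSet.univ)
        (hμs := measure_ne_top μ univ) (c := σ)] with x hx
      rw [hx]
      simp
    rw [← hg]
    refine integral_mul_le_of_mem_weakStarClosure _ (fun η hη => ?_) hω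
    rw [hg, h η hη]
  linarith [key 1, key (-1)]

lemma norm_le_one_iff_ae_abs_le_one {ω : Lp ℝ ⊤ μ} : ‖ω‖ ≤ 1 ↔ ∀ᵐ x ∂μ, |ω x| ≤ 1 := by
  refine ⟨fun h => ?_, fun h => ?_⟩
  · have h1 := Lp.memLp ω
    filter_upwards [ae_le_eLpNormEssSup (f := ω) (μ := μ)] with x hx
    have h2 : eLpNorm ω ⊤ μ ≤ 1 := by
      rw [Lp.norm_def] at h
      rw [← ENNReal.ofReal_one]
      exact (ENNReal.le_ofReal_iff_toReal_le h1.2.ne zero_le_one).2 h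
    rw [eLpNorm_exponent_top] at h2
    have h3 := hx.trans h2
    rw [← ofReal_norm, ENNReal.ofReal_le_one] at h3
    exact h3
  · exact Lp.norm_le_of_ae_bound zero_le_one h |>.trans (by simp)

end WeakStar

/-! ### The constraints pass to the closure -/

section Inclusion

variable {Λ : AddSubgroup Plane} {M : Set (Surface Λ)}

lemma integral_comp_eq_of_mem_orbit [DiscreteTopology Λ] {ω₀ η : Lp ℝ ⊤ (area M)}
    (hη : η ∈ orbit ω₀) (F : ℝ → ℝ) :
    ∫ x, F (η x) ∂(area M) = ∫ x, F (ω₀ x) ∂(area M) := by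
  obtain ⟨φ, hφ, hηφ⟩ := hη
  rw [← (measurePreserving_of_mem_identityComponent hφ).integral_comp
    φ.measurableEmbedding fun x => F (ω₀ x)]
  refine integral_congr_ae ?_
  filter_upwards [hηφ] with x hx
  rw [hx]

/-- Weak-* limits of rearrangements of `ω₀` lie in the phase space, and satisfy the conservation of
the mean and the inequalities between convex integrals. -/
lemma weakStarClosure_orbit_subset [DiscreteTopology Λ] [IsFiniteMeasure (area M)]
    {ω₀ ω : Lp ℝ ⊤ (area M)} (hω₀ : ω₀ ∈ phaseSpace M) (hω : ω ∈ weakStarClosure (orbit ω₀)) :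
    ω ∈ phaseSpace M ∧ ∫ x, ω x ∂(area M) = ∫ x, ω₀ x ∂(area M) ∧
      ∀ s, ∫ x, max (ω x - s) 0 ∂(area M) ≤ ∫ x, max (ω₀ x - s) 0 ∂(area M) := by
  refine ⟨norm_le_one_iff_ae_abs_le_one.2 ?_, ?_, fun s => ?_⟩
  · have key (σ : ℝ) (hσ : |σ| = 1) : ∀ᵐ x ∂(area M), σ * ω x ≤ 1 := by
      have h0 : ∫ x, max (σ * ω x - 1) 0 ∂(area M) ≤ 0 := by
        refine integral_max_sub_le_of_mem_weakStarClosure (fun η hη => le_of_eq ?_) hω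
        rw [integral_comp_eq_of_mem_orbit hη fun y => max (σ * y - 1) 0]
        refine integral_eq_zero_of_ae ?_
        filter_upwards [norm_le_one_iff_ae_abs_le_one.1 hω₀] with x hx
        refine max_eq_right (sub_nonpos.2 ((le_abs_self _).trans ?_))
        rwa [abs_mul, hσ, one_mul]
      have h1 := (integral_eq_zero_iff_of_nonneg (fun x => le_max_right (σ * ω x - 1) 0)
        (integrable_max_sub ((integrable_of_Lp_top ω).const_mul σ) 1)).1
        (le_antisymm h0 (integral_nonneg fun x => le_max_right _ _))
      filter_upwards [h1] with x hx
      exact sub_nonpos.1 (max_eq_right_iff.1 hx)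
    filter_upwards [key 1 (by simp), key (-1) (by simp)] with x h1 h2
    rw [abs_le]
    constructor <;> linarith
  · exact integral_eq_of_mem_weakStarClosure
      (fun η hη => integral_comp_eq_of_mem_orbit hη fun y => y) hω
  · have h := integral_max_sub_le_of_mem_weakStarClosure (σ := 1) (s := s)
      (fun η hη => (integral_comp_eq_of_mem_orbit hη fun y => max (1 * y - s) 0).le) hω
    simpa only [one_mul] using h

end Inclusion

/-! ### Step functions and averages over cells -/

section Step

variable {α ι : Type*} [Fintype ι] {C : ι → Set α}

/-- The function with the value `c i` on the set `C i`, and zero elsewhere. -/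
def step (C : ι → Set α) (c : ι → ℝ) (x : α) : ℝ := ∑ i, (C i).indicator (fun _ => c i) x

lemma step_of_mem (hd : Pairwise fun i j => Disjoint (C i) (C j)) (c : ι → ℝ) {i : ι} {x : α}
    (hx : x ∈ C i) : step C c x = c i := by
  rw [step, Finset.sum_eq_single i, indicator_of_mem hx]
  · exact fun j _ hji => indicator_of_notMem (fun hj => disjoint_left.1 (hd hji) hj hx) _
  · simp

lemma step_of_notMem (c : ι → ℝ) {x : α} (hx : x ∉ ⋃ i, C i) : step C c x = 0 :=
  Finset.sum_eq_zero fun i _ => indicator_of_notMem (fun hi => hx (mem_iUnion.2 ⟨i, hi⟩)) _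

variable [MeasurableSpace α] {μ : Measure α}

lemma integral_step_mul (hC : ∀ i, MeasurableSet (C i)) (c : ι → ℝ) {u : α → ℝ}
    (hu : Integrable u μ) : ∫ x, step C c x * u x ∂μ = ∑ i, c i * ∫ x in C i, u x ∂μ := by
  simp only [step, Finset.sum_mul]
  have h (i : ι) (x : α) :
      (C i).indicator (fun _ => c i) x * u x = (C i).indicator (fun x => c i * u x) x := by
    by_cases hx : x ∈ C i <;> simp [hx]
  simp only [h]
  rw [integral_finsetSum _ fun i _ => (hu.const_mul (c i)).indicator (hC i)]
  refine Finset.sum_congr rfl fun i _ => ?_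
  rw [integral_indicator (hC i), integral_const_mul]

lemma sum_setIntegral_eq (hC : ∀ i, MeasurableSet (C i))
    (hd : Pairwise fun i j => Disjoint (C i) (C j)) {u : α → ℝ} (hu : Integrable u μ) :
    ∑ i, ∫ x in C i, u x ∂μ = ∫ x in ⋃ i, C i, u x ∂μ :=
  (integral_iUnion_fintype hC hd fun _ => hu.integrableOn).symm

lemma sum_setIntegral_le (hC : ∀ i, MeasurableSet (C i))
    (hd : Pairwise fun i j => Disjoint (C i) (C j)) {u : α → ℝ} (hu : Integrable u μ)
    (hu0 : ∀ x, 0 ≤ u x) : ∑ i, ∫ x in C i, u x ∂μ ≤ ∫ x, u x ∂μ := by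
  rw [sum_setIntegral_eq hC hd hu]
  exact setIntegral_le_integral hu (Eventually.of_forall hu0)

lemma sum_abs_setIntegral_le (hC : ∀ i, MeasurableSet (C i))
    (hd : Pairwise fun i j => Disjoint (C i) (C j)) {u : α → ℝ} (hu : Integrable u μ) :
    ∑ i, |∫ x in C i, u x ∂μ| ≤ ∫ x, |u x| ∂μ :=
  (Finset.sum_le_sum fun _ _ => abs_integral_le_integral_abs).trans
    (sum_setIntegral_le hC hd hu.abs fun _ => abs_nonneg _)

variable [IsFiniteMeasure μ]

lemma integrable_step (hC : ∀ i, MeasurableSet (C i)) (c : ι → ℝ) : Integrable (step C c) μ :=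
  integrable_finsetSum _ fun i _ => (integrable_const (c i)).indicator (hC i)

lemma integral_step (hC : ∀ i, MeasurableSet (C i)) (c : ι → ℝ) :
    ∫ x, step C c x ∂μ = ∑ i, μ.real (C i) * c i := by
  simp only [step]
  rw [integral_finsetSum _ fun i _ => (integrable_const (c i)).indicator (hC i)]
  refine Finset.sum_congr rfl fun i _ => ?_
  rw [integral_indicator (hC i), integral_const, smul_eq_mul, measureReal_restrict_apply_univ]

lemma integral_add_indicator {R : Set α} (hR : MeasurableSet R) {u : α → ℝ} (hu : Integrable u μ)
    (B : ℝ) : ∫ x, (u x + R.indicator (fun _ => B) x) ∂μ = ∫ x, u x ∂μ + B * μ.real R := by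
  rw [integral_add hu ((integrable_const B).indicator hR), integral_indicator hR, integral_const,
    smul_eq_mul, measureReal_restrict_apply_univ, mul_comm]

/-- A function that hardly varies on each of the sets `C i` is approximated by a step function. -/
lemma integral_abs_sub_step_le (hC : ∀ i, MeasurableSet (C i))
    (hd : Pairwise fun i j => Disjoint (C i) (C j)) {f : α → ℝ} (hf : Integrable f μ) {c : ι → ℝ}
    {ε B : ℝ} (hε : 0 ≤ ε) (hB : ∀ x, |f x| ≤ B) (hfc : ∀ i, ∀ x ∈ C i, |f x - c i| ≤ ε) :
    ∫ x, |f x - step C c x| ∂μ ≤ ε * μ.real univ + B * μ.real (⋃ i, C i)ᶜ := by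
  have hR : MeasurableSet (⋃ i, C i)ᶜ := (MeasurableSet.iUnion hC).compl
  calc ∫ x, |f x - step C c x| ∂μ
      ≤ ∫ x, (ε + (⋃ i, C i)ᶜ.indicator (fun _ => B) x) ∂μ := by
        refine integral_mono (hf.sub (integrable_step hC c)).abs
          ((integrable_const ε).add ((integrable_const B).indicator hR)) fun x => ?_
        by_cases hx : x ∈ ⋃ i, C i
        · obtain ⟨i, hi⟩ := mem_iUnion.1 hx
          simp only [indicator_of_notMem (notMem_compl_iff.2 hx), step_of_mem hd c hi, add_zero]
          exact hfc i x hi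
        · simp only [indicator_of_mem (mem_compl hx), step_of_notMem c hx, sub_zero]
          linarith [hB x]
    _ = _ := by
        rw [integral_add_indicator hR (integrable_const ε), integral_const, smul_eq_mul, mul_comm ε]

/-- Integrals against functions that hardly vary on each of the sets `C i` are controlled by the
integrals over these sets. -/
lemma abs_integral_mul_le (hC : ∀ i, MeasurableSet (C i))
    (hd : Pairwise fun i j => Disjoint (C i) (C j)) {f u : α → ℝ} (hf : Integrable f μ) {c : ι → ℝ}
    {ε B K : ℝ} (hε : 0 ≤ ε) (hB : ∀ x, |f x| ≤ B) (hc : ∀ i, |c i| ≤ B)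
    (hfc : ∀ i, ∀ x ∈ C i, |f x - c i| ≤ ε) (hu : Integrable u μ) (huK : ∀ᵐ x ∂μ, |u x| ≤ K) :
    |∫ x, f x * u x ∂μ| ≤
      K * (ε * μ.real univ + B * μ.real (⋃ i, C i)ᶜ) + B * ∑ i, |∫ x in C i, u x ∂μ| := by
  have hfs : Integrable (fun x => f x - step C c x) μ := hf.sub (integrable_step hC c)
  have hprod : Integrable (fun x => (f x - step C c x) * u x) μ :=
    hfs.mul_bdd hu.aestronglyMeasurable huK
  have hprod' : Integrable (fun x => step C c x * u x) μ :=
    (integrable_step hC c).mul_bdd hu.aestronglyMeasurable huK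
  have hsplit : ∫ x, f x * u x ∂μ =
      ∫ x, (f x - step C c x) * u x ∂μ + ∑ i, c i * ∫ x in C i, u x ∂μ := by
    rw [← integral_step_mul hC c hu, ← integral_add hprod hprod']
    exact integral_congr_ae (Eventually.of_forall fun x => by ring)
  rw [hsplit]
  refine (abs_add_le _ _).trans (add_le_add ?_ ?_)
  · by_cases hμ : μ = 0
    · subst hμ
      simp
    have hK : 0 ≤ K := by
      have : (ae μ).NeBot := ae_neBot.2 hμ
      obtain ⟨x, hx⟩ := huK.exists
      exact (abs_nonneg _).trans hx
    calc |∫ x, (f x - step C c x) * u x ∂μ| ≤ ∫ x, |(f x - step C c x) * u x| ∂μ :=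
          abs_integral_le_integral_abs
      _ ≤ ∫ x, K * |f x - step C c x| ∂μ := by
          refine integral_mono_ae hprod.abs (hfs.abs.const_mul K) ?_
          filter_upwards [huK] with x hx
          rw [abs_mul, mul_comm]
          gcongr
      _ ≤ _ := by
          rw [integral_const_mul]
          gcongr
          exact integral_abs_sub_step_le hC hd hf hε hB hfc
  · refine (Finset.abs_sum_le_sum_abs _ _).trans ?_
    rw [Finset.mul_sum]
    refine Finset.sum_le_sum fun i _ => ?_
    rw [abs_mul]
    gcongr
    exact hc i

/-- The averages of `ω` over sets of equal measure are majorized by the values of a step function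
near `f`, up to an error, if `ω` is majorized by `f`. -/
lemma average_majorized (hC : ∀ i, MeasurableSet (C i))
    (hd : Pairwise fun i j => Disjoint (C i) (C j)) {τ : ℝ} (hτ : 0 < τ)
    (hCτ : ∀ i, μ.real (C i) = τ) {ω f : α → ℝ} (hω : Integrable ω μ) (hf : Integrable f μ)
    (hω1 : ∀ᵐ x ∂μ, |ω x| ≤ 1) (heq : ∫ x, ω x ∂μ = ∫ x, f x ∂μ)
    (hle : ∀ s, ∫ x, max (ω x - s) 0 ∂μ ≤ ∫ x, max (f x - s) 0 ∂μ) {c : ι → ℝ} {B e ε : ℝ}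
    (hB : 1 ≤ B) (hcB : ∀ i, |c i| ≤ B) (hfc : ∫ x, |f x - step C c x| ∂μ ≤ e)
    (hε : μ.real (⋃ i, C i)ᶜ ≤ ε) :
    (∀ (I : Finset ι) (k : ι), ∑ i ∈ I, τ⁻¹ * ∫ x in C i, ω x ∂μ ≤
      c k * I.card + ∑ i, max (c i - c k) 0 + (e + B * ε) / τ) ∧
    |∑ i, τ⁻¹ * ∫ x in C i, ω x ∂μ - ∑ i, c i| ≤ (e + B * ε) / τ := by
  have hR : MeasurableSet (⋃ i, C i)ᶜ := (MeasurableSet.iUnion hC).compl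
  have hfs : Integrable (fun x => |f x - step C c x|) μ := (hf.sub (integrable_step hC c)).abs
  constructor
  · intro I k
    set s := c k with hs
    have h1 : ∑ i ∈ I, (∫ x in C i, ω x ∂μ - τ * s) ≤ ∫ x, max (ω x - s) 0 ∂μ := by
      calc ∑ i ∈ I, (∫ x in C i, ω x ∂μ - τ * s)
          ≤ ∑ i ∈ I, ∫ x in C i, max (ω x - s) 0 ∂μ := by
            refine Finset.sum_le_sum fun i _ => ?_
            have : ∫ x in C i, ω x ∂μ - τ * s = ∫ x in C i, (ω x - s) ∂μ := by
              rw [integral_sub hω.integrableOn (integrable_const s), integral_const, smul_eq_mul,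
                measureReal_restrict_apply_univ, hCτ]
            rw [this]
            exact setIntegral_mono (hω.sub (integrable_const s)).integrableOn
              (integrable_max_sub hω s).integrableOn fun x => le_max_left _ _
        _ ≤ ∑ i, ∫ x in C i, max (ω x - s) 0 ∂μ :=
            Finset.sum_le_sum_of_subset_of_nonneg (Finset.subset_univ I) fun i _ _ =>
              integral_nonneg fun x => le_max_right _ _
        _ ≤ ∫ x, max (ω x - s) 0 ∂μ :=
            sum_setIntegral_le hC hd (integrable_max_sub hω s) fun x => le_max_right _ _
    -- On a cell, `(f - s)₊ ≤ (c i - s)₊ + |f - c i|`. Off the cells the step function is zero, and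
    -- `(f - s)₊ ≤ |f| + |s|` with `|s| ≤ B`.
    have h2 : ∫ x, max (f x - s) 0 ∂μ ≤ ∑ i, τ * max (c i - s) 0 + B * ε + e := by
      have hst := integrable_step (μ := μ) hC fun i => max (c i - s) 0
      calc ∫ x, max (f x - s) 0 ∂μ
          ≤ ∫ x, (step C (fun i => max (c i - s) 0) x + |f x - step C c x| +
              (⋃ i, C i)ᶜ.indicator (fun _ => B) x) ∂μ := by
            refine integral_mono (integrable_max_sub hf s)
              ((hst.add hfs).add ((integrable_const B).indicator hR)) fun x => ?_
            have ha := le_abs_self (f x - step C c x)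
            have ha0 := abs_nonneg (f x - step C c x)
            by_cases hx : x ∈ ⋃ i, C i
            · obtain ⟨i, hi⟩ := mem_iUnion.1 hx
              simp only [indicator_of_notMem (notMem_compl_iff.2 hx), step_of_mem hd _ hi,
                add_zero] at ha ha0 ⊢
              exact max_le (by linarith [le_max_left (c i - s) 0])
                (by linarith [le_max_right (c i - s) 0])
            · simp only [indicator_of_mem (mem_compl hx), step_of_notMem _ hx, zero_add] at ha ha0 ⊢
              have hs' := (abs_le.1 (hcB k)).1
              exact max_le (by linarith) (by linarith)
        _ ≤ _ := by
            rw [integral_add_indicator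
              (u := fun x => step C (fun i => max (c i - s) 0) x + |f x - step C c x|) hR
              (hst.add hfs), integral_add hst hfs, integral_step hC]
            simp only [hCτ]
            have : B * μ.real (⋃ i, C i)ᶜ ≤ B * ε := by gcongr
            linarith
    have h3 := (h1.trans (hle s)).trans h2
    rw [Finset.sum_sub_distrib, Finset.sum_const, nsmul_eq_mul, ← Finset.mul_sum] at h3
    rw [← Finset.mul_sum, inv_mul_le_iff₀ hτ]
    have : τ * (s * I.card + ∑ i, max (c i - s) 0 + (e + B * ε) / τ) =
        τ * (s * I.card) + τ * ∑ i, max (c i - s) 0 + (e + B * ε) := by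
      field_simp
    rw [this]
    linarith
  · have h1 : ∑ i, ∫ x in C i, ω x ∂μ = ∫ x, ω x ∂μ - ∫ x in (⋃ i, C i)ᶜ, ω x ∂μ := by
      rw [sum_setIntegral_eq hC hd hω, ← integral_add_compl (MeasurableSet.iUnion hC) hω]
      ring
    have h2 : |∫ x in (⋃ i, C i)ᶜ, ω x ∂μ| ≤ B * ε := by
      have h3 : ‖∫ x in (⋃ i, C i)ᶜ, ω x ∂μ‖ ≤ 1 * μ.real (⋃ i, C i)ᶜ :=
        norm_setIntegral_le_of_norm_le_const_ae (measure_lt_top _ _)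
          (ae_restrict_of_ae hω1)
      have h4 : 0 ≤ μ.real (⋃ i, C i)ᶜ := measureReal_nonneg
      rw [Real.norm_eq_abs] at h3
      nlinarith
    have h3 : |∫ x, f x ∂μ - τ * ∑ i, c i| ≤ e := by
      have : τ * ∑ i, c i = ∫ x, step C c x ∂μ := by
        rw [integral_step hC]
        simp only [hCτ]
        rw [Finset.mul_sum]
      rw [this, ← integral_sub hf (integrable_step hC c)]
      exact abs_integral_le_integral_abs.trans hfc
    rw [← Finset.mul_sum, h1, heq]
    have h4 : τ⁻¹ * (∫ x, f x ∂μ - ∫ x in (⋃ i, C i)ᶜ, ω x ∂μ) - ∑ i, c i =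
        ((∫ x, f x ∂μ - τ * ∑ i, c i) - ∫ x in (⋃ i, C i)ᶜ, ω x ∂μ) / τ := by
      field_simp
      ring
    rw [h4, abs_div, abs_of_pos hτ]
    gcongr
    exact (abs_sub _ _).trans (add_le_add h3 h2)

end Step

/-! ### Division of a cell into strips -/

section Strips

variable {Λ : AddSubgroup Plane} [DiscreteTopology Λ]

/-- A square cell is divided into `J` parallel strips of equal area. -/
lemma exists_strips {δ : ℝ} (hδ : 0 < δ) (hinj : InjOn (proj Λ) (box (diag δ))) {J : ℕ}
    (hJ : 0 < J) :
    ∃ (h : Plane) (d : Fin J → Plane), (∀ k, 0 < h k) ∧ (∀ k, h k ≤ δ) ∧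
      (∀ x j, cell h (x + proj Λ (d j)) ⊆ cell (diag δ) x) ∧
      (∀ x, Pairwise fun j k =>
        Disjoint (cell h (x + proj Λ (d j))) (cell h (x + proj Λ (d k)))) ∧
      ∀ x, surfaceArea Λ (cell h x) = ENNReal.ofReal (4 * δ ^ 2 / J) := by
  have hJ0 : (0 : ℝ) < J := by exact_mod_cast hJ
  have hJ1 : (1 : ℝ) ≤ J := by exact_mod_cast hJ
  set h : Plane := !₂[δ / J, δ] with hh
  have h0 : h 0 = δ / J := rfl
  have h1 : h 1 = δ := rfl
  have hle : ∀ k, h k ≤ δ := by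
    intro k
    fin_cases k
    · exact div_le_self hδ.le hJ1
    · exact le_rfl
  have hpos : ∀ k, 0 < h k := by
    intro k
    fin_cases k
    · exact div_pos hδ hJ0
    · exact hδ
  -- These are the centres of the `J` intervals of length `2δ / J` that divide `(-δ, δ)`.
  set d : Fin J → Plane := fun j => !₂[((2 * j + 1) / J - 1) * δ, 0] with hd
  have d0 (j : Fin J) : d j 0 = ((2 * j + 1) / J - 1) * δ := rfl
  have d1 (j : Fin J) : d j 1 = 0 := rfl
  have hdbox (j : Fin J) : ∀ u ∈ box h, d j + u ∈ box (diag δ) := by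
    intro u hu
    have hu0 := abs_lt.1 (hu 0)
    have hu1 := hu 1
    rw [h0] at hu0
    have hj : (j : ℝ) + 1 ≤ J := by exact_mod_cast j.2
    rw [mem_box_iff (i := 0) (j := 1) (by decide)]
    simp only [PiLp.add_apply, d0, d1, zero_add, diag_apply]
    refine ⟨abs_lt.2 ⟨?_, ?_⟩, hu1⟩
    · have : -δ + δ / J ≤ ((2 * (j : ℝ) + 1) / J - 1) * δ := by
        rw [sub_mul, one_mul, div_mul_eq_mul_div]
        have : δ / J ≤ (2 * (j : ℝ) + 1) * δ / J := by
          gcongr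
          nlinarith [(Nat.cast_nonneg (j : ℕ) : (0 : ℝ) ≤ _)]
        linarith
      linarith
    · have : ((2 * (j : ℝ) + 1) / J - 1) * δ ≤ δ - δ / J := by
        have h2 : (2 * (j : ℝ) + 1) / J ≤ 2 - 1 / J := by
          rw [div_le_iff₀ hJ0, sub_mul, one_div, inv_mul_cancel₀ hJ0.ne']
          linarith
        have h3 := mul_le_mul_of_nonneg_right h2 hδ.le
        have h4 : (2 - 1 / (J : ℝ)) * δ = 2 * δ - δ / J := by ring
        linarith
      linarith
  refine ⟨h, d, hpos, hle, fun x j => cell_add_proj_subset (hdbox j), fun x j k hjk => ?_,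
    fun x => ?_⟩
  · refine disjoint_cell_add_proj hinj (hdbox j) (hdbox k) (i := 0) ?_
    rw [d0, d0, h0]
    have h2 : ((2 * (j : ℝ) + 1) / J - 1) * δ - ((2 * (k : ℝ) + 1) / J - 1) * δ =
        2 * (δ / J) * ((j : ℝ) - k) := by
      field_simp
      ring
    have h3 : (1 : ℝ) ≤ |(j : ℝ) - k| := by
      have : (1 : ℤ) ≤ |((j : ℕ) : ℤ) - ((k : ℕ) : ℤ)| :=
        Int.one_le_abs (sub_ne_zero.2 fun h => hjk (Fin.ext (by exact_mod_cast h)))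
      exact_mod_cast this
    have h4 : 0 < 2 * (δ / J) := by positivity
    rw [h2, abs_mul, abs_of_pos h4]
    nlinarith
  · have hsub : box h ⊆ box (diag δ) := box_mono fun k => by
      rw [diag_apply]
      exact hle k
    rw [surfaceArea_cell (hinj.mono hsub), volume_box h hpos, h0, h1]
    congr 1
    ring

end Strips

/-! ### Cells whose strips can be rearranged -/

section Rearrangement

variable {Λ : AddSubgroup Plane} {M : Set (Surface Λ)}

lemma area_real_preimage (hM : MeasurableSet M) {E : Set (Surface Λ)} (hE : E ⊆ M) :
    (area M).real (Subtype.val ⁻¹' E) = (surfaceArea Λ E).toReal := by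
  rw [measureReal_def, area_apply hM, Subtype.image_preimage_coe, inter_eq_right.2 hE]

/-- A domain is covered, up to a set of small area, by small cells of equal area, which can be
divided into parts that are rearranged arbitrarily, approximately, by area preserving
diffeomorphisms. -/
theorem exists_rearrangeable_cells [DiscreteTopology Λ] (hM : IsSmoothDomain M) {ε r : ℝ} (hε : 0 < ε) (hr : 0 < r) :
    ∃ (ι : Type) (_ : Fintype ι) (x : ι → M) (C : ι → Set M) (τ : ℝ), 0 < τ ∧
      (∀ i, MeasurableSet (C i)) ∧ (Pairwise fun i j => Disjoint (C i) (C j)) ∧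
      (∀ i, (area M).real (C i) = τ) ∧ (area M).real (⋃ i, C i)ᶜ ≤ ε ∧
      (∀ i, ∀ p ∈ C i, dist p (x i) < r) ∧
      ∀ J : ℕ, 0 < J → ∀ σ : Fin J → Equiv.Perm ι, ∃ S : ι × Fin J → Set M,
        (∀ q, MeasurableSet (S q)) ∧ (Pairwise fun q q' => Disjoint (S q) (S q')) ∧
        (∀ q, S q ⊆ C q.1) ∧ (∀ q, (area M).real (S q) = τ / J) ∧
        ∃ φ ∈ identityComponent M,
          (area M).real {p | ∃ q, p ∈ S q ∧ φ p ∉ C (σ q.2 q.1)} ≤ ε := by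
  have hMm := hM.isClosed.measurableSet
  have hfin := isFiniteMeasure_area hM.isCompact
  -- A square cell of half side `δ` lies within `2δ` of its centre, hence `r / 2`.
  obtain ⟨δ, hδ, hδr, hinj, s, x, hdisj, hCM, hcompl, hswap⟩ := exists_grid hM
    (ε := ENNReal.ofReal ε) (by simpa using hε) (show 0 < r / 2 by linarith)
  have hcenter {h : Plane} (hh : ∀ k, 0 < h k) (z : Surface Λ) : z ∈ cell h z :=
    mem_cell.2 ⟨0, fun k => by simpa using hh k, (congrArg _ (QuotientAddGroup.mk_zero Λ)).trans (add_zero z)⟩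
  have hdiag : ∀ k, 0 < diag δ k := fun k => by simpa using hδ
  have hτ (z : Surface Λ) : (surfaceArea Λ (cell (diag δ) z)).toReal = 4 * δ ^ 2 := by
    rw [surfaceArea_cell hinj, volume_box _ hdiag, diag_apply, diag_apply,
      ENNReal.toReal_ofReal (by positivity)]
    ring
  refine ⟨s, inferInstance, fun i => ⟨x i, hCM i (hcenter hdiag _)⟩,
    fun i => Subtype.val ⁻¹' cell (diag δ) (x i), 4 * δ ^ 2, by positivity,
    fun i => measurable_subtype_coe (isOpen_cell _ _).measurableSet,
    fun i j hij => (hdisj hij).preimage _,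
    fun i => by rw [area_real_preimage hMm (hCM i), hτ], ?_, fun i p hp => ?_, fun J hJ σ => ?_⟩
  · rw [measureReal_def, area_apply hMm]
    refine ENNReal.toReal_le_of_le_ofReal hε.le (le_trans (measure_mono ?_) hcompl)
    rintro _ ⟨p, hp, rfl⟩
    refine ⟨p.2, fun hp' => hp ?_⟩
    simpa using hp'
  · obtain ⟨v, hv, hvp⟩ := mem_cell.1 hp
    rw [Subtype.dist_eq, dist_eq_norm, ← hvp, add_sub_cancel_left]
    calc ‖proj Λ v‖ ≤ ‖v‖ := QuotientAddGroup.norm_mk_le_norm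
      _ < 2 * δ := norm_lt_of_mem_box hv
      _ < r := by linarith
  · obtain ⟨h, d, hpos, hle, hsub, hd, harea⟩ := exists_strips hδ hinj hJ
    set y : s × Fin J → Surface Λ := fun q => x q.1 + proj Λ (d q.2) with hy
    have hysub (q : s × Fin J) : cell h (y q) ⊆ cell (diag δ) (x q.1) := hsub _ _
    have hydisj : Pairwise fun q q' => Disjoint (cell h (y q)) (cell h (y q')) := by
      rintro ⟨i, j⟩ ⟨i', j'⟩ hne
      by_cases hi : i = i'
      · subst hi
        exact hd (x i) fun hj => hne (Prod.ext rfl hj)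
      · exact (hdisj hi).mono (hysub _) (hysub _)
    -- Strip `j` of cell `i` goes to strip `j` of cell `σ j i`. Since each `σ j` is a bijection,
    -- this is one permutation of all the strips.
    obtain ⟨T, hT, hTmaps⟩ := exists_approximable_perm hydisj
      (fun q q' hne => hswap q.1 q'.1 _ (hysub q (hcenter hpos _)) _ (hysub q' (hcenter hpos _)) h
        hpos hle (hydisj hne))
      (⟨fun q => (σ q.2 q.1, q.2), fun q => ((σ q.2).symm q.1, q.2), fun q => by simp,
        fun q => by simp⟩ : Equiv.Perm (s × Fin J))
    obtain ⟨φ, hφ, hφT⟩ := hT (ENNReal.ofReal ε) (by simpa using hε)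
    refine ⟨fun q => Subtype.val ⁻¹' cell h (y q),
      fun q => measurable_subtype_coe (isOpen_cell _ _).measurableSet,
      fun q q' hne => (hydisj hne).preimage _, fun q => preimage_mono (hysub q), fun q => ?_,
      φ, hφ, ?_⟩
    · rw [area_real_preimage hMm ((hysub q).trans (hCM _)), harea,
        ENNReal.toReal_ofReal (by positivity)]
    · refine ENNReal.toReal_le_of_le_ofReal hε.le (le_trans (measure_mono ?_) hφT)
      rintro p ⟨q, hpq, hpC⟩ hpT
      have h1 := hTmaps q hpq
      rw [← hpT] at h1
      exact hpC (hysub _ h1)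

end Rearrangement

/-! ### Averages over cells after a rearrangement -/

section Transport

variable {α ι : Type*} [Fintype ι] {C : ι → Set α}

lemma abs_step_le (hd : Pairwise fun i j => Disjoint (C i) (C j)) {c : ι → ℝ} {B : ℝ} (hB : 0 ≤ B)
    (hc : ∀ i, |c i| ≤ B) (x : α) : |step C c x| ≤ B := by
  by_cases hx : x ∈ ⋃ i, C i
  · obtain ⟨i, hi⟩ := mem_iUnion.1 hx
    rw [step_of_mem hd c hi]
    exact hc i
  · rwa [step_of_notMem c hx, abs_zero]

variable [MeasurableSpace α] {μ : Measure α} [IsFiniteMeasure μ]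

lemma measureReal_compl_iUnion {ι : Type*} [Fintype ι] {C : ι → Set α}
    (hC : ∀ i, MeasurableSet (C i))
    (hd : Pairwise fun i j => Disjoint (C i) (C j)) {τ : ℝ} (hCτ : ∀ i, μ.real (C i) = τ) :
    μ.real (⋃ i, C i)ᶜ = μ.real univ - Fintype.card ι * τ := by
  rw [measureReal_compl (MeasurableSet.iUnion hC), measureReal_iUnion_fintype hd hC]
  simp [hCτ]

/-- The integrals over the cells of a rearrangement of a function that is almost constant on each
cell. -/
lemma sum_abs_setIntegral_comp_sub_le (hC : ∀ i, MeasurableSet (C i))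
    (hd : Pairwise fun i j => Disjoint (C i) (C j)) {τ : ℝ} (hCτ : ∀ i, μ.real (C i) = τ) {J : ℕ}
    (hJ : 0 < J) {S : ι × Fin J → Set α} (hS : ∀ q, MeasurableSet (S q))
    (hSd : Pairwise fun q q' => Disjoint (S q) (S q')) (hSC : ∀ q, S q ⊆ C q.1)
    (hSτ : ∀ q, μ.real (S q) = τ / J) {σ : Fin J → Equiv.Perm ι} {φ : α → α}
    (hφ : MeasurePreserving φ μ μ) (hφe : MeasurableEmbedding φ) {f : α → ℝ} (hf : Integrable f μ)
    {c : ι → ℝ} {B e ε : ℝ} (hB : 0 ≤ B) (hc : ∀ i, |c i| ≤ B)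
    (hfc : ∫ x, |f x - step C c x| ∂μ ≤ e) (hε : μ.real (⋃ i, C i)ᶜ ≤ ε)
    (hbad : μ.real {p | ∃ q, p ∈ S q ∧ φ p ∉ C (σ q.2 q.1)} ≤ ε) :
    ∑ i, |∫ x in C i, f (φ x) ∂μ - τ * ((J : ℝ)⁻¹ * ∑ j, c (σ j i))| ≤ e + 3 * B * ε := by
  set Z : Set α := {p | ∃ q, p ∈ S q ∧ φ p ∉ C (σ q.2 q.1)} with hZ
  have hZm : MeasurableSet Z := by
    have : Z = ⋃ q, S q ∩ φ ⁻¹' (C (σ q.2 q.1))ᶜ := by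
      ext p
      simp [hZ]
    rw [this]
    exact MeasurableSet.iUnion fun q => (hS q).inter (hφ.measurable (hC _).compl)
  have hR : MeasurableSet (⋃ q, S q)ᶜ := (MeasurableSet.iUnion hS).compl
  -- The strips have the same total area as the cells.
  have hRε : μ.real (⋃ q, S q)ᶜ ≤ ε := by
    rw [measureReal_compl_iUnion hC hd hCτ] at hε
    rw [measureReal_compl_iUnion hS hSd hSτ]
    have hJ0 : (J : ℝ) ≠ 0 := by exact_mod_cast hJ.ne'
    have : (Fintype.card (ι × Fin J) : ℝ) * (τ / J) = Fintype.card ι * τ := by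
      rw [Fintype.card_prod, Fintype.card_fin, Nat.cast_mul]
      field_simp
    rwa [this]
  -- This is the ideal profile of `f ∘ φ`: on strip `j` of cell `i` it has the value of the target
  -- cell, so its mean over cell `i` is the average of the `c (σ j i)`.
  set k : α → ℝ := step S fun q => c (σ q.2 q.1) with hk
  have hki : Integrable k μ := integrable_step hS _
  have hFi : Integrable (fun x => step C c (φ x)) μ :=
    hφ.integrable_comp_of_integrable (integrable_step hC c)
  have hfi : Integrable (fun x => f (φ x)) μ := hφ.integrable_comp_of_integrable hf
  have hkC (i : ι) : ∫ x in C i, k x ∂μ = τ * ((J : ℝ)⁻¹ * ∑ j, c (σ j i)) := by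
    have hSi : Pairwise fun j j' : Fin J => Disjoint (S (i, j)) (S (i, j')) := fun j j' hne =>
      hSd fun h => hne (congrArg Prod.snd h)
    have h1 : ∫ x in C i, k x ∂μ =
        ∫ x in C i, step (fun j => S (i, j)) (fun j => c (σ j i)) x ∂μ := by
      refine setIntegral_congr_fun (hC i) fun x hx => ?_
      by_cases hxS : x ∈ ⋃ j, S (i, j)
      · obtain ⟨j, hj⟩ := mem_iUnion.1 hxS
        rw [step_of_mem hSi _ hj]
        exact step_of_mem hSd (fun q => c (σ q.2 q.1)) hj
      · rw [step_of_notMem _ hxS]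
        refine step_of_notMem _ fun hx' => ?_
        obtain ⟨⟨i', j⟩, hj⟩ := mem_iUnion.1 hx'
        obtain rfl : i' = i := by
          by_contra hne
          exact disjoint_left.1 (hd hne) (hSC _ hj) hx
        exact hxS (mem_iUnion.2 ⟨j, hj⟩)
    rw [h1, setIntegral_eq_integral_of_forall_compl_eq_zero, integral_step fun j => hS (i, j)]
    · simp only [hSτ]
      rw [← Finset.mul_sum]
      ring
    · intro x hx
      refine step_of_notMem _ fun hx' => ?_
      obtain ⟨j, hj⟩ := mem_iUnion.1 hx'
      exact hx (hSC _ hj)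
  -- The distance of `f` from its step function is unchanged by `φ`. To it come `2B` on the bad set
  -- `Z` and `B` off the strips, where `k` vanishes.
  have hmain : ∫ x, |f (φ x) - k x| ∂μ ≤ e + 3 * B * ε := by
    calc ∫ x, |f (φ x) - k x| ∂μ
        ≤ ∫ x, (|f (φ x) - step C c (φ x)| + Z.indicator (fun _ => 2 * B) x +
            (⋃ q, S q)ᶜ.indicator (fun _ => B) x) ∂μ := by
          refine integral_mono (hfi.sub hki).abs (((hfi.sub hFi).abs.add
            ((integrable_const _).indicator hZm)).add ((integrable_const _).indicator hR))
            fun x => ?_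
          have h1 := abs_sub_le (f (φ x)) (step C c (φ x)) (k x)
          have h2 := abs_step_le hd hB hc (φ x)
          by_cases hx : x ∈ ⋃ q, S q
          · obtain ⟨q, hq⟩ := mem_iUnion.1 hx
            have hkx : k x = c (σ q.2 q.1) := step_of_mem hSd (fun q => c (σ q.2 q.1)) hq
            simp only [indicator_of_notMem (notMem_compl_iff.2 hx), add_zero]
            by_cases hxZ : x ∈ Z
            · rw [indicator_of_mem hxZ]
              have h3 := abs_sub (step C c (φ x)) (k x)
              rw [hkx] at h1 h3 ⊢
              linarith [hc (σ q.2 q.1)]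
            · have h4 : φ x ∈ C (σ q.2 q.1) := by
                by_contra h
                exact hxZ ⟨q, hq, h⟩
              rw [indicator_of_notMem hxZ, hkx, step_of_mem hd c h4, add_zero]
          · have hxZ : x ∉ Z := fun ⟨q, hq, _⟩ => hx (mem_iUnion.2 ⟨q, hq⟩)
            have hkx : k x = 0 := step_of_notMem _ hx
            simp only [indicator_of_mem (mem_compl hx), indicator_of_notMem hxZ, add_zero]
            simp only [hkx, sub_zero] at h1 ⊢
            linarith
      _ = ∫ x, |f x - step C c x| ∂μ + 2 * B * μ.real Z + B * μ.real (⋃ q, S q)ᶜ := by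
          rw [integral_add_indicator
              (u := fun x => |f (φ x) - step C c (φ x)| + Z.indicator (fun _ => 2 * B) x) hR
              ((hfi.sub hFi).abs.add ((integrable_const _).indicator hZm)),
            integral_add_indicator (u := fun x => |f (φ x) - step C c (φ x)|) hZm (hfi.sub hFi).abs,
            hφ.integral_comp hφe fun x => |f x - step C c x|]
      _ ≤ e + 2 * B * ε + B * ε := by gcongr
      _ = e + 3 * B * ε := by ring
  refine le_trans (le_of_eq ?_)
    ((sum_abs_setIntegral_le hC hd (hfi.sub hki)).trans hmain)
  refine Finset.sum_congr rfl fun i _ => ?_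
  rw [← hkC, ← integral_sub hfi.integrableOn hki.integrableOn]
  rfl

end Transport

/-! ### Functions majorized by the patch lie in the closure -/

section Density

variable {Λ : AddSubgroup Plane} [DiscreteTopology Λ] {M : Set (Surface Λ)}

/-- A function `ω` that is majorized by `f` has, on a fine grid, nearly the same averages as some
rearrangement of `f`. -/
theorem exists_rearrangement_near (hM : IsSmoothDomain M) {ω f : M → ℝ}
    (hω : Integrable ω (area M)) (hf : Integrable f (area M)) (hω1 : ∀ᵐ x ∂(area M), |ω x| ≤ 1)
    (heq : ∫ x, ω x ∂(area M) = ∫ x, f x ∂(area M))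
    (hle : ∀ s, ∫ x, max (ω x - s) 0 ∂(area M) ≤ ∫ x, max (f x - s) 0 ∂(area M)) {f₀ : M → ℝ}
    (hf₀ : Integrable f₀ (area M)) {B e ε r : ℝ} (hB : 1 ≤ B) (hε : 0 < ε) (hr : 0 < r)
    (hf₀B : ∀ x, |f₀ x| ≤ B) (hff₀ : ∫ x, |f x - f₀ x| ∂(area M) ≤ e)
    (hf₀r : ∀ p q, dist p q < r → |f₀ p - f₀ q| ≤ ε) :
    ∃ φ ∈ identityComponent M, ∃ (ι : Type) (_ : Fintype ι) (x : ι → M) (C : ι → Set M),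
      (∀ i, MeasurableSet (C i)) ∧ (Pairwise fun i j => Disjoint (C i) (C j)) ∧
      (area M).real (⋃ i, C i)ᶜ ≤ ε ∧ (∀ i, ∀ p ∈ C i, dist p (x i) < r) ∧
      ∑ i, |∫ p in C i, (f (φ p) - ω p) ∂(area M)| ≤
        4 * (e + (ε * (area M).real univ + B * ε)) + 6 * B * ε + ε := by
  have hfin := isFiniteMeasure_area hM.isCompact
  obtain ⟨ι, hι, x, C, τ, hτ, hC, hd, hCτ, hcompl, hdist, hS⟩ := exists_rearrangeable_cells hM hε hr
  set c : ι → ℝ := fun i => f₀ (x i) with hc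
  have hB0 : 0 ≤ B := zero_le_one.trans hB
  set e' := e + (ε * (area M).real univ + B * ε) with he'
  have hfc : ∫ x, |f x - step C c x| ∂(area M) ≤ e' := by
    calc ∫ x, |f x - step C c x| ∂(area M)
        ≤ ∫ x, (|f x - f₀ x| + |f₀ x - step C c x|) ∂(area M) :=
          integral_mono (hf.sub (integrable_step hC c)).abs
            ((hf.sub hf₀).abs.add (hf₀.sub (integrable_step hC c)).abs)
            fun x => abs_sub_le _ _ _
      _ = ∫ x, |f x - f₀ x| ∂(area M) + ∫ x, |f₀ x - step C c x| ∂(area M) :=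
          integral_add (hf.sub hf₀).abs (hf₀.sub (integrable_step hC c)).abs
      _ ≤ e' := by
          refine add_le_add hff₀ ((integral_abs_sub_step_le hC hd hf₀ hε.le hf₀B
            fun i p hp => hf₀r _ _ (hdist i p hp)).trans ?_)
          gcongr
  have he'0 : 0 ≤ e' := (integral_nonneg fun _ => abs_nonneg _).trans hfc
  obtain ⟨h1, h2⟩ := average_majorized hC hd hτ hCτ hω hf hω1 heq hle hB (fun i => hf₀B (x i)) hfc
    hcompl
  -- The errors carry a factor `1 / τ`, which disappears when averages are turned back into
  -- integrals over cells of area `τ`.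
  obtain ⟨J, hJ, σ, hσ⟩ := exists_average_perm (by positivity) (div_pos hε hτ) h1 h2
  obtain ⟨S, hSm, hSd, hSC, hSτ, φ, hφ, hbad⟩ := hS J hJ σ
  have hφm := measurePreserving_of_mem_identityComponent hφ
  refine ⟨φ, hφ, ι, hι, x, C, hC, hd, hcompl, hdist, ?_⟩
  have h3 := sum_abs_setIntegral_comp_sub_le hC hd hCτ hJ hSm hSd hSC hSτ hφm
    φ.measurableEmbedding hf hB0 (fun i => hf₀B (x i)) hfc hcompl hbad
  have hfφ : Integrable (fun p => f (φ p)) (area M) := hφm.integrable_comp_of_integrable hf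
  calc ∑ i, |∫ p in C i, (f (φ p) - ω p) ∂(area M)|
      ≤ ∑ i, (|∫ p in C i, f (φ p) ∂(area M) - τ * ((J : ℝ)⁻¹ * ∑ j, c (σ j i))| +
          τ * |τ⁻¹ * ∫ p in C i, ω p ∂(area M) - (J : ℝ)⁻¹ * ∑ j, c (σ j i)|) := by
        refine Finset.sum_le_sum fun i _ => ?_
        rw [integral_sub hfφ.integrableOn hω.integrableOn]
        refine (abs_sub_le _ (τ * ((J : ℝ)⁻¹ * ∑ j, c (σ j i))) _).trans
          (add_le_add le_rfl (le_of_eq ?_))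
        rw [abs_sub_comm, ← abs_of_pos hτ, ← abs_mul, abs_of_pos hτ, mul_sub,
          mul_inv_cancel_left₀ hτ.ne']
    _ ≤ (e' + 3 * B * ε) + τ * (3 * ((e' + B * ε) / τ) + ε / τ) := by
        rw [Finset.sum_add_distrib, ← Finset.mul_sum]
        gcongr
    _ = 4 * e' + 6 * B * ε + ε := by
        field_simp
        ring

/-- The weak-* closure of the orbit of `ω₀` contains all functions majorized by `ω₀`. -/
theorem mem_weakStarClosure_orbit (hM : IsSmoothDomain M) {ω₀ ω : Lp ℝ ⊤ (area M)}
    (hω₀ : ω₀ ∈ phaseSpace M) (hω : ω ∈ phaseSpace M)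
    (heq : ∫ x, ω x ∂(area M) = ∫ x, ω₀ x ∂(area M))
    (hle : ∀ s, ∫ x, max (ω x - s) 0 ∂(area M) ≤ ∫ x, max (ω₀ x - s) 0 ∂(area M)) :
    ω ∈ weakStarClosure (orbit ω₀) := by
  have hfin := isFiniteMeasure_area hM.isCompact
  have hcomp : CompactSpace M := isCompact_iff_compactSpace.1 hM.isCompact
  refine mem_weakStarClosure fun I hI θ hθ => ?_
  have hω1 := norm_le_one_iff_ae_abs_le_one.1 hω
  have hω₀1 := norm_le_one_iff_ae_abs_le_one.1 hω₀
  -- Test functions and `ω₀` are replaced by continuous functions. The error `θ / 8` is doubled by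
  -- `|u| ≤ 2`; the error `θ / (16 (b + 1))` for `ω₀` will be multiplied by `4b`. Each contributes
  -- at most `θ / 4`.
  choose G hG hGi using fun g : Lp ℝ 1 (area M) =>
    ((Lp.memLp g).integrable le_rfl).exists_boundedContinuous_integral_sub_le
      (show 0 < θ / 8 by linarith)
  obtain ⟨b, hb0, hb⟩ : ∃ b : ℝ, 0 ≤ b ∧ ∀ g ∈ I, ‖G g‖ ≤ b := by
    obtain ⟨b, hb⟩ := (hI.image fun g => ‖G g‖).bddAbove
    exact ⟨max b 0, le_max_right _ _, fun g hg =>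
      (hb (mem_image_of_mem _ hg)).trans (le_max_left _ _)⟩
  obtain ⟨f₀, hf₀, hf₀i⟩ := (integrable_of_Lp_top ω₀).exists_boundedContinuous_integral_sub_le
    (show 0 < θ / (16 * (b + 1)) by positivity)
  set m := (area M).real univ with hm
  have hm0 : 0 ≤ m := measureReal_nonneg
  set B := max 1 ‖f₀‖ with hB
  have hB1 : 1 ≤ B := le_max_left _ _
  -- `K` collects the coefficients of `ε` in the final estimate, so that they too contribute at most
  -- `θ / 4`.
  set K := 2 * (m + b) + b * (4 * m + 10 * B + 1) with hK
  have hK0 : 0 ≤ K := by positivity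
  set ε := θ / (4 * (K + 1)) with hε
  have hε0 : 0 < ε := by positivity
  have hunif (F : BoundedContinuousFunction M ℝ) :
      ∀ᶠ r in 𝓝[>] (0 : ℝ), ∀ p q, dist p q < r → |F p - F q| ≤ ε := by
    obtain ⟨r, hr, h⟩ := Metric.uniformContinuous_iff.1
      (CompactSpace.uniformContinuous_of_continuous F.continuous) ε hε0
    filter_upwards [Ioo_mem_nhdsGT hr] with r' hr' p q hpq
    exact (h (hpq.trans hr'.2)).le
  obtain ⟨r, ⟨hr1, hr2⟩, hr3⟩ := (((hunif f₀).and
    ((eventually_all_finite hI).2 fun g _ => hunif (G g))).and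
    self_mem_nhdsWithin).exists
  obtain ⟨φ, hφ, ι, _, x, C, hC, hd, hcompl, hdist, hsum⟩ := exists_rearrangement_near hM
    (integrable_of_Lp_top ω) (integrable_of_Lp_top ω₀) hω1 heq hle hf₀i hB1 hε0 hr3
    (fun x => (f₀.norm_coe_le_norm x).trans (le_max_right _ _)) hf₀ hr1
  have hφm := measurePreserving_of_mem_identityComponent hφ
  set η := Lp.compMeasurePreserving φ hφm ω₀ with hη
  have hηφ : η =ᵐ[area M] fun x => ω₀ (φ x) := Lp.coeFn_compMeasurePreserving ω₀ hφm
  refine ⟨η, ⟨φ, hφ, hηφ⟩, fun g hg => ?_⟩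
  set u : M → ℝ := fun x => ω₀ (φ x) - ω x with hu
  have hui : Integrable u (area M) :=
    (hφm.integrable_comp_of_integrable (integrable_of_Lp_top ω₀)).sub (integrable_of_Lp_top ω)
  have hu2 : ∀ᵐ x ∂(area M), |u x| ≤ 2 := by
    filter_upwards [hω1, hφm.quasiMeasurePreserving.ae hω₀1] with x h1 h2
    exact (abs_sub _ _).trans (by linarith)
  have hgi : Integrable g (area M) := (Lp.memLp g).integrable le_rfl
  have hdiff : Integrable (fun x => (g x - G g x) * u x) (area M) :=
    (hgi.sub (hGi g)).mul_bdd hui.aestronglyMeasurable hu2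
  have hGu : Integrable (fun x => G g x * u x) (area M) :=
    (hGi g).mul_bdd hui.aestronglyMeasurable hu2
  have hgη : Integrable (fun x => g x * η x) (area M) :=
    hgi.mul_bdd (Lp.aestronglyMeasurable η) (c := 1) (by
      filter_upwards [hηφ, hφm.quasiMeasurePreserving.ae hω₀1] with x h1 h2
      rw [h1]
      exact h2)
  have hgω : Integrable (fun x => g x * ω x) (area M) :=
    hgi.mul_bdd (Lp.aestronglyMeasurable ω) hω1
  have hsplit : ∫ x, g x * η x ∂(area M) - ∫ x, g x * ω x ∂(area M) =
      ∫ x, (g x - G g x) * u x ∂(area M) + ∫ x, G g x * u x ∂(area M) := by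
    rw [← integral_add hdiff hGu, ← integral_sub hgη hgω]
    refine integral_congr_ae ?_
    filter_upwards [hηφ] with x hx
    rw [hx, hu]
    ring
  have h1 : |∫ x, (g x - G g x) * u x ∂(area M)| ≤ 2 * (θ / 8) := by
    calc |∫ x, (g x - G g x) * u x ∂(area M)| ≤ ∫ x, |(g x - G g x) * u x| ∂(area M) :=
          abs_integral_le_integral_abs
      _ ≤ ∫ x, 2 * |g x - G g x| ∂(area M) := by
          refine integral_mono_ae hdiff.abs ((hgi.sub (hGi g)).abs.const_mul 2) ?_
          filter_upwards [hu2] with x hx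
          rw [abs_mul, mul_comm]
          gcongr
      _ ≤ 2 * (θ / 8) := by
          rw [integral_const_mul]
          gcongr
          exact hG g
  have h2 : |∫ x, G g x * u x ∂(area M)| ≤
      2 * (ε * m + b * ε) + b * (4 * (θ / (16 * (b + 1)) + (ε * m + B * ε)) + 6 * B * ε + ε) := by
    have hGb (x : M) : |G g x| ≤ b := ((G g).norm_coe_le_norm x).trans (hb g hg)
    refine (abs_integral_mul_le hC hd (hGi g) (c := fun i => G g (x i)) hε0.le hGb
      (fun i => hGb _) (fun i p hp => hr2 g hg _ _ (hdist i p hp)) hui hu2).trans ?_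
    gcongr
  have h3 : b * (4 * (θ / (16 * (b + 1)))) ≤ θ / 4 := by
    rw [mul_div_assoc', mul_div_assoc', div_le_div_iff₀ (by positivity) (by positivity)]
    nlinarith
  have h4 : K * ε ≤ θ / 4 := by
    rw [hε, mul_div_assoc', div_le_div_iff₀ (by positivity) (by positivity)]
    nlinarith
  rw [hsplit]
  refine (abs_add_le _ _).trans_lt ?_
  have h5 : 2 * (ε * m + b * ε) + b * (4 * (θ / (16 * (b + 1)) + (ε * m + B * ε)) + 6 * B * ε + ε) =
      K * ε + b * (4 * (θ / (16 * (b + 1)))) := by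
    rw [hK]
    ring
  linarith

end Density

/-! ### The values of the patch, and the conclusion -/

section Values

/-- The values of a simple function. -/
lemma ae_exists_eq_of_ae_eq_sum_indicator {α ι : Type*} [Fintype ι] [MeasurableSpace α]
    {μ : Measure α} {A : ι → Set α} (hdisj : Pairwise fun i j => AEDisjoint μ (A i) (A j))
    (hcover : (⋃ i, A i) =ᵐ[μ] (univ : Set α)) {a : ι → ℝ} {f : α → ℝ}
    (hf : f =ᵐ[μ] fun x => ∑ i, (A i).indicator (fun _ => a i) x) : ∀ᵐ x ∂μ, ∃ i, f x = a i := by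
  have hd : ∀ᵐ x ∂μ, ∀ i j, i ≠ j → x ∉ A i ∩ A j :=
    ae_all_iff.2 fun i => ae_all_iff.2 fun j => by
      by_cases hij : i = j
      · exact Eventually.of_forall fun x h => absurd hij h
      · filter_upwards [measure_eq_zero_iff_ae_notMem.1 (hdisj hij)] with x hx _ using hx
  filter_upwards [hf, hcover.mem_iff, hd] with x hx hxc hxd
  obtain ⟨i, hi⟩ := mem_iUnion.1 (hxc.2 (mem_univ x))
  refine ⟨i, ?_⟩
  rw [hx, Finset.sum_eq_single i, indicator_of_mem hi]
  · exact fun j _ hji => indicator_of_notMem (fun hj => hxd j i hji ⟨hj, hi⟩) _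
  · simp

end Values

end VortexPatch

end

theorem propositionA1 (Λ : AddSubgroup Plane) [DiscreteTopology Λ]
    (M : Set (Surface Λ)) (hM : IsSmoothDomain M)
    (N : ℕ) (a : Fin N → ℝ) (ha : Function.Injective a)
    (A : Fin N → Set M) (hA : ∀ i, NullMeasurableSet (A i) (area M))
    (hdisj : Pairwise fun i j => AEDisjoint (area M) (A i) (A j))
    (hcover : (⋃ i, A i) =ᵐ[area M] (univ : Set M))
    (ω₀ : Lp ℝ ⊤ (area M)) (hω₀ : ω₀ ∈ phaseSpace M)
    (hpatch : ω₀ =ᵐ[area M] fun x => ∑ i, (A i).indicator (fun _ => a i) x) :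
    weakStarClosure (orbit ω₀) =
      {ω | ω ∈ phaseSpace M ∧
        ∫ x, ω x ∂(area M) = ∫ x, ω₀ x ∂(area M) ∧
        ∀ i, ∫ x, max (ω x - a i) 0 ∂(area M) ≤ ∫ x, max (ω₀ x - a i) 0 ∂(area M)} := by
  have hfin := isFiniteMeasure_area hM.isCompact
  refine Subset.antisymm (fun ω hω => ?_) fun ω ⟨hω, heq, hle⟩ => ?_
  · obtain ⟨h1, h2, h3⟩ := weakStarClosure_orbit_subset hω₀ hω
    exact ⟨h1, h2, fun i => h3 (a i)⟩
  · exact mem_weakStarClosure_orbit hM hω₀ hω heq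
      (integral_max_sub_le_of_forall_value (integrable_of_Lp_top ω) (integrable_of_Lp_top ω₀)
        (ae_exists_eq_of_ae_eq_sum_indicator hdisj hcover hpatch) hle)
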